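/- Let $E$ be a real Banach space, $H$ a real Hilbert space, $B\in\mathscr L(H,E)$, and let $A$ be the generator of a $C_0$-semigroup $S=\{S(t)\}_{t\ge 0}$ on $E$. For $t\ge 0$ let $Q_t$ be given by $$\langle Q_t x^*,y^*\rangle=\int_0^t\langle S(s)BB^*S^*(s)x^*,y^*\rangle\,ds,\qquad x^*,y^*\in E^*,$$ and assume that for every $t\ge 0$ there is a centred Gaussian Radon measure $\mu_t$ on $E$ with covariance operator $Q_t$. Assume that the limit $Q_\infty:=\lim_{t\to\infty}Q_t$ exists in the weak operator topology of $\mathscr L(E^*,E)$ and that it is the covariance operator of a centred Gaussian Radon measure $\mu_\infty$ on $E$. Let $P=\{P(t)\}_{t\ge0}$ be the Ornstein--Uhlenbeck semigroup $$P(t)f(x)=\int_E f(S(t)x+y)\,d\mu_t(y)$$ on bounded continuous functions $f$, extended by continuity to the complex space $L^1(E,\mu_\infty)$, and let $L_P$ be its generator there. Let $E_\infty$ be the closure in $E$ of the range of $Q_\infty$, and let $A_\infty$ be the part of $A$ in $E_\infty$, that is, $D(A_\infty)=\{x\in E_\infty\cap D(A): Ax\in E_\infty\}$ and $A_\infty x=Ax$.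 Assume that $S$ is eventually compact and that $\sigma(A_\infty)\neq\emptyset$, where $\sigma(A_\infty)$ is the spectrum of the complexification of $A_\infty$ (if $\mu_\infty$ is nondegenerate, i.e. $E_\infty=E$, this says that $\sigma(A)\ne\emptyset$). Then $$\sigma(L_P)=\mathbb C^-:=\{\lambda\in\mathbb C:\ \operatorname{Re}\lambda\le 0\}\quad\text{in } L^1(E,\mu_\infty),$$ and every $\lambda\in\mathbb C$ with $\operatorname{Re}\lambda<0$ is an eigenvalue of $L_P$. -/

import Mathlib

open MeasureTheory ProbabilityTheory Filter Topology BoundedContinuousFunction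
open scoped NNReal ENNReal

namespace OrnsteinUhlenbeck

noncomputable section

/-! ### Semigroups, generators, spectra -/

/-- A `C₀`-semigroup of bounded operators on a Banach space `X`. -/
structure C0Semigroup (𝕜 X : Type*) [RCLike 𝕜] [NormedAddCommGroup X] [NormedSpace 𝕜 X] where
  /-- the operator at time `t` -/
  op : ℝ≥0 → X →L[𝕜] X
  op_zero : op 0 = ContinuousLinearMap.id 𝕜 X
  op_add : ∀ s t, op (s + t) = (op s).comp (op t)
  tendsto_zero : ∀ x, Tendsto (fun t => op t x) (𝓝 0) (𝓝 x)

section Generator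

variable {𝕜 X Y : Type*} [RCLike 𝕜] [NormedAddCommGroup X] [NormedSpace 𝕜 X]
  [NormedAddCommGroup Y] [NormedSpace 𝕜 Y]

/-- `S(t)` is a compact operator for some `t > 0` (hence for all larger times, if `S` is a
semigroup). -/
def EventuallyCompact (S : C0Semigroup 𝕜 X) : Prop :=
  ∃ t : ℝ≥0, 0 < t ∧ IsCompactOperator (S.op t)

/-- `y = lim_{t ↓ 0} (T(t) x - x) / t` in norm. -/
def IsGeneratorValue (T : ℝ≥0 → X →L[𝕜] X) (x y : X) : Prop :=
  Tendsto (fun t : ℝ≥0 => ((t : ℝ) : 𝕜)⁻¹ • (T t x - x)) (𝓝[>] 0) (𝓝 y)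

theorem IsGeneratorValue.unique {T : ℝ≥0 → X →L[𝕜] X} {x y z : X}
    (h : IsGeneratorValue T x y) (h' : IsGeneratorValue T x z) : y = z :=
  tendsto_nhds_unique h h'

theorem IsGeneratorValue.add {T : ℝ≥0 → X →L[𝕜] X} {x x' y y' : X}
    (h : IsGeneratorValue T x y) (h' : IsGeneratorValue T x' y') :
    IsGeneratorValue T (x + x') (y + y') := by
  refine (Tendsto.add h h').congr fun t => ?_
  rw [map_add, ← smul_add]
  congr 1
  abel

theorem IsGeneratorValue.smul {T : ℝ≥0 → X →L[𝕜] X} {x y : X} (c : 𝕜)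
    (h : IsGeneratorValue T x y) : IsGeneratorValue T (c • x) (c • y) := by
  refine (Tendsto.const_smul h c).congr fun t => ?_
  rw [map_smul, ← smul_sub, smul_comm]

/-- The generator of a one-parameter family of operators: its domain consists of the `x` for which
`lim_{t ↓ 0} (T(t) x - x) / t` exists, and its value at `x` is this limit. -/
def generator (T : ℝ≥0 → X →L[𝕜] X) : X →ₗ.[𝕜] X where
  domain :=
    { carrier := {x | ∃ y, IsGeneratorValue T x y}
      add_mem' := by
        rintro a b ⟨y, hy⟩ ⟨z, hz⟩
        exact ⟨y + z, hy.add hz⟩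
      zero_mem' := ⟨0, by simp [IsGeneratorValue]⟩
      smul_mem' := by
        rintro c a ⟨y, hy⟩
        exact ⟨c • y, hy.smul c⟩ }
  toFun :=
    { toFun := fun x => x.2.choose
      map_add' := fun a b =>
        (a + b).2.choose_spec.unique (a.2.choose_spec.add b.2.choose_spec)
      map_smul' := fun c a => (c • a).2.choose_spec.unique (a.2.choose_spec.smul c) }

/-- `T` is a bijection of its domain onto `Y`, with bounded inverse. -/
def HasBoundedInverse (T : X →ₗ.[𝕜] Y) : Prop :=
  ∃ R : Y →L[𝕜] X,
    (∀ y, ∃ h : R y ∈ T.domain, T ⟨R y, h⟩ = y) ∧ ∀ x : T.domain, R (T x) = x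

/-- The part of the operator `A` in the subspace `F`: its domain is
`{x ∈ F : x ∈ D(A), A x ∈ F}`. -/
def partIn (A : X →ₗ.[𝕜] X) (F : Submodule 𝕜 X) : F →ₗ.[𝕜] F where
  domain :=
    { carrier := {x | ∃ h : (x : X) ∈ A.domain, A ⟨x, h⟩ ∈ F}
      add_mem' := by
        rintro a b ⟨ha, ha'⟩ ⟨hb, hb'⟩
        refine ⟨A.domain.add_mem ha hb, ?_⟩
        have := A.map_add ⟨a, ha⟩ ⟨b, hb⟩
        exact this ▸ F.add_mem ha' hb'
      zero_mem' := ⟨A.domain.zero_mem, by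
        have := A.map_zero
        exact this ▸ F.zero_mem⟩
      smul_mem' := by
        rintro c a ⟨ha, ha'⟩
        refine ⟨A.domain.smul_mem c ha, ?_⟩
        have := A.map_smul c ⟨a, ha⟩
        exact this ▸ F.smul_mem c ha' }
  toFun :=
    { toFun := fun x => ⟨A ⟨x.1, x.2.1⟩, x.2.2⟩
      map_add' := fun a b => Subtype.ext (A.map_add ⟨a.1, a.2.1⟩ ⟨b.1, b.2.1⟩)
      map_smul' := fun c a => Subtype.ext (A.map_smul c ⟨a.1, a.2.1⟩) }

end Generator

section Spectrum

/-- The operator `z - L` with domain `D(L)`, in a complex Banach space. -/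
def shift {X : Type*} [NormedAddCommGroup X] [NormedSpace ℂ X] (L : X →ₗ.[ℂ] X) (z : ℂ) :
    X →ₗ.[ℂ] X where
  domain := L.domain
  toFun := z • L.domain.subtype - L.toFun

/-- The spectrum of an unbounded operator in a complex Banach space. -/
def spec {X : Type*} [NormedAddCommGroup X] [NormedSpace ℂ X] (L : X →ₗ.[ℂ] X) : Set ℂ :=
  {z | ¬ HasBoundedInverse (shift L z)}

/-- `z` is an eigenvalue of the unbounded operator `L`. -/
def IsEigenvalue {X : Type*} [NormedAddCommGroup X] [NormedSpace ℂ X] (L : X →ₗ.[ℂ] X)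
    (z : ℂ) : Prop :=
  ∃ f : L.domain, (f : X) ≠ 0 ∧ L f = z • (f : X)

/-- The operator `z - A_ℂ`, where `A_ℂ` is the complexification of an operator `A` in a real Banach
space `X`. Here the pair `(x, y)` stands for the element `x + i y` of the complexification of `X`,
so `(z - A_ℂ)(x + i y) = (Re z • x - Im z • y - A x) + i (Im z • x + Re z • y - A y)`. -/
def complexShift {X : Type*} [NormedAddCommGroup X] [NormedSpace ℝ X] (A : X →ₗ.[ℝ] X) (z : ℂ) :
    X × X →ₗ.[ℝ] X × X where
  domain := A.domain.prod A.domain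
  toFun :=
    { toFun := fun u =>
        (z.re • u.1.1 - z.im • u.1.2 - A ⟨u.1.1, u.2.1⟩,
          z.im • u.1.1 + z.re • u.1.2 - A ⟨u.1.2, u.2.2⟩)
      map_add' := fun u v => by
        have h1 := A.map_add ⟨u.1.1, u.2.1⟩ ⟨v.1.1, v.2.1⟩
        have h2 := A.map_add ⟨u.1.2, u.2.2⟩ ⟨v.1.2, v.2.2⟩
        simp only [AddMemClass.mk_add_mk] at h1 h2
        ext
        · simp only [Submodule.coe_add, Prod.fst_add, Prod.snd_add, h1, smul_add]
          abel
        · simp only [Submodule.coe_add, Prod.fst_add, Prod.snd_add, h2, smul_add]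
          abel
      map_smul' := fun c u => by
        have h1 := A.map_smul c ⟨u.1.1, u.2.1⟩
        have h2 := A.map_smul c ⟨u.1.2, u.2.2⟩
        simp only [SetLike.mk_smul_mk] at h1 h2
        ext
        · simp only [Submodule.coe_smul, Prod.smul_fst, Prod.smul_snd, h1, RingHom.id_apply,
            smul_sub, smul_comm c]
        · simp only [Submodule.coe_smul, Prod.smul_fst, Prod.smul_snd, h2, RingHom.id_apply,
            smul_sub, smul_add, smul_comm c] }

/-- The (complex) spectrum of an operator in a real Banach space, that is, the spectrum of its
complexification. -/
def complexSpec {X : Type*} [NormedAddCommGroup X] [NormedSpace ℝ X] (A : X →ₗ.[ℝ] X) : Set ℂ :=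
  {z | ¬ HasBoundedInverse (complexShift A z)}

end Spectrum

/-! ### Covariances and Gaussian measures -/

section Gaussian

variable {E : Type*} [NormedAddCommGroup E] [NormedSpace ℝ E]

/-- The operator `Q = B B* : E* → E`, where `H` is identified with its dual. -/
def noiseCov {H : Type*} [NormedAddCommGroup H] [InnerProductSpace ℝ H] [CompleteSpace H]
    (B : H →L[ℝ] E) (x' : StrongDual ℝ E) : E :=
  B ((InnerProductSpace.toDual ℝ H).symm (x'.comp B))

/-- `⟨Q_t x', y'⟩ = ∫₀ᵗ ⟨S(s) B B* S(s)* x', y'⟩ ds`. -/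
def covForm {H : Type*} [NormedAddCommGroup H] [InnerProductSpace ℝ H] [CompleteSpace H]
    (S : C0Semigroup ℝ E) (B : H →L[ℝ] E) (t : ℝ≥0) (x' y' : StrongDual ℝ E) : ℝ :=
  ∫ s in (0 : ℝ)..t, y' (S.op s.toNNReal (noiseCov B (x'.comp (S.op s.toNNReal))))

/-- `μ` is a centred Gaussian Radon measure on `E` whose covariance operator `Q` satisfies
`⟨Q x', y'⟩ = q x' y'`. -/
structure IsCentredGaussianRadon [MeasurableSpace E] [BorelSpace E] (μ : Measure E)
    (q : StrongDual ℝ E → StrongDual ℝ E → ℝ) : Prop where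
  innerRegular : μ.InnerRegular
  isGaussian : IsGaussian μ
  centred : ∀ x' : StrongDual ℝ E, ∫ x, x' x ∂μ = 0
  covariance : ∀ x' y' : StrongDual ℝ E, ∫ x, x' x * y' x ∂μ = q x' y'

end Gaussian

/-! ### The Ornstein-Uhlenbeck semigroup -/

section OU

variable {E : Type*} [NormedAddCommGroup E] [NormedSpace ℝ E] [MeasurableSpace E] [BorelSpace E]

/-- The operator `f ↦ (x ↦ ∫ f(T x + y) dν(y))` on bounded continuous functions. With `T = S(t)`
and `ν = μ_t` this is the Ornstein-Uhlenbeck operator `P(t)`. -/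
def transition (T : E →L[ℝ] E) (ν : Measure E) [IsProbabilityMeasure ν] (f : E →ᵇ ℂ) : E →ᵇ ℂ :=
  BoundedContinuousFunction.ofNormedAddCommGroup (fun x => ∫ y, f (T x + y) ∂ν)
    (by
      refine continuous_of_dominated (bound := fun _ => ‖f‖) (fun x => ?_)
        (fun x => Eventually.of_forall fun y => f.norm_coe_le_norm _) (integrable_const _)
        (Eventually.of_forall fun y => by fun_prop)
      exact (f.continuous.comp (by fun_prop : Continuous fun y => T x + y)).aestronglyMeasurable)
    ‖f‖
    (fun x => by
      simpa using norm_integral_le_of_norm_le_const (μ := ν)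
        (Eventually.of_forall fun y => f.norm_coe_le_norm (T x + y)))

open Classical in
/-- The continuous linear extension of `transition T ν` to complex `L¹(E, m)`. It is unique when
the bounded continuous functions are dense in `L¹(E, m)`, as they are for a finite Radon
measure `m`. (If there were no extension, the value would be `0`.) -/
def transitionL1 (T : E →L[ℝ] E) (ν m : Measure E) [IsProbabilityMeasure ν] [IsFiniteMeasure m] :
    Lp ℂ 1 m →L[ℂ] Lp ℂ 1 m :=
  if h : ∃ P : Lp ℂ 1 m →L[ℂ] Lp ℂ 1 m, ∀ f : E →ᵇ ℂ,
      P (BoundedContinuousFunction.toLp 1 m ℂ f) =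
        BoundedContinuousFunction.toLp 1 m ℂ (transition T ν f)
  then h.choose else 0

/-- The generator `L_P` in `L¹(E, m)` of the Ornstein-Uhlenbeck semigroup `P`, where
`P(t) f(x) = ∫ f(S(t) x + y) dμ_t(y)`. -/
def ouGenerator (S : C0Semigroup ℝ E) (μ : ℝ≥0 → Measure E) [∀ t, IsProbabilityMeasure (μ t)]
    (m : Measure E) [IsFiniteMeasure m] : Lp ℂ 1 m →ₗ.[ℂ] Lp ℂ 1 m :=
  generator fun t => transitionL1 (S.op t) (μ t) m

end OU

end

end OrnsteinUhlenbeck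

namespace OrnsteinUhlenbeck

noncomputable section

/-! ### Strongly continuous semigroups -/

section Semigroup

variable {X : Type*} [NormedAddCommGroup X] [NormedSpace ℝ X]

/-! A single spectral value `w` of `A_∞` produces all the eigenvalues. Eventual compactness and
Riesz theory turn `w` into a nonzero complex functional `Z` on `E_∞` with `Z (S(t) x) = e^{tw} Z x`
(`exists_eigenfunctional`). The identity `Q_∞ = Q_t + S(t) Q_∞ S(t)*` and `Q_t → Q_∞` make the
variance of `Z ∘ S(t)` tend to `0`, so `α = Re w < 0` (`re_neg_of_eigenfunctionals`). Multiplying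
`Z` by a constant of modulus one makes its real and imaginary parts `U`, `V` uncorrelated, hence
independent under `μ_∞`, with variances `p > 0` and `r ≥ 0`. On functions of `(U, V)` the operator
`P(t)` only sees a rotation and the contraction by `c = e^{αt}`.

The decisive object is the family `Φ(v) = (1 + pv)^{-1/2} (1 + rv)^{-1/2} exp(v U² / (2(1 + pv)) + v
V² / (2(1 + rv)))`. For real `v > -δ`, `δ = 1/(p + r)`, it is the density, with respect to `μ_∞`,
that replaces the variances `p`, `r` by `p(1 + pv)`, `r(1 + rv)`. It is therefore bounded in `L¹`
for all large `v`, and it extends to a bounded holomorphic map from a sector with vertex `-δ` into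
`L¹` (`norm_gaussVector_le`, `differentiableOn_gaussVector`). For `v = -τ² < 0` it is a Gaussian
superposition of characters `e^{iL}`, on which `P(t)` is explicit; rotation invariance of the planar
Gaussian gives `P(t) Φ(v) = Φ(c² v)`, and the identity theorem extends this to the sector
(`transitionL1_gaussVector`).

Dilations are diagonalized by the Mellin transform. With `s = -z / (2α)`, the formal eigenvector for
`e^{tz}` is `∫₀^∞ v^{s-1} Φ(v) dv`. Since `Re s < 0` this diverges at `0`, so it is replaced by
`∫₀^∞ v^{s+n-1} Φ⁽ⁿ⁾(v) dv` with `n > -Re s`, which converges by Cauchy's estimates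
(`exists_eigenvector_of_sector`). It is nonzero because pairing with `e^{iU}` gives a nonzero
multiple of a Gamma value. Thus the open left half-plane consists of eigenvalues. Its closure lies
in the spectrum, and contractivity of `P` in `L¹` excludes everything to the right. -/

theorem isGeneratorValue_real_iff {T : ℝ≥0 → X →L[ℝ] X} {x y : X} :
    IsGeneratorValue T x y ↔
      Tendsto (fun t : ℝ≥0 => (t : ℝ)⁻¹ • (T t x - x)) (𝓝[>] 0) (𝓝 y) := by
  simp [IsGeneratorValue]

theorem IsGeneratorValue.map_of_commute {T : ℝ≥0 → X →L[ℝ] X} {x y : X}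
    (h : IsGeneratorValue T x y) (L : X →L[ℝ] X) (hL : ∀ t z, L (T t z) = T t (L z)) :
    IsGeneratorValue T (L x) (L y) := by
  rw [isGeneratorValue_real_iff] at *
  refine ((L.continuous.tendsto y).comp h).congr fun t => ?_
  simp [hL]

namespace C0Semigroup

theorem op_add_apply (T : C0Semigroup ℝ X) (s t : ℝ≥0) (x : X) :
    T.op (s + t) x = T.op s (T.op t x) := by
  rw [T.op_add]; rfl

theorem op_comm (T : C0Semigroup ℝ X) (s t : ℝ≥0) (x : X) :
    T.op s (T.op t x) = T.op t (T.op s x) := by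
  rw [← T.op_add_apply, ← T.op_add_apply, add_comm]

variable [CompleteSpace X]

/-- Otherwise the norms are unbounded along some null sequence, although every orbit converges along
it; this contradicts Banach-Steinhaus. -/
theorem exists_bound_near_zero (T : C0Semigroup ℝ X) :
    ∃ δ > 0, ∃ M : ℝ, ∀ t : ℝ≥0, t < δ → ‖T.op t‖ ≤ M := by
  by_contra! h
  choose t ht hM using fun n : ℕ => h (1 / ((n : ℝ≥0) + 1)) (by positivity) n
  have htend : Tendsto t atTop (𝓝 0) :=
    tendsto_of_tendsto_of_tendsto_of_le_of_le tendsto_const_nhds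
      (NNReal.tendsto_coe.1 (by simpa using tendsto_one_div_add_atTop_nhds_zero_nat (𝕜 := ℝ)))
      (fun _ => zero_le) (fun n => (ht n).le)
  obtain ⟨C, hC⟩ := banach_steinhaus (g := fun n => T.op (t n)) (fun x => by
    obtain ⟨C, hC⟩ := ((T.tendsto_zero x).comp htend).norm.bddAbove_range
    exact ⟨C, fun n => hC ⟨n, rfl⟩⟩)
  obtain ⟨n, hn⟩ := exists_nat_gt C
  exact absurd (hC n) (not_le.2 (hn.trans (hM n)))

theorem exists_bound_of_le (T : C0Semigroup ℝ X) (a : ℝ≥0) :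
    ∃ M : ℝ, ∀ t ≤ a, ‖T.op t‖ ≤ M := by
  obtain ⟨δ, hδ, M, hM⟩ := T.exists_bound_near_zero
  obtain ⟨n, hn⟩ := exists_nat_gt (a / δ)
  have hn0 : 0 < (n : ℝ≥0) := lt_of_le_of_lt zero_le hn
  have key : ∀ (s : ℝ≥0), s < δ → ∀ k : ℕ, ‖T.op (k • s)‖ ≤ (max M 1) ^ k := by
    intro s hs k
    induction k with
    | zero =>
      rw [zero_smul, T.op_zero, pow_zero]
      exact ContinuousLinearMap.norm_id_le
    | succ k ih =>
      rw [succ_nsmul, T.op_add, pow_succ]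
      refine (ContinuousLinearMap.opNorm_comp_le _ _).trans ?_
      gcongr
      exact (hM s hs).trans (le_max_left _ _)
  refine ⟨(max M 1) ^ n, fun t ht => ?_⟩
  have h1 : n • (t / n) = t := by
    rw [nsmul_eq_mul, mul_div_cancel₀ _ hn0.ne']
  rw [← h1]
  refine key _ ?_ n
  rw [div_lt_iff₀ hn0]
  refine ht.trans_lt ?_
  rwa [div_lt_iff₀ hδ, mul_comm] at hn

/-- For `s ≤ t`, `T(t)x - T(s)x = T(s)(T(t-s)x - x)`; the uniform bound on `T(s)` reduces continuity
from both sides to continuity at `0`. -/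
theorem continuous_orbit (T : C0Semigroup ℝ X) (x : X) : Continuous fun t => T.op t x := by
  rw [continuous_iff_continuousAt]
  intro t₀
  obtain ⟨M, hM⟩ := T.exists_bound_of_le (t₀ + 1)
  have hM0 : 0 ≤ M := (norm_nonneg _).trans (hM 0 zero_le)
  have key : ∀ s t : ℝ≥0, s ≤ t → s ≤ t₀ + 1 →
      dist (T.op t x) (T.op s x) ≤ M * ‖T.op (nndist t s) x - x‖ := by
    intro s t hst hs
    have h1 : nndist t s = t - s := by
      rw [NNReal.nndist_eq, tsub_eq_zero_of_le hst, max_eq_left zero_le]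
    have h2 : T.op t x = T.op s (T.op (t - s) x) := by
      rw [← T.op_add_apply, add_tsub_cancel_of_le hst]
    rw [h1, dist_eq_norm, h2, ← map_sub]
    exact (ContinuousLinearMap.le_opNorm _ _).trans (by gcongr; exact hM s hs)
  have hlim : Tendsto (fun t => M * ‖T.op (nndist t t₀) x - x‖) (𝓝 t₀) (𝓝 0) := by
    have h0 : Tendsto (fun t => nndist t t₀) (𝓝 t₀) (𝓝 0) := by
      have : Continuous fun t => nndist t t₀ := by fun_prop
      simpa using this.tendsto t₀
    have := (((T.tendsto_zero x).comp h0).sub_const x).norm.const_mul M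
    simpa using this
  refine tendsto_iff_dist_tendsto_zero.2 (squeeze_zero' (Eventually.of_forall fun _ => dist_nonneg)
    ?_ hlim)
  filter_upwards [Iio_mem_nhds (show t₀ < t₀ + 1 by simp)] with t ht
  rcases le_total t₀ t with h | h
  · exact key t₀ t h (by simp)
  · rw [dist_comm, nndist_comm]
    exact key t t₀ h ht.le

theorem continuous_orbit_real (T : C0Semigroup ℝ X) (x : X) :
    Continuous fun s : ℝ => T.op s.toNNReal x :=
  (T.continuous_orbit x).comp continuous_real_toNNReal

/-- The operator `x ↦ ∫₀ᵗ T(s) x ds`. -/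
def integralOp (T : C0Semigroup ℝ X) (t : ℝ≥0) : X →L[ℝ] X :=
  LinearMap.mkContinuousOfExistsBound
    { toFun := fun x => ∫ s in (0 : ℝ)..t, T.op s.toNNReal x
      map_add' := fun x y => by
        simp only [map_add]
        exact intervalIntegral.integral_add
          ((T.continuous_orbit_real x).intervalIntegrable _ _)
          ((T.continuous_orbit_real y).intervalIntegrable _ _)
      map_smul' := fun c x => by
        simp only [map_smul, RingHom.id_apply]
        exact intervalIntegral.integral_smul _ _ }
    (by
      obtain ⟨M, hM⟩ := T.exists_bound_of_le t
      refine ⟨M * t, fun x => ?_⟩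
      have h := intervalIntegral.norm_integral_le_of_norm_le_const (a := (0 : ℝ)) (b := t)
        (f := fun s => T.op s.toNNReal x) (C := M * ‖x‖) (fun s hs => by
          rw [Set.uIoc_of_le t.coe_nonneg] at hs
          refine (ContinuousLinearMap.le_opNorm _ _).trans ?_
          gcongr
          exact hM _ (by simpa [Real.toNNReal_le_iff_le_coe] using hs.2))
      simp only [sub_zero, NNReal.abs_eq] at h
      exact h.trans (le_of_eq (by ring)))

theorem integralOp_apply (T : C0Semigroup ℝ X) (t : ℝ≥0) (x : X) :
    T.integralOp t x = ∫ s in (0 : ℝ)..t, T.op s.toNNReal x := rfl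

theorem map_integralOp (T : C0Semigroup ℝ X) {Y : Type*} [NormedAddCommGroup Y] [NormedSpace ℝ Y]
    [CompleteSpace Y] (L : X →L[ℝ] Y) (t : ℝ≥0) (x : X) :
    L (T.integralOp t x) = ∫ s in (0 : ℝ)..t, L (T.op s.toNNReal x) := by
  rw [integralOp_apply]
  exact (L.intervalIntegral_comp_comm ((T.continuous_orbit_real x).intervalIntegrable _ _)).symm

theorem integralOp_commute (T : C0Semigroup ℝ X) (L : X →L[ℝ] X)
    (hL : ∀ t x, L (T.op t x) = T.op t (L x)) (t : ℝ≥0) (x : X) :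
    L (T.integralOp t x) = T.integralOp t (L x) := by
  rw [map_integralOp, integralOp_apply]
  simp only [hL]

theorem tendsto_inv_smul_integralOp (T : C0Semigroup ℝ X) (x : X) :
    Tendsto (fun t : ℝ≥0 => (t : ℝ)⁻¹ • T.integralOp t x) (𝓝[>] 0) (𝓝 x) := by
  have h := intervalIntegral.integral_hasDerivAt_right
    ((T.continuous_orbit_real x).intervalIntegrable 0 0)
    ((T.continuous_orbit_real x).stronglyMeasurableAtFilter _ _)
    (T.continuous_orbit_real x).continuousAt
  rw [hasDerivAt_iff_tendsto_slope_zero] at h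
  have hc : Tendsto (fun t : ℝ≥0 => (t : ℝ)) (𝓝[>] 0) (𝓝[≠] 0) := by
    refine tendsto_nhdsWithin_iff.2 ⟨?_, ?_⟩
    · have : Tendsto (fun t : ℝ≥0 => (t : ℝ)) (𝓝 0) (𝓝 0) := by
        simpa using NNReal.continuous_coe.tendsto 0
      exact this.mono_left nhdsWithin_le_nhds
    · filter_upwards [self_mem_nhdsWithin] with t ht
      exact NNReal.coe_ne_zero.2 (ne_of_gt ht)
  have h2 := h.comp hc
  simpa [Function.comp_def, T.op_zero, integralOp_apply] using h2

/-- Both sides are `∫_t^{t+h} - ∫_0^h` of the orbit of `x`. -/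
theorem op_integralOp_sub (T : C0Semigroup ℝ X) (h t : ℝ≥0) (x : X) :
    T.op h (T.integralOp t x) - T.integralOp t x = T.integralOp h (T.op t x - x) := by
  have shift : ∀ a b : ℝ≥0, T.op a (T.integralOp b x) =
      ∫ s in (a : ℝ)..(b + a), T.op s.toNNReal x := by
    intro a b
    rw [map_integralOp]
    have := intervalIntegral.integral_comp_add_right (a := (0 : ℝ)) (b := b)
      (fun s => T.op s.toNNReal x) a
    rw [zero_add] at this
    rw [← this]
    refine intervalIntegral.integral_congr fun s hs => ?_
    rw [Set.uIcc_of_le b.coe_nonneg] at hs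
    rw [← T.op_add_apply, Real.toNNReal_add hs.1 a.coe_nonneg, Real.toNNReal_coe, add_comm]
  have hi : ∀ a b : ℝ, IntervalIntegrable (fun s => T.op s.toNNReal x) volume a b :=
    fun a b => (T.continuous_orbit_real x).intervalIntegrable a b
  have h1 : T.integralOp h (T.op t x) = T.op t (T.integralOp h x) :=
    (T.integralOp_commute (T.op t) (fun s y => T.op_comm t s y) h x).symm
  rw [map_sub, h1, shift h t, shift t h, integralOp_apply, integralOp_apply,
    ← intervalIntegral.integral_add_adjacent_intervals (hi h t) (hi t (t + h)),
    ← intervalIntegral.integral_add_adjacent_intervals (hi 0 h) (hi h t), add_comm (h : ℝ) t]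
  abel

theorem isGeneratorValue_integralOp (T : C0Semigroup ℝ X) (t : ℝ≥0) (x : X) :
    IsGeneratorValue T.op (T.integralOp t x) (T.op t x - x) := by
  rw [isGeneratorValue_real_iff]
  refine (T.tendsto_inv_smul_integralOp (T.op t x - x)).congr fun h => ?_
  rw [op_integralOp_sub]

/-- The bounded operator `integralOp t` commutes with `T` and may be applied inside the limit that
defines `y`; uniqueness of generator values does the rest, with no appeal to closedness of the
generator. -/
theorem integralOp_of_isGeneratorValue (T : C0Semigroup ℝ X) {x y : X}
    (hxy : IsGeneratorValue T.op x y) (t : ℝ≥0) : T.integralOp t y = T.op t x - x := by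
  have h1 := hxy.map_of_commute (T.integralOp t)
    (fun s z => (T.integralOp_commute (T.op s) (fun r w => T.op_comm s r w) t z).symm)
  exact h1.unique (T.isGeneratorValue_integralOp t x)

/-- If `A B = B A = Θ` with `B` bounded and `Θ` bijective, then the generator `A` has a bounded
inverse. -/
theorem exists_inverse_of_bijective (T : C0Semigroup ℝ X) (B Θ : X →L[ℝ] X)
    (h1 : ∀ x, IsGeneratorValue T.op (B x) (Θ x))
    (h2 : ∀ x y, IsGeneratorValue T.op x y → B y = Θ x) (hΘ : Function.Bijective Θ) :
    ∃ R : X →L[ℝ] X, (∀ y, IsGeneratorValue T.op (R y) y) ∧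
      ∀ x y, IsGeneratorValue T.op x y → R y = x := by
  obtain ⟨u, hu⟩ := ContinuousLinearMap.isUnit_iff_bijective.2 hΘ
  have hr : ∀ y, Θ ((↑u⁻¹ : X →L[ℝ] X) y) = y := fun y => by
    rw [← hu, ← mul_apply_eq_comp, Units.mul_inv]; rfl
  refine ⟨B * ↑u⁻¹, fun y => ?_, fun x y hxy => ?_⟩
  · have := h1 ((↑u⁻¹ : X →L[ℝ] X) y)
    rwa [hr] at this
  · have h3 := h1 ((↑u⁻¹ : X →L[ℝ] X) y)
    rw [hr] at h3
    -- `x - B Θ⁻¹ y` has generator value `0`, so `Θ` annihilates it.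
    have h4 := h2 _ _ (hxy.add (h3.smul (-1 : ℝ)))
    rw [neg_one_smul, neg_one_smul, add_neg_cancel, map_zero] at h4
    have h5 := hΘ.1 ((map_zero Θ).trans h4)
    rw [← sub_eq_add_neg, eq_comm, sub_eq_zero] at h5
    exact h5.symm

/-- The Neumann series inverts `T(t) - 1`; this takes the place of the Laplace transform formula for
the resolvent. -/
theorem exists_inverse_of_norm_lt_one (T : C0Semigroup ℝ X) {t : ℝ≥0} (ht : ‖T.op t‖ < 1) :
    ∃ R : X →L[ℝ] X, (∀ y, IsGeneratorValue T.op (R y) y) ∧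
      ∀ x y, IsGeneratorValue T.op x y → R y = x := by
  refine T.exists_inverse_of_bijective (T.integralOp t) (T.op t - 1)
    (T.isGeneratorValue_integralOp t) (fun x y h => T.integralOp_of_isGeneratorValue h t) ?_
  rw [← ContinuousLinearMap.isUnit_iff_bijective, ← neg_sub, IsUnit.neg_iff]
  exact isUnit_one_sub_of_norm_lt_one ht

end C0Semigroup

end Semigroup

/-! ### Compact perturbations of the identity -/

section Compact

variable {X : Type*} [NormedAddCommGroup X] [NormedSpace ℝ X]

/-- F. Riesz's argument: almost orthogonal vectors `x n ∈ N (n + 1)` have images under `T` at mutual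
distance at least `1`, which compactness forbids. -/
theorem not_strictMono_of_isCompactOperator {T : X →L[ℝ] X} (hT : IsCompactOperator T)
    (N : ℕ → Submodule ℝ X) (hcl : ∀ n, IsClosed (N n : Set X)) (hN : StrictMono N)
    (hmap : ∀ n, ∀ x ∈ N (n + 1), x - T x ∈ N n) : False := by
  have key : ∀ n : ℕ, ∃ x ∈ N (n + 1), ‖x‖ ≤ 3 ∧ ∀ y ∈ N n, 1 ≤ ‖x - y‖ := by
    intro n
    have h₁ : IsClosed ((N n).comap (N (n + 1)).subtype : Set (N (n + 1))) :=
      (hcl n).preimage continuous_subtype_val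
    have h₂ : ∃ x : N (n + 1), x ∉ (N n).comap (N (n + 1)).subtype := by
      obtain ⟨x, hx, hx'⟩ := SetLike.exists_of_lt (hN (Nat.lt_succ_self n))
      exact ⟨⟨x, hx⟩, hx'⟩
    obtain ⟨⟨x, hx⟩, hxn, hxy⟩ := riesz_lemma_of_norm_lt (𝕜 := ℝ) (c := 2) (R := 3)
      (by norm_num) (by norm_num) h₁ h₂
    exact ⟨x, hx, hxn, fun y hy => hxy ⟨y, hN.monotone (Nat.le_succ n) hy⟩ hy⟩
  choose x hxN hxn hxy using key
  have hsep : ∀ m n, m < n → 1 ≤ ‖T (x n) - T (x m)‖ := by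
    intro m n hmn
    have h1 : x n - T (x n) ∈ N n := hmap n _ (hxN n)
    have h2 : T (x m) ∈ N n := by
      have h3 : x m - (x m - T (x m)) ∈ N (m + 1) :=
        (N (m + 1)).sub_mem (hxN m) (hN.monotone (Nat.le_succ m) (hmap m _ (hxN m)))
      rw [sub_sub_cancel] at h3
      exact hN.monotone hmn h3
    have h4 := hxy n _ ((N n).add_mem h1 h2)
    rwa [show x n - (x n - T (x n) + T (x m)) = T (x n) - T (x m) by abel] at h4
  obtain ⟨K, hK, hK'⟩ := hT.image_closedBall_subset_compact 3
  obtain ⟨y, -, ψ, hψ, hψy⟩ := hK.tendsto_subseq (fun n => hK' ⟨x n, by simp [hxn], rfl⟩)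
  obtain ⟨n₀, hn₀⟩ := Metric.cauchySeq_iff'.1 hψy.cauchySeq 1 one_pos
  have h1 := hn₀ (n₀ + 1) (Nat.le_succ _)
  rw [dist_eq_norm] at h1
  exact absurd h1 (not_lt.2 (hsep _ _ (hψ (Nat.lt_succ_self _))))

theorem isCompactOperator_one_sub_pow {T : X →L[ℝ] X} (hT : IsCompactOperator T) (n : ℕ) :
    IsCompactOperator (1 - (1 - T) ^ n : X →L[ℝ] X) := by
  induction n with
  | zero => simpa using (isCompactOperator_zero : IsCompactOperator (0 : X → X))
  | succ n ih =>
    have : (1 - (1 - T) ^ (n + 1) : X →L[ℝ] X) = (1 - (1 - T) ^ n) + (1 - T) ^ n * T := by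
      rw [pow_succ]; noncomm_ring
    rw [this]
    exact ih.add (hT.clm_comp ((1 - T) ^ n))

variable [CompleteSpace X]

/-- The Fredholm alternative. -/
theorem bijective_of_isCompactOperator_one_sub {G : X →L[ℝ] X}
    (hG : IsCompactOperator (1 - G : X →L[ℝ] X)) (hinj : ∀ x, G x = 0 → x = 0) :
    Function.Bijective G := by
  rcases hG.hasEigenvalue_or_mem_resolventSet (μ := (1 : ℝ)) one_ne_zero with h | h
  · obtain ⟨x, hx⟩ := h.exists_hasEigenvector
    have h1 : x - G x = x := by simpa using hx.apply_eq_smul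
    exact absurd (hinj x (by simpa using h1)) hx.2
  · rw [spectrum.mem_resolventSet_iff] at h
    rw [← ContinuousLinearMap.isUnit_iff_bijective]
    simpa using h

/-- The projection onto the (finite-dimensional) generalized eigenspace for the eigenvalue `1` of
a compact operator. -/
theorem exists_riesz_projection {T : X →L[ℝ] X} (hT : IsCompactOperator T) :
    ∃ (V : Submodule ℝ X) (P : X →L[ℝ] X), FiniteDimensional ℝ V ∧ (∀ x, P x ∈ V) ∧
      (∀ x ∈ V, P x = x) ∧ (∀ x, T x = x → x ∈ V) ∧
      ∀ L : X →L[ℝ] X, (∀ x, L (T x) = T (L x)) → ∀ x, P (L x) = L (P x) := by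
  -- The kernels of the powers of `1 - T` cannot increase strictly, so they stabilize.
  obtain ⟨n, hn⟩ : ∃ n : ℕ, ∀ x, ((1 - T) ^ (n + 1) : X →L[ℝ] X) x = 0 → ((1 - T) ^ n : X →L[ℝ] X) x = 0 := by
    by_contra! h
    refine not_strictMono_of_isCompactOperator hT
      (fun n => LinearMap.ker ((1 - T) ^ n : X →L[ℝ] X).toLinearMap) (fun n => ?_)
      (strictMono_nat_of_lt_succ fun n => ?_) (fun n x hx => ?_)
    · exact ((1 - T) ^ n : X →L[ℝ] X).isClosed_ker
    · refine lt_of_le_of_ne (fun x hx => ?_) fun heq => ?_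
      · have hx' : ((1 - T) ^ n) x = 0 := hx
        change ((1 - T) ^ (n + 1)) x = 0
        rw [pow_succ', mul_apply_eq_comp, hx', map_zero]
      · obtain ⟨x, hx, hx'⟩ := h n
        have : x ∈ LinearMap.ker ((1 - T) ^ (n + 1) : X →L[ℝ] X).toLinearMap := hx
        rw [← heq] at this
        exact hx' this
    · have hx' : ((1 - T) ^ (n + 1)) x = 0 := hx
      change ((1 - T) ^ n) (x - T x) = 0
      rw [pow_succ, mul_apply_eq_comp] at hx'
      simpa using hx'
  have hn' : ∀ k x, ((1 - T) ^ (n + k)) x = 0 → ((1 - T) ^ n) x = 0 := by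
    intro k
    induction k with
    | zero => exact fun x hx => hx
    | succ k ih =>
      intro x hx
      refine ih x ?_
      rw [show n + (k + 1) = k + (n + 1) by ring, pow_add, mul_apply_eq_comp] at hx
      have h2 : ((1 - T) ^ (n + 1)) (((1 - T) ^ k) x) = 0 := by
        rw [← mul_apply_eq_comp, ← pow_add, add_comm, pow_add, mul_apply_eq_comp]
        exact hx
      have h3 := hn _ h2
      rwa [← mul_apply_eq_comp, ← pow_add] at h3
  -- The exponent `n + 1`, rather than `n`, makes `ker G` contain the fixed vectors of `T` even if
  -- `n = 0`.
  set G : X →L[ℝ] X := (1 - T) ^ (n + 1) with hGdef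
  have hG2 : ∀ x, G (G x) = 0 → G x = 0 := by
    intro x hx
    rw [← mul_apply_eq_comp, hGdef, ← pow_add] at hx
    rw [hGdef, pow_succ', mul_apply_eq_comp,
      hn' (1 + (n + 1)) x (by rwa [← add_assoc]), map_zero]
  have hGc : IsCompactOperator (1 - G : X →L[ℝ] X) := isCompactOperator_one_sub_pow hT _
  set V : Submodule ℝ X := LinearMap.ker G.toLinearMap with hV
  have hVmem : ∀ x, x ∈ V ↔ G x = 0 := fun x => Iff.rfl
  have hVcl : IsClosed (V : Set X) := G.isClosed_ker
  have : CompleteSpace V := hVcl.completeSpace_coe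
  have hfin : FiniteDimensional ℝ V := by
    apply FiniteDimensional.of_isCompactOperator_id (𝕜 := ℝ)
    have hVV : ∀ v ∈ V, (1 - G : X →L[ℝ] X).toLinearMap v ∈ V := by
      intro v hv
      have : (1 - G : X →L[ℝ] X).toLinearMap v = v := by
        simp [(hVmem v).1 hv]
      rwa [this]
    have h1 := IsCompactOperator.restrict' (f := (1 - G : X →L[ℝ] X).toLinearMap) hGc hVV
    have h2 : (id : V → V) = ⇑((1 - G : X →L[ℝ] X).toLinearMap.restrict hVV) := by
      funext v
      refine Subtype.ext ?_
      simp
    rwa [← h2] at h1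
  obtain ⟨p, hp⟩ := Submodule.ClosedComplemented.of_finiteDimensional V
  have hp0 : ∀ x (hx : x ∈ V), ((p x : V) : X) = x := fun x hx => by rw [hp ⟨x, hx⟩]
  -- To split `X = range G ⊕ ker G`, take any continuous projection `p` onto `V = ker G`. Then `G +
  -- p` is an injective compact perturbation of the identity, hence bijective, and the sought
  -- projection is `p Θ⁻¹`.
  set Θ : X →L[ℝ] X := G + V.subtypeL.comp p with hΘ
  have hΘx : ∀ x, Θ x = G x + p x := fun x => rfl
  have hGp : ∀ x, G (p x : X) = 0 := fun x => (hVmem _).1 (p x).2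
  have hker : ∀ x y, G x = (p y : X) → (p y : X) = 0 := by
    intro x y h
    have h1 := hG2 x (by rw [h, hGp])
    rw [← h, h1]
  have hbij : Function.Bijective Θ := by
    apply bijective_of_isCompactOperator_one_sub
    · have : (1 - Θ : X →L[ℝ] X) = (1 - G) - V.subtypeL.comp p := by rw [hΘ]; abel
      rw [this]
      refine hGc.sub ?_
      exact ((isCompactOperator_id_iff_finiteDimensional (𝕜 := ℝ).2 hfin).comp_clm p).clm_comp
        V.subtypeL
    · intro x hx
      rw [hΘx, add_eq_zero_iff_eq_neg] at hx
      have h1 : (p (-x) : X) = 0 := hker x (-x) (by rw [hx, map_neg]; rfl)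
      have h2 : (p x : X) = 0 := by
        rw [map_neg] at h1
        simpa using h1
      rw [h2, neg_zero] at hx
      rw [← hp0 x hx, h2]
  obtain ⟨u, hu⟩ := ContinuousLinearMap.isUnit_iff_bijective.2 hbij
  set I : X →L[ℝ] X := ↑u⁻¹ with hI
  have hΘI : ∀ x, G (I x) + p (I x) = x := fun x => by
    rw [← hΘx, ← hu, hI, ← mul_apply_eq_comp, Units.mul_inv]; rfl
  -- The `V`-component in a decomposition `G y + v` is unique. This characterization yields
  -- commutation with `L`, since `L` preserves `V` and the range of `G`.
  have hchar : ∀ x y v, v ∈ V → x = G y + v → (p (I x) : X) = v := by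
    intro x y v hv hx
    have h1 : G (y - I x) = (p (I x - v) : X) := by
      rw [map_sub, map_sub, AddSubgroupClass.coe_sub, hp0 v hv, sub_eq_sub_iff_add_eq_add, ← hx,
        add_comm, hΘI]
    have h2 := hker _ _ h1
    rw [map_sub, AddSubgroupClass.coe_sub, hp0 v hv, sub_eq_zero] at h2
    exact h2
  refine ⟨V, V.subtypeL.comp (p.comp I), hfin, fun x => (p (I x)).2, fun x hx => ?_, fun x hx => ?_,
    fun L hL x => ?_⟩
  · exact hchar x 0 x hx (by simp)
  · rw [hVmem, hGdef, pow_succ, mul_apply_eq_comp]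
    have : (1 - T : X →L[ℝ] X) x = 0 := by simp [hx]
    rw [this, map_zero]
  · have hLG : ∀ x, L (G x) = G (L x) := by
      have hc : Commute L T := by
        ext x; exact hL x
      have : Commute L G := ((Commute.one_right L).sub_right hc).pow_right _
      intro x
      exact congrArg (fun A : X →L[ℝ] X => A x) this
    refine hchar (L x) (L (I x)) (L (p (I x))) ?_ ?_
    · rw [hVmem, ← hLG, hGp, map_zero]
    · rw [← hLG, ← map_add, hΘI]

/-- The generator is inverted separately on the two parts of the Riesz decomposition of `T(t₀)` at
`1`. On `ker P`, `T(t₀) - 1` is injective and `integralOp` does the job; on the finite-dimensional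
`V` the generator is a matrix `a`. If `a` is not surjective, a functional that kills its range,
composed with `P`, is invariant under the semigroup. -/
theorem C0Semigroup.exists_fixed_functional_or_inverse (T : C0Semigroup ℝ X) {t₀ : ℝ≥0}
    (hT : IsCompactOperator (T.op t₀)) :
    (∃ φ : StrongDual ℝ X, φ ≠ 0 ∧ ∀ t x, φ (T.op t x) = φ x) ∨
      ∃ R : X →L[ℝ] X, (∀ y, IsGeneratorValue T.op (R y) y) ∧
        ∀ x y, IsGeneratorValue T.op x y → R y = x := by
  obtain ⟨V, P, hfin, hPV, hPid, hTV, hcomm⟩ := exists_riesz_projection hT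
  have hPT : ∀ t x, P (T.op t x) = T.op t (P x) := fun t => hcomm (T.op t) (fun x => T.op_comm _ _ x)
  have hPB : ∀ t x, P (T.integralOp t x) = T.integralOp t (P x) :=
    fun t x => T.integralOp_commute P hPT t x
  have hBV : ∀ t, ∀ v ∈ V, T.integralOp t v ∈ V := fun t v hv => by
    rw [← hPid v hv, ← hPB]; exact hPV _
  -- The averages `h⁻¹ ∫₀ʰ T(s) v ds` lie in the domain and in `V`, and converge to `v`; the
  -- intersection of the two spaces is finite-dimensional, hence closed.
  have hVD : V ≤ (generator T.op).domain := by
    have hcl : IsClosed (((generator T.op).domain ⊓ V : Submodule ℝ X) : Set X) := by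
      have : FiniteDimensional ℝ ((generator T.op).domain ⊓ V : Submodule ℝ X) :=
        Submodule.finiteDimensional_of_le inf_le_right
      exact Submodule.closed_of_finiteDimensional _
    intro v hv
    have := hcl.mem_of_tendsto (T.tendsto_inv_smul_integralOp v) (Eventually.of_forall fun h =>
      Submodule.smul_mem _ _ ⟨⟨_, T.isGeneratorValue_integralOp h v⟩, hBV h v hv⟩)
    exact this.1
  have hspec : ∀ x : (generator T.op).domain, IsGeneratorValue T.op x (generator T.op x) :=
    fun x => x.2.choose_spec
  have hval : ∀ x y, IsGeneratorValue T.op x y → IsGeneratorValue T.op (P x) (P y) :=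
    fun x y h => h.map_of_commute P hPT
  set a : V →ₗ[ℝ] V := ((generator T.op).toFun ∘ₗ Submodule.inclusion hVD).codRestrict V
    (fun v => by
      have h1 := hspec ⟨v, hVD v.2⟩
      have h2 := hval _ _ h1
      rw [hPid v v.2] at h2
      have h3 := h1.unique h2
      change generator T.op ⟨v, hVD v.2⟩ ∈ V
      rw [h3]
      exact hPV _) with ha
  have haspec : ∀ v : V, IsGeneratorValue T.op (v : X) (a v : X) := fun v => hspec ⟨v, hVD v.2⟩
  by_cases hsurj : LinearMap.range a = ⊤
  · right
    have hsurj' : Function.Surjective a := LinearMap.range_eq_top.1 hsurj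
    set e : V ≃ₗ[ℝ] V := LinearEquiv.ofBijective a
      ⟨LinearMap.injective_iff_surjective.2 hsurj', hsurj'⟩
    have he : ∀ v, a (e.symm v) = v := fun v => e.apply_symm_apply v
    have he' : ∀ v, e.symm (a v) = v := fun v => e.symm_apply_apply v
    set PV : X →L[ℝ] V := P.codRestrict V hPV
    set b : X →L[ℝ] X := V.subtypeL.comp ((LinearMap.toContinuousLinearMap (e.symm : V →ₗ[ℝ] V)).comp PV)
    have hb : ∀ x, b x = (e.symm ⟨P x, hPV x⟩ : X) := fun x => rfl
    -- `B` is `integralOp t₀` on `ker P` and `a⁻¹` on `V`; the generator times `B` is then `T(t₀) -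
    -- 1` on `ker P` and the identity on `V`.
    refine T.exists_inverse_of_bijective (T.integralOp t₀ * (1 - P) + b)
      ((T.op t₀ - 1) * (1 - P) + P) (fun x => ?_) (fun x y hxy => ?_) ?_
    · have h1 := T.isGeneratorValue_integralOp t₀ ((1 - P) x)
      have h2 := haspec (e.symm ⟨P x, hPV x⟩)
      rw [he] at h2
      exact h1.add h2
    · have h1 : IsGeneratorValue T.op (x - P x) (y - P y) := by
        have := hxy.add ((hval _ _ hxy).smul (-1 : ℝ))
        simpa [sub_eq_add_neg] using this
      have h2 := T.integralOp_of_isGeneratorValue h1 t₀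
      have h3 : a ⟨P x, hPV x⟩ = ⟨P y, hPV y⟩ :=
        Subtype.ext ((haspec ⟨P x, hPV x⟩).unique (hval _ _ hxy))
      change T.integralOp t₀ (y - P y) + b y = (T.op t₀ (x - P x) - (x - P x)) + P x
      rw [h2, hb, ← h3, he']
    -- The sign is changed because `-Θ` is the one that differs from the identity by a compact
    -- operator, namely by `T(t₀)(1 - P) + 2P`.
    · have hbij : Function.Bijective (-((T.op t₀ - 1) * (1 - P) + P) : X →L[ℝ] X) := ?_
      · rw [← ContinuousLinearMap.isUnit_iff_bijective] at hbij ⊢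
        exact (IsUnit.neg_iff _).1 hbij
      apply bijective_of_isCompactOperator_one_sub
      · have h1 : (1 - -((T.op t₀ - 1) * (1 - P) + P) : X →L[ℝ] X) =
            (T.op t₀).comp (1 - P) + (P + P) := by
          change _ = T.op t₀ * (1 - P) + (P + P)
          noncomm_ring
        have h2 : IsCompactOperator P :=
          ((isCompactOperator_id_iff_finiteDimensional (𝕜 := ℝ).2 hfin).comp_clm PV).clm_comp
            V.subtypeL
        rw [h1]
        exact (hT.comp_clm _).add (h2.add h2)
      · intro x hx
        have hx' : (T.op t₀ (x - P x) - (x - P x)) + P x = 0 := neg_eq_zero.1 hx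
        have hPP : P (P x) = P x := hPid _ (hPV x)
        have h1 := congrArg P hx'
        simp only [map_add, map_sub, hPT, hPP, map_zero, sub_self, zero_add] at h1
        rw [h1, sub_zero, add_zero, sub_eq_zero] at hx'
        rw [← hPid x (hTV x hx'), h1]
  · left
    obtain ⟨ψ, hψ, hψa⟩ := Submodule.exists_le_ker_of_lt_top _ (lt_top_iff_ne_top.2 hsurj)
    refine ⟨(LinearMap.toContinuousLinearMap ψ).comp (P.codRestrict V hPV), fun h0 => hψ ?_,
      fun t x => ?_⟩
    · ext v
      have h1 := congrArg (fun φ : StrongDual ℝ X => φ v) h0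
      have h2 : P.codRestrict V hPV v = v := Subtype.ext (hPid v v.2)
      simpa [h2] using h1
    · change ψ ⟨P (T.op t x), _⟩ = ψ ⟨P x, _⟩
      rw [← sub_eq_zero, ← map_sub]
      -- `T(t) P x - P x` is `a` applied to `∫₀ᵗ T(s) P x ds`, so `ψ` vanishes on it.
      have h1 : IsGeneratorValue T.op (T.integralOp t (P x)) (T.op t (P x) - P x) :=
        T.isGeneratorValue_integralOp t (P x)
      have h2 := haspec ⟨T.integralOp t (P x), hBV t _ (hPV x)⟩
      refine hψa ⟨⟨T.integralOp t (P x), hBV t _ (hPV x)⟩, Subtype.ext ?_⟩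
      rw [h2.unique h1, ← hPT]
      rfl

end Compact

/-! ### Rescaled semigroups and resolvents -/

section Twist

theorem generator_spec {𝕜 X : Type*} [RCLike 𝕜] [NormedAddCommGroup X] [NormedSpace 𝕜 X]
    {T : ℝ≥0 → X →L[𝕜] X} (x : (generator T).domain) : IsGeneratorValue T x (generator T x) :=
  x.2.choose_spec

theorem IsGeneratorValue.exists_generator_eq {𝕜 X : Type*} [RCLike 𝕜] [NormedAddCommGroup X]
    [NormedSpace 𝕜 X] {T : ℝ≥0 → X →L[𝕜] X} {x y : X} (h : IsGeneratorValue T x y) :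
    ∃ hx : x ∈ (generator T).domain, generator T ⟨x, hx⟩ = y :=
  ⟨⟨y, h⟩, (generator_spec ⟨x, ⟨y, h⟩⟩).unique h⟩

variable {X : Type*} [NormedAddCommGroup X] [NormedSpace ℝ X]

theorem tendsto_clm_apply {ι : Type*} {l : Filter ι} {f : ι → X →L[ℝ] X} {g : ι → X}
    {A : X →L[ℝ] X} {x : X} (hf : Tendsto f l (𝓝 A)) (hg : Tendsto g l (𝓝 x)) :
    Tendsto (fun i => f i (g i)) l (𝓝 (A x)) :=
  ((isBoundedBilinearMap_apply (𝕜 := ℝ)).continuous.tendsto (A, x)).comp (hf.prodMk_nhds hg)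

theorem continuous_algHom_complex (ρ : ℂ →ₐ[ℝ] (X →L[ℝ] X)) : Continuous ρ :=
  ρ.toLinearMap.continuous_of_finiteDimensional

/-- The semigroup `e^{-tz} T(t)`, for a complex structure `ρ` that commutes with `T`. -/
def C0Semigroup.twist (T : C0Semigroup ℝ X) (ρ : ℂ →ₐ[ℝ] (X →L[ℝ] X))
    (hρ : ∀ c t x, ρ c (T.op t x) = T.op t (ρ c x)) (z : ℂ) : C0Semigroup ℝ X where
  op t := (ρ (Complex.exp (-((t : ℝ) * z)))).comp (T.op t)
  op_zero := by
    ext x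
    simp [T.op_zero]
  op_add s t := by
    ext x
    have h : Complex.exp (-(((s + t : ℝ≥0) : ℝ) * z)) =
        Complex.exp (-((s : ℝ) * z)) * Complex.exp (-((t : ℝ) * z)) := by
      rw [← Complex.exp_add]; congr 1; push_cast; ring
    simp only [ContinuousLinearMap.comp_apply, h, map_mul, mul_apply_eq_comp, T.op_add, hρ]
  tendsto_zero x := by
    have h1 : Tendsto (fun t : ℝ≥0 => ρ (Complex.exp (-((t : ℝ) * z)))) (𝓝 0) (𝓝 1) := by
      have hc : Continuous fun t : ℝ≥0 => ρ (Complex.exp (-((t : ℝ) * z))) :=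
        (continuous_algHom_complex ρ).comp (by fun_prop)
      simpa using hc.tendsto 0
    exact tendsto_clm_apply h1 (T.tendsto_zero x)

theorem C0Semigroup.twist_op_apply (T : C0Semigroup ℝ X) (ρ : ℂ →ₐ[ℝ] (X →L[ℝ] X))
    (hρ : ∀ c t x, ρ c (T.op t x) = T.op t (ρ c x)) (z : ℂ) (t : ℝ≥0) (x : X) :
    (T.twist ρ hρ z).op t x = ρ (Complex.exp (-((t : ℝ) * z))) (T.op t x) := rfl

theorem tendsto_exp_sub_one_div (z : ℂ) :
    Tendsto (fun t : ℝ≥0 => (t : ℝ)⁻¹ • (Complex.exp ((t : ℝ) * z) - 1)) (𝓝[>] 0) (𝓝 z) := by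
  have h : HasDerivAt (fun s : ℝ => Complex.exp (s * z)) z 0 := by
    have h1 : HasDerivAt (fun s : ℝ => (s : ℂ) * z) z 0 := by
      simpa using (Complex.ofRealCLM.hasDerivAt (x := (0 : ℝ))).mul_const z
    simpa using h1.cexp
  rw [hasDerivAt_iff_tendsto_slope_zero] at h
  have hc : Tendsto (fun t : ℝ≥0 => (t : ℝ)) (𝓝[>] 0) (𝓝[≠] 0) := by
    refine tendsto_nhdsWithin_iff.2 ⟨?_, ?_⟩
    · have : Tendsto (fun t : ℝ≥0 => (t : ℝ)) (𝓝 0) (𝓝 0) := by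
        simpa using NNReal.continuous_coe.tendsto 0
      exact this.mono_left nhdsWithin_le_nhds
    · filter_upwards [self_mem_nhdsWithin] with t ht
      exact NNReal.coe_ne_zero.2 (ne_of_gt ht)
  simpa [Function.comp_def] using h.comp hc

/-- Product rule: `e^{-tz} T(t)x - x = e^{-tz}(T(t)x - x) + (e^{-tz} - 1)x`. -/
theorem C0Semigroup.isGeneratorValue_twist_of (T : C0Semigroup ℝ X) (ρ : ℂ →ₐ[ℝ] (X →L[ℝ] X))
    (hρ : ∀ c t x, ρ c (T.op t x) = T.op t (ρ c x)) (z : ℂ) {x y : X}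
    (h : IsGeneratorValue T.op x y) :
    IsGeneratorValue (T.twist ρ hρ z).op x (y - ρ z x) := by
  rw [isGeneratorValue_real_iff] at *
  have h1 : Tendsto (fun t : ℝ≥0 => ρ (Complex.exp (-((t : ℝ) * z)))) (𝓝[>] 0) (𝓝 1) := by
    have hc : Continuous fun t : ℝ≥0 => ρ (Complex.exp (-((t : ℝ) * z))) :=
      (continuous_algHom_complex ρ).comp (by fun_prop)
    exact Tendsto.mono_left (by simpa using hc.tendsto 0) nhdsWithin_le_nhds
  have h2 := ((continuous_algHom_complex ρ).tendsto _).comp (tendsto_exp_sub_one_div (-z))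
  have h3 := (tendsto_clm_apply h1 h).add (tendsto_clm_apply h2 (tendsto_const_nhds (x := x)))
  have h4 : (1 : X →L[ℝ] X) y + ρ (-z) x = y - ρ z x := by
    simp [sub_eq_add_neg]
  rw [h4] at h3
  refine h3.congr fun t => ?_
  simp only [Function.comp_apply, twist_op_apply, map_smul, map_sub, map_one, mul_neg,
    _root_.smul_apply, _root_.sub_apply, one_apply_eq_self]
  rw [← smul_add]
  congr 1
  abel

/-- The converse direction follows by twisting back with `-z`. -/
theorem C0Semigroup.isGeneratorValue_twist (T : C0Semigroup ℝ X) (ρ : ℂ →ₐ[ℝ] (X →L[ℝ] X))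
    (hρ : ∀ c t x, ρ c (T.op t x) = T.op t (ρ c x)) (z : ℂ) {x y : X} :
    IsGeneratorValue (T.twist ρ hρ z).op x y ↔ IsGeneratorValue T.op x (y + ρ z x) := by
  constructor
  · intro h
    have hρ' : ∀ c t x, ρ c ((T.twist ρ hρ z).op t x) = (T.twist ρ hρ z).op t (ρ c x) := by
      intro c t x
      have hm : ∀ c d (y : X), ρ c (ρ d y) = ρ (c * d) y := fun c d y => by
        rw [map_mul, mul_apply_eq_comp]
      rw [twist_op_apply, twist_op_apply, ← hρ, hm, hm, mul_comm]
    have h1 := (T.twist ρ hρ z).isGeneratorValue_twist_of ρ hρ' (-z) h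
    have h2 : ((T.twist ρ hρ z).twist ρ hρ' (-z)).op = T.op := by
      funext t
      ext x
      rw [twist_op_apply, twist_op_apply, ← mul_apply_eq_comp, ← map_mul, ← Complex.exp_add]
      simp
    rw [h2] at h1
    simpa using h1
  · intro h
    simpa using T.isGeneratorValue_twist_of ρ hρ z h

end Twist

/-! ### Resolvents of complex contraction semigroups. -/

section ComplexResolvent

variable {X : Type*} [NormedAddCommGroup X] [NormedSpace ℂ X]

/-- The inverse of a complex linear operator is automatically complex linear, so the results for
real spaces suffice. -/
theorem hasBoundedInverse_of_real {Y : Type*} [NormedAddCommGroup Y] [NormedSpace ℂ Y]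
    (L : X →ₗ.[ℂ] Y) (R : Y →L[ℝ] X) (h1 : ∀ y, ∃ h : R y ∈ L.domain, L ⟨R y, h⟩ = y)
    (h2 : ∀ x : L.domain, R (L x) = x) : HasBoundedInverse L := by
  have hR : ∀ (c : ℂ) y, R (c • y) = c • R y := by
    intro c y
    obtain ⟨h, hy⟩ := h1 y
    have h3 := h2 (c • ⟨R y, h⟩)
    rw [L.map_smul, hy] at h3
    exact h3
  exact ⟨⟨{ toFun := R, map_add' := map_add R, map_smul' := hR }, R.continuous⟩, h1, h2⟩

/-- A complex semigroup, as a real one. -/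
def C0Semigroup.restrictScalars (T : C0Semigroup ℂ X) : C0Semigroup ℝ X where
  op t := (T.op t).restrictScalars ℝ
  op_zero := by ext x; simp [T.op_zero]
  op_add s t := by ext x; simp [T.op_add]
  tendsto_zero := T.tendsto_zero

/-- The multiplication by complex scalars. -/
def complexScalars (X : Type*) [NormedAddCommGroup X] [NormedSpace ℂ X] :
    ℂ →ₐ[ℝ] (X →L[ℝ] X) where
  toFun c := (c • ContinuousLinearMap.id ℂ X).restrictScalars ℝ
  map_one' := by ext; simp
  map_mul' c d := by ext; simp [mul_smul]
  map_zero' := by ext; simp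
  map_add' c d := by ext; simp [add_smul]
  commutes' r := by ext; simp [Algebra.algebraMap_eq_smul_one]

theorem complexScalars_apply (c : ℂ) (x : X) : complexScalars X c x = c • x := rfl

theorem isGeneratorValue_restrictScalars_iff (T : C0Semigroup ℂ X) {x y : X} :
    IsGeneratorValue T.restrictScalars.op x y ↔ IsGeneratorValue T.op x y := by
  rw [isGeneratorValue_real_iff]
  refine tendsto_congr fun t => ?_
  rw [← Complex.coe_smul, Complex.ofReal_inv]
  rfl

variable [CompleteSpace X]

/-- The twisted operator `e^{-z} T(1)` has norm at most `e^{-Re z} < 1`. -/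
theorem hasBoundedInverse_shift_of_contraction (T : C0Semigroup ℂ X) (hT : ∀ t, ‖T.op t‖ ≤ 1)
    {z : ℂ} (hz : 0 < z.re) : HasBoundedInverse (shift (generator T.op) z) := by
  have hρ : ∀ c t x, complexScalars X c (T.restrictScalars.op t x) =
      T.restrictScalars.op t (complexScalars X c x) := by
    intro c t x
    exact ((T.op t).map_smul c x).symm
  set T' := T.restrictScalars.twist (complexScalars X) hρ z with hT'
  have hn : ‖T'.op 1‖ < 1 := by
    refine lt_of_le_of_lt (ContinuousLinearMap.opNorm_le_bound _ (Real.exp_pos (-z.re)).le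
      fun x => ?_) (Real.exp_lt_one_iff.2 (neg_neg_of_pos hz))
    rw [hT', C0Semigroup.twist_op_apply, complexScalars_apply, norm_smul, Complex.norm_exp]
    have h1 : ‖T.restrictScalars.op 1 x‖ ≤ ‖x‖ := by
      have := (T.op 1).le_of_opNorm_le (hT 1) x
      rwa [one_mul] at this
    have h2 := mul_le_mul_of_nonneg_left h1 (Real.exp_pos (-z.re)).le
    simpa using h2
  obtain ⟨R, hR1, hR2⟩ := T'.exists_inverse_of_norm_lt_one hn
  have hgen : ∀ x y, IsGeneratorValue T'.op x y ↔ IsGeneratorValue T.op x (y + z • x) := by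
    intro x y
    rw [← isGeneratorValue_restrictScalars_iff, hT', C0Semigroup.isGeneratorValue_twist,
      complexScalars_apply]
  -- The sign arises because the twisted semigroup is generated by `L - z`, while `shift` is `z -
  -- L`.
  refine hasBoundedInverse_of_real _ (-R) (fun y => ?_) fun x => ?_
  · have h1 := (hgen _ _).1 (hR1 (-y))
    rw [map_neg] at h1
    obtain ⟨h, hy⟩ := h1.exists_generator_eq
    refine ⟨h, ?_⟩
    change z • (-R y) - generator T.op ⟨-R y, h⟩ = y
    rw [hy]
    abel
  · have h1 := generator_spec (T := T.op) x
    have h2 := hR2 _ _ ((hgen x (generator T.op x - z • (x : X))).2 (by simpa using h1))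
    change -R (z • (x : X) - generator T.op x) = x
    rw [← map_neg, neg_sub, h2]

end ComplexResolvent

/-! ### Eigenfunctionals of eventually compact semigroups -/

section Eigenfunctional

variable {X Y : Type*} [NormedAddCommGroup X] [NormedSpace ℝ X] [NormedAddCommGroup Y]
  [NormedSpace ℝ Y]

/-- The restriction of a semigroup to an invariant subspace. -/
def C0Semigroup.restrict (T : C0Semigroup ℝ X) (F : Submodule ℝ X)
    (hF : ∀ t, ∀ x ∈ F, T.op t x ∈ F) : C0Semigroup ℝ F where
  op t := ((T.op t).comp F.subtypeL).codRestrict F fun x => hF t x x.2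
  op_zero := by ext x; simp [T.op_zero]
  op_add s t := by
    ext x
    exact T.op_add_apply s t x
  tendsto_zero x := tendsto_subtype_rng.2 (T.tendsto_zero x)

theorem isGeneratorValue_restrict_iff (T : C0Semigroup ℝ X) (F : Submodule ℝ X)
    (hF : ∀ t, ∀ x ∈ F, T.op t x ∈ F) {x y : F} :
    IsGeneratorValue (T.restrict F hF).op x y ↔ IsGeneratorValue T.op (x : X) y := by
  rw [isGeneratorValue_real_iff, isGeneratorValue_real_iff, tendsto_subtype_rng]
  rfl

/-- The product semigroup. -/
def C0Semigroup.prod (T : C0Semigroup ℝ X) (T' : C0Semigroup ℝ Y) : C0Semigroup ℝ (X × Y) where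
  op t := (T.op t).prodMap (T'.op t)
  op_zero := by ext x <;> simp [T.op_zero, T'.op_zero]
  op_add s t := by ext x <;> simp [T.op_add, T'.op_add]
  tendsto_zero x := (T.tendsto_zero x.1).prodMk_nhds (T'.tendsto_zero x.2)

theorem isGeneratorValue_prod_iff (T : C0Semigroup ℝ X) (T' : C0Semigroup ℝ Y) {x y : X × Y} :
    IsGeneratorValue (T.prod T').op x y ↔
      IsGeneratorValue T.op x.1 y.1 ∧ IsGeneratorValue T'.op x.2 y.2 := by
  simp only [isGeneratorValue_real_iff, Prod.tendsto_iff]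
  rfl

/-- The operator `(x, y) ↦ (-y, x)`. -/
def complexUnit (X : Type*) [NormedAddCommGroup X] [NormedSpace ℝ X] : X × X →L[ℝ] X × X :=
  (-ContinuousLinearMap.snd ℝ X X).prod (ContinuousLinearMap.fst ℝ X X)

/-- The complex structure of the complexification of `X`. -/
def complexStructure (X : Type*) [NormedAddCommGroup X] [NormedSpace ℝ X] :
    ℂ →ₐ[ℝ] (X × X →L[ℝ] X × X) :=
  Complex.lift ⟨complexUnit X, by ext x <;> simp [complexUnit]⟩

theorem complexStructure_apply (c : ℂ) (x : X × X) :
    complexStructure X c x = (c.re • x.1 - c.im • x.2, c.im • x.1 + c.re • x.2) := by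
  have : complexStructure X c x = c.re • x + c.im • complexUnit X x := by
    simp [complexStructure, Complex.lift, Algebra.algebraMap_eq_smul_one]
  rw [this]
  ext <;> simp [complexUnit, sub_eq_add_neg, add_comm]

variable [CompleteSpace X]

/-- If a restriction of the generator of an eventually compact semigroup has a spectral value `z`,
then the adjoint of the restricted semigroup has an eigenvector, with eigenvalues `e^{tz}`. -/
theorem exists_eigenfunctional (T : C0Semigroup ℝ X) (hT : EventuallyCompact T)
    (F : Submodule ℝ X) (hFc : IsClosed (F : Set X)) (hF : ∀ t, ∀ x ∈ F, T.op t x ∈ F) {z : ℂ}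
    (hz : z ∈ complexSpec (partIn (generator T.op) F)) :
    ∃ Z : F →L[ℝ] ℂ, Z ≠ 0 ∧
      ∀ (t : ℝ≥0) (x : F), Z ((T.restrict F hF).op t x) = Complex.exp ((t : ℝ) * z) * Z x := by
  have : CompleteSpace F := hFc.completeSpace_coe
  set TF := T.restrict F hF with hTF
  have hρ : ∀ c t x, complexStructure F c ((TF.prod TF).op t x) =
      (TF.prod TF).op t (complexStructure F c x) := by
    intro c t x
    rw [complexStructure_apply, complexStructure_apply]
    change (c.re • TF.op t x.1 - c.im • TF.op t x.2, c.im • TF.op t x.1 + c.re • TF.op t x.2) =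
      (TF.op t (c.re • x.1 - c.im • x.2), TF.op t (c.im • x.1 + c.re • x.2))
    rw [map_sub, map_add, map_smul, map_smul, map_smul, map_smul]
  set T' := (TF.prod TF).twist (complexStructure F) hρ z with hT'
  obtain ⟨t₀, -, ht₀⟩ := hT
  have hTFc : IsCompactOperator (TF.op t₀) :=
    (ht₀.comp_clm F.subtypeL).codRestrict _ hFc
  have hcomp : IsCompactOperator (T'.op t₀) := by
    have h1 : IsCompactOperator ((TF.prod TF).op t₀) := by
      have h2 := ((hTFc.comp_clm (ContinuousLinearMap.fst ℝ F F)).clm_comp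
        (ContinuousLinearMap.inl ℝ F F)).add ((hTFc.comp_clm
          (ContinuousLinearMap.snd ℝ F F)).clm_comp (ContinuousLinearMap.inr ℝ F F))
      have h3 : ⇑((TF.prod TF).op t₀) = ⇑(ContinuousLinearMap.inl ℝ F F) ∘ ⇑(TF.op t₀) ∘
          ⇑(ContinuousLinearMap.fst ℝ F F) + ⇑(ContinuousLinearMap.inr ℝ F F) ∘ ⇑(TF.op t₀) ∘
            ⇑(ContinuousLinearMap.snd ℝ F F) := by
        funext x
        exact Prod.ext (add_zero _).symm (zero_add _).symm
      rwa [h3]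
    exact h1.clm_comp (complexStructure F (Complex.exp (-((t₀ : ℝ) * z))))
  rcases T'.exists_fixed_functional_or_inverse hcomp with ⟨φ, hφ, hφT⟩ | ⟨R, hR1, hR2⟩
  -- A real functional on the complexification is the real part of a complex one: `φ(x, y) = Re (Z x
  -- + i Z y)` forces `Z = u - i v`.
  · set u : F →L[ℝ] ℝ := φ.comp (ContinuousLinearMap.inl ℝ F F) with hu
    set v : F →L[ℝ] ℝ := φ.comp (ContinuousLinearMap.inr ℝ F F) with hv
    have hsplit : ∀ x y, φ (x, y) = u x + v y := by
      intro x y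
      rw [hu, hv, ContinuousLinearMap.comp_apply, ContinuousLinearMap.comp_apply, ← map_add]
      simp
    refine ⟨Complex.ofRealCLM.comp u - Complex.I • Complex.ofRealCLM.comp v, fun h0 => hφ ?_,
      fun t x => ?_⟩
    · ext x
      · have := congrArg (fun A : F →L[ℝ] ℂ => (A x).re) h0
        simpa [hu] using this
      · have := congrArg (fun A : F →L[ℝ] ℂ => (A x).im) h0
        simpa [hv] using this
    · have h1 := hφT t (x, 0)
      have h2 := hφT t (0, x)
      rw [hT', C0Semigroup.twist_op_apply, complexStructure_apply, hsplit, hsplit] at h1 h2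
      set c := Complex.exp (-((t : ℝ) * z)) with hc
      change u (c.re • TF.op t x - c.im • TF.op t 0) + v (c.im • TF.op t x + c.re • TF.op t 0) =
        u x + v 0 at h1
      change u (c.re • TF.op t 0 - c.im • TF.op t x) + v (c.im • TF.op t 0 + c.re • TF.op t x) =
        u 0 + v x at h2
      simp only [map_zero, smul_zero, sub_zero, add_zero, zero_sub, zero_add, map_neg, map_smul,
        smul_eq_mul] at h1 h2
      have hcc : Complex.exp ((t : ℝ) * z) * c = 1 := by
        rw [hc, ← Complex.exp_add]; simp
      have h3 : (u x : ℂ) - Complex.I * v x = c * (u (TF.op t x) - Complex.I * v (TF.op t x)) := by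
        rw [← h1, ← h2]
        apply Complex.ext <;> simp
      change (u (TF.op t x) : ℂ) - Complex.I * v (TF.op t x) =
        Complex.exp ((t : ℝ) * z) * ((u x : ℂ) - Complex.I * v x)
      rw [h3, ← mul_assoc, hcc, one_mul]
  · refine absurd ?_ hz
    have hgen : ∀ x y : F × F, IsGeneratorValue T'.op x y ↔
        IsGeneratorValue T.op (x.1 : X) ((y + complexStructure F z x).1 : X) ∧
          IsGeneratorValue T.op (x.2 : X) ((y + complexStructure F z x).2 : X) := by
      intro x y
      rw [hT', C0Semigroup.isGeneratorValue_twist, isGeneratorValue_prod_iff, hTF,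
        isGeneratorValue_restrict_iff, isGeneratorValue_restrict_iff]
    refine ⟨-R, fun y => ?_, fun x => ?_⟩
    · have h0 := hR1 (-y)
      rw [map_neg] at h0
      obtain ⟨h1, h2⟩ := (hgen _ _).1 h0
      obtain ⟨d1, e1⟩ := h1.exists_generator_eq
      obtain ⟨d2, e2⟩ := h2.exists_generator_eq
      have m1 : (-R y).1 ∈ (partIn (generator T.op) F).domain := ⟨d1, by rw [e1]; exact Subtype.prop _⟩
      have m2 : (-R y).2 ∈ (partIn (generator T.op) F).domain := ⟨d2, by rw [e2]; exact Subtype.prop _⟩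
      have f1 : partIn (generator T.op) F ⟨_, m1⟩ = (-y + complexStructure F z (-R y)).1 :=
        Subtype.ext e1
      have f2 : partIn (generator T.op) F ⟨_, m2⟩ = (-y + complexStructure F z (-R y)).2 :=
        Subtype.ext e2
      refine ⟨⟨m1, m2⟩, ?_⟩
      change (z.re • (-R y).1 - z.im • (-R y).2 - partIn (generator T.op) F ⟨_, m1⟩,
        z.im • (-R y).1 + z.re • (-R y).2 - partIn (generator T.op) F ⟨_, m2⟩) = y
      rw [f1, f2, complexStructure_apply]
      ext <;> simp
    · obtain ⟨⟨x1, x2⟩, ⟨m1, m1'⟩, ⟨m2, m2'⟩⟩ := x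
      have g1 := generator_spec (T := T.op) ⟨_, m1⟩
      have g2 := generator_spec (T := T.op) ⟨_, m2⟩
      have h2 := hR2 (x1, x2) ((⟨_, m1'⟩, ⟨_, m2'⟩) - complexStructure F z (x1, x2))
        ((hgen _ _).2 (by simpa using ⟨g1, g2⟩))
      change -R (z.re • x1 - z.im • x2 - ⟨_, m1'⟩, z.im • x1 + z.re • x2 - ⟨_, m2'⟩) = (x1, x2)
      rw [← map_neg]
      refine Eq.trans (congrArg R ?_) h2
      rw [complexStructure_apply]
      ext <;> simp

end Eigenfunctional

/-! ### Measures with separable support -/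

section SeparableSupport

/-- The measure `μ` is concentrated on a separable set. -/
def HasSeparableSupport {α : Type*} [TopologicalSpace α] [MeasurableSpace α] (μ : Measure α) :
    Prop :=
  ∃ s : Set α, TopologicalSpace.IsSeparable s ∧ ∀ᵐ x ∂μ, x ∈ s

variable {E : Type*} [NormedAddCommGroup E] [MeasurableSpace E]

theorem HasSeparableSupport.mono_ac {μ ν : Measure E} (h : HasSeparableSupport μ) (hν : ν ≪ μ) :
    HasSeparableSupport ν := by
  obtain ⟨s, hs, hsμ⟩ := h
  exact ⟨s, hs, hν.ae_le hsμ⟩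

variable [BorelSpace E]

/-- Countably many compact sets exhaust the measure. This lets the later arguments do without
separability of `E`. -/
theorem hasSeparableSupport_of_innerRegular {μ : Measure E} [IsFiniteMeasure μ]
    (h : μ.InnerRegular) : HasSeparableSupport μ := by
  have key : ∀ n : ℕ, ∃ K : Set E, IsCompact K ∧ μ Kᶜ < 1 / ((n : ℝ≥0∞) + 1) := by
    intro n
    obtain ⟨K, -, hK, hKm, hlt⟩ := MeasurableSet.univ.exists_isCompact_isClosed_sdiff_lt (μ := μ)
      (measure_ne_top _ _) (ε := 1 / ((n : ℝ≥0∞) + 1)) (by simp)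
    exact ⟨K, hK, by rwa [Set.compl_eq_univ_sdiff]⟩
  choose K hK hlt using key
  refine ⟨⋃ n, K n, TopologicalSpace.isSeparable_iUnion.2 fun n => (hK n).isSeparable, ?_⟩
  rw [ae_iff]
  refine le_antisymm (ge_of_tendsto' ENNReal.tendsto_inv_nat_nhds_zero fun n => ?_) zero_le
  refine (measure_mono (Set.compl_subset_compl.2 (Set.subset_iUnion K n))).trans
    ((hlt n).le.trans ?_)
  rw [one_div]
  exact ENNReal.inv_le_inv.2 le_self_add

theorem HasSeparableSupport.aestronglyMeasurable_id {μ : Measure E} (h : HasSeparableSupport μ) :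
    AEStronglyMeasurable (fun x : E => x) μ :=
  aestronglyMeasurable_iff_aemeasurable_separable.2 ⟨aemeasurable_id, h⟩

variable [NormedSpace ℝ E] [CompleteSpace E]

/-- Both measures live on one closed separable subspace, where uniqueness of characteristic
functions is available; functionals on it extend to `E` by Hahn-Banach. -/
theorem HasSeparableSupport.ext_of_charFunDual {μ ν : Measure E} [IsFiniteMeasure μ]
    [IsFiniteMeasure ν] (hμ : HasSeparableSupport μ) (hν : HasSeparableSupport ν)
    (h : ∀ L, charFunDual μ L = charFunDual ν L) : μ = ν := by
  obtain ⟨s, hs, hsμ⟩ := hμ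
  obtain ⟨s', hs', hsν⟩ := hν
  set G : Submodule ℝ E := (Submodule.span ℝ (s ∪ s')).topologicalClosure with hG
  have hGcl : IsClosed (G : Set E) := Submodule.isClosed_topologicalClosure _
  have hsub : s ∪ s' ⊆ G := Submodule.subset_span.trans (Submodule.le_topologicalClosure _)
  have hsep : TopologicalSpace.IsSeparable (G : Set E) :=
    ((hs.union hs').span (R := ℝ)).closure
  have : TopologicalSpace.SeparableSpace G := hsep.separableSpace
  have : SecondCountableTopology G := UniformSpace.secondCountable_of_separable G
  have : CompleteSpace G := hGcl.completeSpace_coe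
  have hemb : MeasurableEmbedding ((↑) : G → E) := .subtype_coe hGcl.measurableSet
  have hmap : ∀ (ρ : Measure E), (∀ᵐ x ∂ρ, x ∈ G) → (ρ.comap ((↑) : G → E)).map G.subtypeL = ρ := by
    intro ρ hρ
    have h1 : (ρ.comap ((↑) : G → E)).map ((↑) : G → E) = ρ.restrict (Set.range ((↑) : G → E)) :=
      hemb.map_comap ρ
    rw [Subtype.range_coe] at h1
    exact h1.trans (Measure.restrict_eq_self_of_ae_mem hρ)
  have hμG := hmap μ (hsμ.mono fun x hx => hsub (Or.inl hx))
  have hνG := hmap ν (hsν.mono fun x hx => hsub (Or.inr hx))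
  have hfin : ∀ (ρ : Measure E) [IsFiniteMeasure ρ], IsFiniteMeasure (ρ.comap ((↑) : G → E)) :=
    fun ρ _ => ⟨by rw [hemb.comap_apply]; exact measure_lt_top _ _⟩
  have := hfin μ
  have := hfin ν
  have key : μ.comap ((↑) : G → E) = ν.comap ((↑) : G → E) := by
    refine Measure.ext_of_charFunDual (funext fun L => ?_)
    obtain ⟨g, hg, -⟩ := exists_extension_norm_eq G L
    have hgL : g.comp G.subtypeL = L := by ext x; exact hg x
    rw [← hgL, ← charFunDual_map, ← charFunDual_map, hμG, hνG, h]
  rw [← hμG, ← hνG, key]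

/-- The positive and negative parts of `h` are densities of two finite measures with equal
characteristic functions. -/
theorem HasSeparableSupport.ae_eq_zero_of_integral_real {μ : Measure E} [IsFiniteMeasure μ]
    (hμ : HasSeparableSupport μ) {h : E → ℝ} (hi : Integrable h μ)
    (h0 : ∀ L : StrongDual ℝ E, ∫ x, (h x : ℂ) * Complex.exp (L x * Complex.I) ∂μ = 0) :
    h =ᵐ[μ] 0 := by
  have hae : ∀ k : E → ℝ, Integrable k μ → AEMeasurable (fun x => ENNReal.ofReal (k x)) μ :=
    fun k hk => hk.aestronglyMeasurable.aemeasurable.ennreal_ofReal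
  have hfin : ∀ k : E → ℝ, Integrable k μ →
      IsFiniteMeasure (μ.withDensity fun x => ENNReal.ofReal (k x)) := fun k hk =>
    isFiniteMeasure_withDensity_ofReal hk.2
  have := hfin h hi
  have := hfin (-h) hi.neg
  have hchar : ∀ k : E → ℝ, Integrable k μ → ∀ L : StrongDual ℝ E,
      charFunDual (μ.withDensity fun x => ENNReal.ofReal (k x)) L =
        ∫ x, ((max (k x) 0 : ℝ) : ℂ) * Complex.exp (L x * Complex.I) ∂μ := by
    intro k hk L
    rw [charFunDual_apply, integral_withDensity_eq_integral_toReal_smul₀ (hae k hk)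
      (Eventually.of_forall fun x => ENNReal.ofReal_lt_top)]
    simp [ENNReal.toReal_ofReal']
  have hint : ∀ k : E → ℝ, Integrable k μ → ∀ L : StrongDual ℝ E,
      Integrable (fun x => ((max (k x) 0 : ℝ) : ℂ) * Complex.exp (L x * Complex.I)) μ := by
    intro k hk L
    refine hk.pos_part.ofReal.mul_bdd (c := 1) ?_ (Eventually.of_forall fun x => ?_)
    · exact (by fun_prop : Continuous fun x => Complex.exp (L x * Complex.I)).aestronglyMeasurable
    · rw [Complex.norm_exp_ofReal_mul_I]
  have key : μ.withDensity (fun x => ENNReal.ofReal (h x)) =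
      μ.withDensity (fun x => ENNReal.ofReal ((-h) x)) := by
    refine HasSeparableSupport.ext_of_charFunDual (hμ.mono_ac (withDensity_absolutelyContinuous _ _))
      (hμ.mono_ac (withDensity_absolutelyContinuous _ _)) fun L => ?_
    rw [hchar h hi, hchar _ hi.neg, ← sub_eq_zero, ← integral_sub (hint h hi L) (hint _ hi.neg L),
      ← h0 L]
    refine integral_congr_ae (Eventually.of_forall fun x => ?_)
    simp only [Pi.neg_apply]
    rw [← sub_mul, ← Complex.ofReal_sub]
    congr 2
    rcases le_total (h x) 0 with hx | hx
    · rw [max_eq_right hx, max_eq_left (by linarith)]; ring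
    · rw [max_eq_left hx, max_eq_right (by linarith)]; ring
  rw [withDensity_eq_iff_of_sigmaFinite (hae h hi) (hae _ hi.neg)] at key
  filter_upwards [key] with x hx
  simp only [Pi.neg_apply] at hx
  rcases le_total (h x) 0 with h1 | h1
  · rw [ENNReal.ofReal_of_nonpos h1, eq_comm, ENNReal.ofReal_eq_zero] at hx
    exact le_antisymm h1 (neg_nonpos.1 hx)
  · rw [ENNReal.ofReal_of_nonpos (p := -h x) (by linarith), ENNReal.ofReal_eq_zero] at hx
    exact le_antisymm hx h1

/-- Conjugating the hypothesis for `-L` shows that the conjugate of `g` satisfies it too, hence so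
do its real and imaginary parts. -/
theorem HasSeparableSupport.ae_eq_zero_of_integral {μ : Measure E} [IsFiniteMeasure μ]
    (hμ : HasSeparableSupport μ) {g : E → ℂ} (hi : Integrable g μ)
    (h0 : ∀ L : StrongDual ℝ E, ∫ x, g x * Complex.exp (L x * Complex.I) ∂μ = 0) :
    g =ᵐ[μ] 0 := by
  have hbd : ∀ (k : E → ℂ), Integrable k μ → ∀ L : StrongDual ℝ E,
      Integrable (fun x => k x * Complex.exp (L x * Complex.I)) μ := by
    intro k hk L
    refine hk.mul_bdd (c := 1) ?_ (Eventually.of_forall fun x => ?_)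
    · exact (by fun_prop : Continuous fun x => Complex.exp (L x * Complex.I)).aestronglyMeasurable
    · rw [Complex.norm_exp_ofReal_mul_I]
  have hic : Integrable (fun x => (starRingEnd ℂ) (g x)) μ :=
    (Complex.conjCLE.toContinuousLinearMap.integrable_comp hi :)
  have h1 : ∀ L : StrongDual ℝ E,
      ∫ x, (starRingEnd ℂ) (g x) * Complex.exp (L x * Complex.I) ∂μ = 0 := by
    intro L
    have h2 := congrArg (starRingEnd ℂ) (h0 (-L))
    rw [← integral_conj, map_zero] at h2
    rw [← h2]
    refine integral_congr_ae (Eventually.of_forall fun x => ?_)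
    simp [← Complex.exp_conj]
  have hre : (fun x => (g x).re) =ᵐ[μ] 0 := by
    refine hμ.ae_eq_zero_of_integral_real hi.re fun L => ?_
    have h2 : ∀ x, ((g x).re : ℂ) * Complex.exp (L x * Complex.I) =
        (1 / 2 : ℂ) * (g x * Complex.exp (L x * Complex.I) +
          (starRingEnd ℂ) (g x) * Complex.exp (L x * Complex.I)) := by
      intro x
      rw [← add_mul, Complex.add_conj]
      push_cast
      ring
    simp only [h2]
    rw [integral_const_mul, integral_add (hbd _ hi L) (hbd _ hic L), h0, h1]
    simp
  have him : (fun x => (g x).im) =ᵐ[μ] 0 := by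
    refine hμ.ae_eq_zero_of_integral_real hi.im fun L => ?_
    have h2 : ∀ x, ((g x).im : ℂ) * Complex.exp (L x * Complex.I) =
        (1 / (2 * Complex.I) : ℂ) * (g x * Complex.exp (L x * Complex.I) -
          (starRingEnd ℂ) (g x) * Complex.exp (L x * Complex.I)) := by
      intro x
      rw [← sub_mul, Complex.sub_conj]
      field_simp
      push_cast
      ring
    simp only [h2]
    rw [integral_const_mul, integral_sub (hbd _ hi L) (hbd _ hic L), h0, h1]
    simp
  filter_upwards [hre, him] with x h2 h3
  exact Complex.ext h2 h3

/-- The inclusion of `L²` in `L¹`. -/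
def l2ToL1 (μ : Measure E) [IsProbabilityMeasure μ] : Lp ℂ 2 μ →L[ℂ] Lp ℂ 1 μ :=
  LinearMap.mkContinuous
    { toFun := fun f => ((Lp.memLp f).mono_exponent one_le_two).toLp f
      map_add' := fun f g => by
        rw [← MemLp.toLp_add]
        exact MemLp.toLp_congr _ _ (Lp.coeFn_add f g)
      map_smul' := fun c f => by
        rw [RingHom.id_apply, ← MemLp.toLp_const_smul]
        exact MemLp.toLp_congr _ _ (Lp.coeFn_smul c f) }
    1 (fun f => by
      rw [one_mul]
      change ‖((Lp.memLp f).mono_exponent one_le_two).toLp f‖ ≤ _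
      rw [Lp.norm_toLp, Lp.norm_def]
      exact ENNReal.toReal_mono (Lp.eLpNorm_ne_top f)
        (eLpNorm_le_eLpNorm_of_exponent_le one_le_two (Lp.aestronglyMeasurable f)))

omit [NormedSpace ℝ E] [CompleteSpace E] in
theorem l2ToL1_toLp (μ : Measure E) [IsProbabilityMeasure μ] (f : E →ᵇ ℂ) :
    l2ToL1 μ (BoundedContinuousFunction.toLp 2 μ ℂ f) = BoundedContinuousFunction.toLp 1 μ ℂ f := by
  refine Lp.ext ?_
  have h1 : l2ToL1 μ (BoundedContinuousFunction.toLp 2 μ ℂ f) =ᵐ[μ]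
      BoundedContinuousFunction.toLp 2 μ ℂ f :=
    MemLp.coeFn_toLp ((Lp.memLp (BoundedContinuousFunction.toLp 2 μ ℂ f)).mono_exponent one_le_two)
  filter_upwards [h1, BoundedContinuousFunction.coeFn_toLp 2 μ ℂ f,
    BoundedContinuousFunction.coeFn_toLp 1 μ ℂ f] with x h2 h3 h4
  rw [h2, h3, h4]

/-- The functions `x ↦ e^{i⟨x, x'⟩}` span a dense subspace of `L¹`. -/
theorem HasSeparableSupport.dense_span_probCharDual {μ : Measure E} [IsProbabilityMeasure μ]
    (hμ : HasSeparableSupport μ) :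
    Dense (Submodule.span ℂ (Set.range fun L : StrongDual ℝ E =>
      BoundedContinuousFunction.toLp 1 μ ℂ (probCharDual L)) : Set (Lp ℂ 1 μ)) := by
  set K : Submodule ℂ (Lp ℂ 2 μ) := Submodule.span ℂ (Set.range fun L : StrongDual ℝ E =>
      BoundedContinuousFunction.toLp 2 μ ℂ (probCharDual L)) with hK
  -- In `L²` density can be tested on the orthogonal complement; it is then transported along the
  -- inclusion into `L¹`, which has dense range.
  have hKd : Dense (K : Set (Lp ℂ 2 μ)) := by
    rw [Submodule.dense_iff_topologicalClosure_eq_top, Submodule.topologicalClosure_eq_top_iff,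
      Submodule.eq_bot_iff]
    intro g hg
    have hgi : Integrable g μ := (Lp.memLp g).integrable one_le_two
    have h1 : ∀ L : StrongDual ℝ E,
        ∫ x, (starRingEnd ℂ) (g x) * Complex.exp (L x * Complex.I) ∂μ = 0 := by
      intro L
      have h2 := (Submodule.mem_orthogonal' _ _).1 hg _ (Submodule.subset_span ⟨L, rfl⟩)
      rw [L2.inner_def] at h2
      rw [← h2]
      refine integral_congr_ae ?_
      filter_upwards [BoundedContinuousFunction.coeFn_toLp 2 μ ℂ (probCharDual L)] with x hx
      rw [hx, probCharDual_apply, RCLike.inner_apply, mul_comm]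
    have h3 := hμ.ae_eq_zero_of_integral
      (Complex.conjCLE.toContinuousLinearMap.integrable_comp hgi) h1
    refine (Lp.eq_zero_iff_ae_eq_zero).2 ?_
    filter_upwards [h3] with x hx
    simpa using hx
  have hdr : DenseRange (l2ToL1 μ) := by
    refine (BoundedContinuousFunction.toLp_denseRange (α := E) ℂ μ ℂ ENNReal.one_ne_top).mono ?_
    rintro _ ⟨f, rfl⟩
    exact ⟨_, l2ToL1_toLp μ f⟩
  refine (hdr.dense_image (l2ToL1 μ).continuous hKd).mono ?_
  rintro _ ⟨f, hf, rfl⟩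
  have h1 : l2ToL1 μ f ∈ K.map (l2ToL1 μ).toLinearMap := ⟨f, hf, rfl⟩
  rw [hK, Submodule.map_span, ← Set.range_comp] at h1
  have h2 : (⇑(l2ToL1 μ).toLinearMap ∘ fun L : StrongDual ℝ E =>
      BoundedContinuousFunction.toLp 2 μ ℂ (probCharDual L)) = fun L =>
      BoundedContinuousFunction.toLp 1 μ ℂ (probCharDual L) := funext fun L => l2ToL1_toLp μ _
  rwa [h2] at h1

end SeparableSupport

/-! ### Transition operators in `L¹` -/

section Transition

variable {E : Type*} [NormedAddCommGroup E] [NormedSpace ℝ E] [MeasurableSpace E] [BorelSpace E]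

theorem transition_apply (T : E →L[ℝ] E) (ν : Measure E) [IsProbabilityMeasure ν] (f : E →ᵇ ℂ)
    (x : E) : transition T ν f x = ∫ y, f (T x + y) ∂ν := rfl

theorem integrable_comp_add (T : E →L[ℝ] E) (ν : Measure E) [IsProbabilityMeasure ν] (f : E →ᵇ ℂ)
    (x : E) : Integrable (fun y => f (T x + y)) ν :=
  (integrable_const ‖f‖).mono' (f.continuous.comp (by fun_prop)).aestronglyMeasurable
    (Eventually.of_forall fun _ => f.norm_coe_le_norm _)

theorem transition_add (T : E →L[ℝ] E) (ν : Measure E) [IsProbabilityMeasure ν] (f g : E →ᵇ ℂ) :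
    transition T ν (f + g) = transition T ν f + transition T ν g := by
  ext x
  exact integral_add (integrable_comp_add T ν f x) (integrable_comp_add T ν g x)

theorem transition_smul (T : E →L[ℝ] E) (ν : Measure E) [IsProbabilityMeasure ν] (c : ℂ)
    (f : E →ᵇ ℂ) : transition T ν (c • f) = c • transition T ν f := by
  ext x
  exact integral_const_mul _ _

theorem transition_probCharDual (T : E →L[ℝ] E) (ν : Measure E) [IsProbabilityMeasure ν]
    (L : StrongDual ℝ E) :
    transition T ν (probCharDual L) = charFunDual ν L • probCharDual (L.comp T) := by
  ext x
  rw [transition_apply, BoundedContinuousFunction.smul_apply, smul_eq_mul, charFunDual_apply,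
    mul_comm, ← integral_const_mul]
  refine integral_congr_ae (Eventually.of_forall fun y => ?_)
  simp [probCharDual_apply, add_mul, Complex.exp_add]

/-- `m` is the law of `T x + y` if `x` has law `m` and `y` has law `ν`. -/
def IsInvariantLaw (T : E →L[ℝ] E) (ν m : Measure E) : Prop :=
  ∀ f : E →ᵇ ℝ, ∫ x, ∫ y, f (T x + y) ∂ν ∂m = ∫ x, f x ∂m

/-- The hypothesis compares characteristic functions. In a nonseparable space addition need not be
measurable for the product σ-algebra, so separable supports are used to make `T x + y` almost
everywhere strongly measurable. -/
theorem isInvariantLaw_of_charFunDual [CompleteSpace E] {T : E →L[ℝ] E} {ν m : Measure E}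
    [IsProbabilityMeasure ν] [IsProbabilityMeasure m] (hν : HasSeparableSupport ν)
    (hm : HasSeparableSupport m)
    (h : ∀ L, charFunDual ν L * charFunDual m (L.comp T) = charFunDual m L) :
    IsInvariantLaw T ν m := by
  have hmeas : AEStronglyMeasurable (fun p : E × E => T p.1 + p.2) (m.prod ν) :=
    (T.continuous.comp_aestronglyMeasurable (hm.aestronglyMeasurable_id.comp_fst)).add
      hν.aestronglyMeasurable_id.comp_snd
  have hint : ∀ {V : Type} [NormedAddCommGroup V] (f : E →ᵇ V),
      Integrable (fun p : E × E => f (T p.1 + p.2)) (m.prod ν) := fun f =>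
    (integrable_const ‖f‖).mono' (f.continuous.comp_aestronglyMeasurable hmeas)
      (Eventually.of_forall fun _ => f.norm_coe_le_norm _)
  set ρ := (m.prod ν).map (fun p : E × E => T p.1 + p.2) with hρ
  have : IsProbabilityMeasure ρ := Measure.isProbabilityMeasure_map hmeas.aemeasurable
  have hsep : HasSeparableSupport ρ := by
    obtain ⟨s, hs, hsm⟩ := hm
    obtain ⟨s', hs', hsν⟩ := hν
    refine ⟨closure ((fun p : E × E => T p.1 + p.2) '' (s ×ˢ s')),
      ((hs.prod hs').image (by fun_prop)).closure, ?_⟩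
    refine (ae_map_iff hmeas.aemeasurable isClosed_closure.measurableSet).2 ?_
    filter_upwards [Measure.quasiMeasurePreserving_fst.ae hsm,
      Measure.quasiMeasurePreserving_snd.ae hsν] with p h1 h2
    exact subset_closure ⟨p, ⟨h1, h2⟩, rfl⟩
  have key : ρ = m := by
    refine hsep.ext_of_charFunDual hm fun L => ?_
    have h1 : ∫ p : E × E, Complex.exp (L (T p.1 + p.2) * Complex.I) ∂(m.prod ν) =
        ∫ x, ∫ y, Complex.exp (L (T x + y) * Complex.I) ∂ν ∂m :=
      integral_prod _ (hint (probCharDual L))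
    rw [charFunDual_apply, hρ, integral_map hmeas.aemeasurable
      (by fun_prop : Continuous fun v : E => Complex.exp (L v * Complex.I)).aestronglyMeasurable,
      h1, ← h L, charFunDual_apply (μ := m), ← integral_const_mul]
    refine integral_congr_ae (Eventually.of_forall fun x => ?_)
    have := congrArg (fun f : E →ᵇ ℂ => f x) (transition_probCharDual T ν L)
    simpa [transition_apply, probCharDual_apply] using this
  intro f
  calc ∫ x, ∫ y, f (T x + y) ∂ν ∂m = ∫ p : E × E, f (T p.1 + p.2) ∂(m.prod ν) :=
        (integral_prod _ (hint f)).symm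
    _ = ∫ x, f x ∂ρ := (integral_map hmeas.aemeasurable f.continuous.aestronglyMeasurable).symm
    _ = ∫ x, f x ∂m := by rw [key]

omit [NormedSpace ℝ E] in
theorem norm_toLp_one (m : Measure E) [IsFiniteMeasure m] (f : E →ᵇ ℂ) :
    ‖BoundedContinuousFunction.toLp 1 m ℂ f‖ = ∫ x, ‖f x‖ ∂m := by
  rw [L1.norm_eq_integral_norm]
  refine integral_congr_ae ?_
  filter_upwards [BoundedContinuousFunction.coeFn_toLp 1 m ℂ f] with x hx
  rw [hx]

variable {T : E →L[ℝ] E} {ν m : Measure E} [IsProbabilityMeasure ν] [IsFiniteMeasure m]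

/-- Invariance applied to `‖f‖`, together with the triangle inequality inside the integral, gives
contractivity in `L¹`; this is what makes the extension in `transitionL1` exist. -/
theorem IsInvariantLaw.norm_transition_le (h : IsInvariantLaw T ν m) (f : E →ᵇ ℂ) :
    ‖BoundedContinuousFunction.toLp 1 m ℂ (transition T ν f)‖ ≤
      ‖BoundedContinuousFunction.toLp 1 m ℂ f‖ := by
  rw [norm_toLp_one, norm_toLp_one]
  set g : E →ᵇ ℝ := f.normComp with hg
  have hgx : ∀ x, g x = ‖f x‖ := fun x => rfl
  have h1 := h g
  simp only [hgx] at h1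
  rw [← h1]
  have hcont : Continuous fun x => ∫ y, ‖f (T x + y)‖ ∂ν := by
    refine continuous_of_dominated (bound := fun _ => ‖f‖) (fun x => ?_)
      (fun x => Eventually.of_forall fun y => ?_) (integrable_const _)
      (Eventually.of_forall fun y => ?_)
    · exact (integrable_comp_add T ν f x).norm.aestronglyMeasurable
    · rw [norm_norm]; exact f.norm_coe_le_norm _
    · exact (f.continuous.comp (by fun_prop)).norm
  refine integral_mono_of_nonneg (Eventually.of_forall fun x => norm_nonneg _) ?_
    (Eventually.of_forall fun x => norm_integral_le_integral_norm _)
  refine (integrable_const ‖f‖).mono' hcont.aestronglyMeasurable (Eventually.of_forall fun x => ?_)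
  rw [Real.norm_of_nonneg (integral_nonneg fun _ => norm_nonneg _)]
  have := integral_mono (integrable_comp_add T ν f x).norm (integrable_const (μ := ν) ‖f‖)
    (fun y => f.norm_coe_le_norm (T x + y))
  simpa using this

omit [NormedSpace ℝ E] in
theorem denseRange_toLp_one (m : Measure E) [IsFiniteMeasure m] :
    DenseRange (BoundedContinuousFunction.toLp (α := E) 1 m ℂ : (E →ᵇ ℂ) →L[ℂ] Lp ℂ 1 m) :=
  BoundedContinuousFunction.toLp_denseRange ℂ m ℂ ENNReal.one_ne_top

theorem IsInvariantLaw.transitionL1_toLp (h : IsInvariantLaw T ν m) (f : E →ᵇ ℂ) :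
    transitionL1 T ν m (BoundedContinuousFunction.toLp 1 m ℂ f) =
      BoundedContinuousFunction.toLp 1 m ℂ (transition T ν f) := by
  have hex : ∃ P : Lp ℂ 1 m →L[ℂ] Lp ℂ 1 m, ∀ f : E →ᵇ ℂ,
      P (BoundedContinuousFunction.toLp 1 m ℂ f) =
        BoundedContinuousFunction.toLp 1 m ℂ (transition T ν f) := by
    let F : (E →ᵇ ℂ) →ₗ[ℂ] Lp ℂ 1 m :=
      { toFun := fun f => BoundedContinuousFunction.toLp 1 m ℂ (transition T ν f)
        map_add' := fun f g => by rw [transition_add, map_add]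
        map_smul' := fun c f => by rw [transition_smul, map_smul, RingHom.id_apply] }
    refine ⟨F.extendOfNorm (BoundedContinuousFunction.toLp (α := E) 1 m ℂ).toLinearMap,
      fun f => ?_⟩
    refine LinearMap.extendOfNorm_eq (denseRange_toLp_one m) ⟨1, fun f => ?_⟩ f
    rw [one_mul]
    exact h.norm_transition_le f
  rw [transitionL1, dif_pos hex]
  exact hex.choose_spec f

theorem IsInvariantLaw.norm_transitionL1_le (h : IsInvariantLaw T ν m) :
    ‖transitionL1 T ν m‖ ≤ 1 := by
  refine ContinuousLinearMap.opNorm_le_bound _ zero_le_one fun g => ?_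
  rw [one_mul]
  refine (denseRange_toLp_one m).induction_on (p := fun g => ‖transitionL1 T ν m g‖ ≤ ‖g‖) g
    (isClosed_le (by fun_prop) (by fun_prop)) fun f => ?_
  rw [h.transitionL1_toLp]
  exact h.norm_transition_le f

theorem IsInvariantLaw.transitionL1_probCharDual (h : IsInvariantLaw T ν m)
    (L : StrongDual ℝ E) :
    transitionL1 T ν m (BoundedContinuousFunction.toLp 1 m ℂ (probCharDual L)) =
      charFunDual ν L • BoundedContinuousFunction.toLp 1 m ℂ (probCharDual (L.comp T)) := by
  rw [h.transitionL1_toLp, transition_probCharDual, map_smul]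

end Transition

/-! ### Covariance forms -/

section Covariance

variable {E : Type*} [NormedAddCommGroup E] [NormedSpace ℝ E]

theorem exists_functional_of_notMem {F : Submodule ℝ E} (hF : IsClosed (F : Set E)) {x : E}
    (hx : x ∉ F) : ∃ L : StrongDual ℝ E, (∀ y ∈ F, L y = 0) ∧ L x ≠ 0 := by
  have : IsClosed (F : Set E) := hF
  have hne : ‖F.mkQ x‖ ≠ 0 := by simpa using hx
  obtain ⟨g, -, hg⟩ := exists_dual_vector ℝ (F.mkQ x) hne
  refine ⟨g.comp F.mkQL, fun y hy => ?_, ?_⟩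
  · have : F.mkQ y = 0 := by simpa using hy
    change g (F.mkQ y) = 0
    rw [this, map_zero]
  · change g (F.mkQ x) ≠ 0
    rw [hg]
    exact_mod_cast hne

section CovForm

variable {H : Type*} [NormedAddCommGroup H] [InnerProductSpace ℝ H] [CompleteSpace H]

theorem apply_noiseCov_self (T : E →L[ℝ] E) (B : H →L[ℝ] E) (L : StrongDual ℝ E) :
    L (T (noiseCov B (L.comp T))) = ‖(L.comp T).comp B‖ ^ 2 := by
  set ℓ : StrongDual ℝ H := (L.comp T).comp B with hℓ
  have h1 : L (T (noiseCov B (L.comp T))) = ℓ ((InnerProductSpace.toDual ℝ H).symm ℓ) := rfl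
  rw [h1, ← InnerProductSpace.toDual_symm_apply, real_inner_self_eq_norm_sq,
    LinearIsometryEquiv.norm_map]

theorem covForm_self (S : C0Semigroup ℝ E) (B : H →L[ℝ] E) (t : ℝ≥0) (L : StrongDual ℝ E) :
    covForm S B t L L = ∫ s in (0 : ℝ)..t, ‖(L.comp (S.op s.toNNReal)).comp B‖ ^ 2 := by
  simp only [covForm, apply_noiseCov_self]

theorem covForm_self_nonneg (S : C0Semigroup ℝ E) (B : H →L[ℝ] E) (t : ℝ≥0)
    (L : StrongDual ℝ E) : 0 ≤ covForm S B t L L := by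
  rw [covForm_self]
  exact intervalIntegral.integral_nonneg t.coe_nonneg fun s _ => sq_nonneg _

variable [CompleteSpace E]

-- The operator norm is only lower semicontinuous in `s`: its sublevel sets are intersections of
-- closed sets, one for each vector of `H`.
omit [CompleteSpace H] in
theorem measurable_norm_comp_op (S : C0Semigroup ℝ E) (B : H →L[ℝ] E) (L : StrongDual ℝ E) :
    Measurable fun s : ℝ => ‖(L.comp (S.op s.toNNReal)).comp B‖ := by
  refine measurable_of_Iic fun c => ?_
  by_cases hc : 0 ≤ c
  · have : (fun s : ℝ => ‖(L.comp (S.op s.toNNReal)).comp B‖) ⁻¹' Set.Iic c =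
        ⋂ h : H, {s : ℝ | ‖L (S.op s.toNNReal (B h))‖ ≤ c * ‖h‖} := by
      ext s
      simp only [Set.mem_preimage, Set.mem_Iic, Set.mem_iInter, Set.mem_ofPred_eq]
      exact ContinuousLinearMap.opNorm_le_iff hc
    rw [this]
    refine IsClosed.measurableSet (isClosed_iInter fun h => isClosed_le ?_ continuous_const)
    exact (L.continuous.comp (S.continuous_orbit_real (B h))).norm
  · have : (fun s : ℝ => ‖(L.comp (S.op s.toNNReal)).comp B‖) ⁻¹' Set.Iic c = ∅ := by
      ext s
      simp only [Set.mem_preimage, Set.mem_Iic, Set.mem_empty_iff_false, iff_false, not_le]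
      exact (not_le.1 hc).trans_le (norm_nonneg _)
    rw [this]
    exact MeasurableSet.empty

omit [CompleteSpace H] in
theorem intervalIntegrable_norm_comp_op (S : C0Semigroup ℝ E) (B : H →L[ℝ] E)
    (L : StrongDual ℝ E) (a b : ℝ) :
    IntervalIntegrable (fun s : ℝ => ‖(L.comp (S.op s.toNNReal)).comp B‖ ^ 2) volume a b := by
  obtain ⟨M, hM⟩ := S.exists_bound_of_le (max a b).toNNReal
  refine (intervalIntegrable_const (c := (‖L‖ * M * ‖B‖) ^ 2)).mono_fun
    ((measurable_norm_comp_op S B L).pow_const 2).aestronglyMeasurable ?_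
  refine (ae_restrict_iff' measurableSet_uIoc).2 (Eventually.of_forall fun s hs => ?_)
  have h1 : s ≤ max a b := (Set.mem_Ioc.1 hs).2
  have h2 : ‖(L.comp (S.op s.toNNReal)).comp B‖ ≤ ‖L‖ * M * ‖B‖ := by
    refine (ContinuousLinearMap.opNorm_comp_le _ _).trans ?_
    gcongr
    refine (ContinuousLinearMap.opNorm_comp_le _ _).trans ?_
    gcongr
    exact hM _ (Real.toNNReal_le_toNNReal h1)
  simp only [norm_pow, norm_norm]
  exact pow_le_pow_left₀ (norm_nonneg _) (h2.trans (le_abs_self _)) 2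

theorem covForm_self_add (S : C0Semigroup ℝ E) (B : H →L[ℝ] E) (s t : ℝ≥0)
    (L : StrongDual ℝ E) :
    covForm S B (s + t) L L =
      covForm S B t L L + covForm S B s (L.comp (S.op t)) (L.comp (S.op t)) := by
  simp only [covForm_self]
  rw [← intervalIntegral.integral_add_adjacent_intervals
    (intervalIntegrable_norm_comp_op S B L 0 t) (intervalIntegrable_norm_comp_op S B L t _)]
  congr 1
  have h1 := intervalIntegral.integral_comp_add_right (a := 0) (b := (s : ℝ))
    (fun r : ℝ => ‖(L.comp (S.op r.toNNReal)).comp B‖ ^ 2) (t : ℝ)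
  rw [zero_add] at h1
  rw [NNReal.coe_add, ← h1]
  refine intervalIntegral.integral_congr fun r hr => ?_
  rw [Set.uIcc_of_le s.coe_nonneg] at hr
  have h2 : (r + t).toNNReal = t + r.toNNReal := by
    rw [Real.toNNReal_add hr.1 t.coe_nonneg, Real.toNNReal_coe, add_comm]
  simp only [h2, S.op_add]
  rfl

theorem tendsto_covForm_self_zero (S : C0Semigroup ℝ E) (B : H →L[ℝ] E) (L : StrongDual ℝ E) :
    Tendsto (fun t => covForm S B t L L) (𝓝 0) (𝓝 0) := by
  have h1 : Continuous fun b : ℝ =>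
      ∫ s in (0 : ℝ)..b, ‖(L.comp (S.op s.toNNReal)).comp B‖ ^ 2 :=
    intervalIntegral.continuous_primitive (intervalIntegrable_norm_comp_op S B L) 0
  have h2 := (h1.comp NNReal.continuous_coe).tendsto (0 : ℝ≥0)
  simpa [Function.comp_def, covForm_self] using h2

/-- The diagonal of `Q_∞ = Q_t + S(t) Q_∞ S(t)*`, obtained by letting `s → ∞` in the cocycle
identity for `Q_{s+t}`. -/
theorem limit_covForm_self (S : C0Semigroup ℝ E) (B : H →L[ℝ] E) {Q : StrongDual ℝ E →L[ℝ] E}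
    (hQ : ∀ x' y' : StrongDual ℝ E,
      Tendsto (fun t => covForm S B t x' y') atTop (𝓝 (y' (Q x'))))
    (t : ℝ≥0) (L : StrongDual ℝ E) :
    L (Q L) = covForm S B t L L + (L.comp (S.op t)) (Q (L.comp (S.op t))) := by
  refine tendsto_nhds_unique ((hQ L L).comp (tendsto_atTop_mono (fun _ => le_self_add) tendsto_id :
    Tendsto (fun s : ℝ≥0 => s + t) atTop atTop)) ?_
  refine ((hQ (L.comp (S.op t)) (L.comp (S.op t))).const_add (covForm S B t L L)).congr fun s => ?_
  exact (covForm_self_add S B s t L).symm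

end CovForm

theorem covariance_eq_zero_of_forall {Q : StrongDual ℝ E →L[ℝ] E} {L : StrongDual ℝ E}
    (hL : ∀ x ∈ Q.range.topologicalClosure, L x = 0) : L (Q L) = 0 :=
  hL _ (Q.range.le_topologicalClosure ⟨L, rfl⟩)

variable [MeasurableSpace E] [BorelSpace E]

theorem IsCentredGaussianRadon.memLp_dual {μ : Measure E}
    {q : StrongDual ℝ E → StrongDual ℝ E → ℝ} (h : IsCentredGaussianRadon μ q)
    (L : StrongDual ℝ E) {p : ℝ≥0∞} (hp : p ≠ ∞) : MemLp L p μ :=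
  have := h.isGaussian
  IsGaussian.memLp_dual μ L p hp

theorem IsCentredGaussianRadon.charFunDual_eq {μ : Measure E}
    {q : StrongDual ℝ E → StrongDual ℝ E → ℝ} (h : IsCentredGaussianRadon μ q)
    (L : StrongDual ℝ E) : charFunDual μ L = Complex.exp (-(q L L : ℝ) / 2) := by
  have := h.isGaussian
  rw [IsGaussian.charFunDual_eq_of_forall_strongDual_eq_zero h.centred,
    variance_of_integral_eq_zero (by fun_prop) (h.centred L)]
  simp only [sq, h.covariance]

variable {Q : StrongDual ℝ E →L[ℝ] E} {m : Measure E}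

theorem IsCentredGaussianRadon.ae_eq_zero
    (h : IsCentredGaussianRadon m fun x' y' => y' (Q x')) {L : StrongDual ℝ E}
    (hL : L (Q L) = 0) : ∀ᵐ x ∂m, L x = 0 := by
  have h1 : ∫ x, L x * L x ∂m = 0 := (h.covariance L L).trans hL
  have h2 : Integrable (fun x => L x * L x) m := by
    simpa [sq] using (h.memLp_dual L (p := 2) (by norm_num)).integrable_sq
  rw [integral_eq_zero_iff_of_nonneg (fun x => mul_self_nonneg _) h2] at h1
  filter_upwards [h1] with x hx
  exact mul_self_eq_zero.1 hx

/-- If `L` has variance zero it vanishes almost everywhere, so its covariance with every `x'` is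
zero. -/
theorem IsCentredGaussianRadon.apply_eq_zero
    (h : IsCentredGaussianRadon m fun x' y' => y' (Q x')) {L : StrongDual ℝ E}
    (hL : L (Q L) = 0) : ∀ x ∈ Q.range.topologicalClosure, L x = 0 := by
  have h1 : Q.range.topologicalClosure ≤ LinearMap.ker (L : E →ₗ[ℝ] ℝ) := by
    refine Submodule.topologicalClosure_minimal _ ?_ L.isClosed_ker
    rintro _ ⟨x', rfl⟩
    change L (Q x') = 0
    rw [← h.covariance x' L]
    refine integral_eq_zero_of_ae ?_
    filter_upwards [h.ae_eq_zero hL] with x hx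
    simp [hx]
  exact fun x hx => h1 hx

theorem IsCentredGaussianRadon.covariance_nonneg
    (h : IsCentredGaussianRadon m fun x' y' => y' (Q x')) (L : StrongDual ℝ E) : 0 ≤ L (Q L) := by
  rw [← h.covariance L L]
  exact integral_nonneg fun x => mul_self_nonneg _

end Covariance

/-! ### The Ornstein-Uhlenbeck semigroup in `L¹` -/

section OUSemigroup

variable {E : Type*} [NormedAddCommGroup E] [NormedSpace ℝ E] [CompleteSpace E]
    [MeasurableSpace E] [BorelSpace E]
    {H : Type*} [NormedAddCommGroup H] [InnerProductSpace ℝ H] [CompleteSpace H]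
    {S : C0Semigroup ℝ E} {B : H →L[ℝ] E}
    {μ : ℝ≥0 → Measure E} [∀ t, IsProbabilityMeasure (μ t)]
    (hμ : ∀ t, IsCentredGaussianRadon (μ t) (covForm S B t))
    {Q : StrongDual ℝ E →L[ℝ] E}
    (hQ : ∀ x' y' : StrongDual ℝ E, Tendsto (fun t => covForm S B t x' y') atTop (𝓝 (y' (Q x'))))
    {m : Measure E} [IsProbabilityMeasure m]
    (hm : IsCentredGaussianRadon m (fun x' y' => y' (Q x')))

-- If `L` vanishes on `E_∞`, then `0 = ⟨Q_t L, L⟩ + ⟨Q_∞ S(t)*L, S(t)*L⟩` with both terms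
-- nonnegative; so `S(t)*L` has variance zero and vanishes on `E_∞` as well. Hahn-Banach concludes.
omit [IsProbabilityMeasure m] in
include hQ hm in
theorem op_mem_closure_range (t : ℝ≥0) :
    ∀ x ∈ Q.range.topologicalClosure, S.op t x ∈ Q.range.topologicalClosure := by
  intro x hx
  by_contra hn
  obtain ⟨L, hL, hLx⟩ := exists_functional_of_notMem
    (Submodule.isClosed_topologicalClosure _) hn
  have h1 := limit_covForm_self S B hQ t L
  rw [covariance_eq_zero_of_forall hL] at h1
  have h2 := covForm_self_nonneg S B t L
  have h3 := hm.covariance_nonneg (L.comp (S.op t))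
  exact hLx (hm.apply_eq_zero (L := L.comp (S.op t)) (by linarith) x hx)

omit [∀ t, IsProbabilityMeasure (μ t)] [IsProbabilityMeasure m] in
include hμ hQ hm in
theorem charFunDual_mul_op (t : ℝ≥0) (L : StrongDual ℝ E) :
    charFunDual (μ t) L * charFunDual m (L.comp (S.op t)) = charFunDual m L := by
  rw [(hμ t).charFunDual_eq, hm.charFunDual_eq, hm.charFunDual_eq, ← Complex.exp_add,
    limit_covForm_self S B hQ t L]
  push_cast
  ring_nf

include hμ hQ hm in
theorem isInvariantLaw_op (t : ℝ≥0) : IsInvariantLaw (S.op t) (μ t) m :=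
  isInvariantLaw_of_charFunDual (hasSeparableSupport_of_innerRegular (hμ t).innerRegular)
    (hasSeparableSupport_of_innerRegular hm.innerRegular) (charFunDual_mul_op hμ hQ hm t)

theorem tendsto_of_dense_span {X : Type*} [NormedAddCommGroup X] [NormedSpace ℂ X] {ι : Type*}
    {l : Filter ι} {P : ι → X →L[ℂ] X} (hP : ∀ i, ‖P i‖ ≤ 1) {s : Set X}
    (hs : Dense (Submodule.span ℂ s : Set X)) (h : ∀ x ∈ s, Tendsto (fun i => P i x) l (𝓝 x))
    (x : X) : Tendsto (fun i => P i x) l (𝓝 x) := by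
  have hspan : ∀ x ∈ Submodule.span ℂ s, Tendsto (fun i => P i x) l (𝓝 x) := by
    intro x hx
    induction hx using Submodule.span_induction with
    | mem x hx => exact h x hx
    | zero => simpa using tendsto_const_nhds
    | add x y _ _ hx hy => simpa using hx.add hy
    | smul c x _ hx => simpa using hx.const_smul c
  rw [Metric.tendsto_nhds]
  intro ε hε
  obtain ⟨y, hy, hyx⟩ := hs.exists_dist_lt x (ε := ε / 3) (by positivity)
  filter_upwards [Metric.tendsto_nhds.1 (hspan y hy) (ε / 3) (by positivity)] with i hi
  have h1 : dist (P i x) (P i y) ≤ dist x y := by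
    rw [dist_eq_norm, dist_eq_norm, ← map_sub]
    simpa using (P i).le_of_opNorm_le (hP i) (x - y)
  calc dist (P i x) x ≤ dist (P i x) (P i y) + dist (P i y) y + dist y x := dist_triangle4 _ _ _ _
    _ < ε / 3 + ε / 3 + ε / 3 := by
      rw [dist_comm y x]
      gcongr
      exact h1.trans_lt hyx
    _ = ε := by ring

/-- The Ornstein-Uhlenbeck semigroup in `L¹` of the invariant measure. -/
def ouSemigroup : C0Semigroup ℂ (Lp ℂ 1 m) where
  op t := transitionL1 (S.op t) (μ t) m
  op_zero := by
    -- All three axioms are checked on characters, which span a dense subspace; contractivity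
    -- carries strong continuity over to the closure.
    have hd := (hasSeparableSupport_of_innerRegular hm.innerRegular).dense_span_probCharDual
    refine ContinuousLinearMap.ext_on hd ?_
    rintro _ ⟨L, rfl⟩
    rw [(isInvariantLaw_op hμ hQ hm 0).transitionL1_probCharDual, (hμ 0).charFunDual_eq, S.op_zero]
    simp [covForm]
  op_add s t := by
    have hd := (hasSeparableSupport_of_innerRegular hm.innerRegular).dense_span_probCharDual
    refine ContinuousLinearMap.ext_on hd ?_
    rintro _ ⟨L, rfl⟩
    rw [ContinuousLinearMap.comp_apply, (isInvariantLaw_op hμ hQ hm _).transitionL1_probCharDual,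
      (isInvariantLaw_op hμ hQ hm _).transitionL1_probCharDual, map_smul,
      (isInvariantLaw_op hμ hQ hm _).transitionL1_probCharDual, smul_smul,
      (hμ _).charFunDual_eq, (hμ _).charFunDual_eq, (hμ _).charFunDual_eq, covForm_self_add,
      ← Complex.exp_add, add_comm s t, S.op_add]
    congr 2
    push_cast
    ring
  tendsto_zero := by
    have hd := (hasSeparableSupport_of_innerRegular hm.innerRegular).dense_span_probCharDual
    refine tendsto_of_dense_span (fun t => (isInvariantLaw_op hμ hQ hm t).norm_transitionL1_le) hd ?_
    rintro _ ⟨L, rfl⟩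
    simp only [(isInvariantLaw_op hμ hQ hm _).transitionL1_probCharDual, (hμ _).charFunDual_eq]
    rw [← one_smul ℂ (BoundedContinuousFunction.toLp 1 m ℂ (probCharDual L))]
    have h1 : Tendsto (fun t => BoundedContinuousFunction.toLp 1 m ℂ
        (probCharDual (L.comp (S.op t)))) (𝓝 0)
        (𝓝 (BoundedContinuousFunction.toLp 1 m ℂ (probCharDual L))) := by
      rw [tendsto_iff_norm_sub_tendsto_zero]
      simp only [← map_sub, norm_toLp_one]
      have h2 : Tendsto (fun t => ∫ x, ‖(probCharDual (L.comp (S.op t)) - probCharDual L :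
          E →ᵇ ℂ) x‖ ∂m) (𝓝 0) (𝓝 (∫ x : E, (0 : ℝ) ∂m)) := by
        refine tendsto_integral_filter_of_dominated_convergence (fun _ => 2)
          (Eventually.of_forall fun t => ?_) (Eventually.of_forall fun t =>
          Eventually.of_forall fun x => ?_) (integrable_const _) (Eventually.of_forall fun x => ?_)
        · exact (BoundedContinuousFunction.continuous _).norm.aestronglyMeasurable
        · rw [norm_norm, BoundedContinuousFunction.sub_apply]
          refine (norm_sub_le _ _).trans ?_
          simp only [probCharDual_apply, Complex.norm_exp_ofReal_mul_I]
          norm_num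
        · have h3 : Continuous fun y : E => probCharDual L y := (probCharDual L).continuous
          have h4 := ((h3.tendsto x).comp (S.tendsto_zero x)).sub_const (probCharDual L x)
          simpa [Function.comp_def, probCharDual_apply] using h4.norm
      simpa using h2
    refine Tendsto.smul ?_ h1
    have h5 : Continuous fun r : ℝ => Complex.exp (-(r : ℂ) / 2) := by fun_prop
    simpa [Function.comp_def] using (h5.tendsto 0).comp (tendsto_covForm_self_zero S B L)

include hμ hQ hm in
theorem re_nonpos_of_mem_spec {z : ℂ} (hz : z ∈ spec (ouGenerator S μ m)) : z.re ≤ 0 := by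
  by_contra! h
  exact hz (hasBoundedInverse_shift_of_contraction (ouSemigroup hμ hQ hm)
    (fun t => (isInvariantLaw_op hμ hQ hm t).norm_transitionL1_le) h)

end OUSemigroup

/-! ### Eigenvectors from bounded holomorphic families -/

section Holomorphic

/-- A sector with vertex at `-δ`. -/
def sector (δ : ℝ) : Set ℂ := {v | |v.im| < δ + v.re}

theorem isOpen_sector (δ : ℝ) : IsOpen (sector δ) :=
  isOpen_lt (by fun_prop) (by fun_prop)

theorem convex_sector (δ : ℝ) : Convex ℝ (sector δ) := by
  intro v hv w hw a b ha hb hab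
  simp only [sector, Set.mem_ofPred_eq, Complex.add_im, Complex.add_re, Complex.real_smul,
    Complex.re_ofReal_mul, Complex.im_ofReal_mul] at *
  have h1 : |a * v.im + b * w.im| ≤ a * |v.im| + b * |w.im| := by
    refine (abs_add_le _ _).trans ?_
    rw [abs_mul, abs_mul, abs_of_nonneg ha, abs_of_nonneg hb]
  have h2 : δ = a * δ + b * δ := by rw [← add_mul, hab, one_mul]
  have h3 : 0 < a * (δ + v.re - |v.im|) + b * (δ + w.re - |w.im|) := by
    rcases ha.eq_or_lt with rfl | ha'
    · have : b = 1 := by linarith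
      subst this
      linarith
    · have h4 : 0 < a * (δ + v.re - |v.im|) := mul_pos ha' (by linarith)
      have h5 : 0 ≤ b * (δ + w.re - |w.im|) := mul_nonneg hb (by linarith)
      linarith
  nlinarith

theorem smul_mem_sector {δ : ℝ} (hδ : 0 ≤ δ) {c : ℝ} (hc : 0 < c) (hc1 : c ≤ 1) {v : ℂ}
    (hv : v ∈ sector δ) : (c : ℂ) * v ∈ sector δ := by
  simp only [sector, Set.mem_ofPred_eq, Complex.re_ofReal_mul, Complex.im_ofReal_mul] at *
  rw [abs_mul, abs_of_pos hc]
  nlinarith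

theorem ofReal_mem_sector {δ : ℝ} {v : ℝ} (hv : -δ < v) : (v : ℂ) ∈ sector δ := by
  simp only [sector, Set.mem_ofPred_eq, Complex.ofReal_im, Complex.ofReal_re, abs_zero]
  linarith

variable {X : Type*} [NormedAddCommGroup X] [NormedSpace ℂ X]

theorem hasDerivAt_iteratedDeriv [CompleteSpace X] {Φ : ℂ → X} {Ω : Set ℂ} (hΩ : IsOpen Ω)
    (hΦ : DifferentiableOn ℂ Φ Ω) (n : ℕ) {v : ℂ} (hv : v ∈ Ω) :
    HasDerivAt (iteratedDeriv n Φ) (iteratedDeriv (n + 1) Φ v) v := by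
  rw [iteratedDeriv_succ, hasDerivAt_deriv_iff]
  have h1 : AnalyticOnNhd ℂ (deriv^[n] Φ) Ω := (hΦ.analyticOnNhd hΩ).iterated_deriv n
  rw [← iteratedDeriv_eq_iterate] at h1
  exact (h1 v hv).differentiableAt

theorem map_iteratedDeriv [CompleteSpace X] {Φ : ℂ → X} {Ω : Set ℂ} (hΩ : IsOpen Ω)
    (hΦ : DifferentiableOn ℂ Φ Ω) {T : X →L[ℂ] X} {c : ℂ} (hc : ∀ v ∈ Ω, c * v ∈ Ω)
    (h : ∀ v ∈ Ω, T (Φ v) = Φ (c * v)) (n : ℕ) :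
    ∀ v ∈ Ω, T (iteratedDeriv n Φ v) = c ^ n • iteratedDeriv n Φ (c * v) := by
  induction n with
  | zero => simpa using h
  | succ n ih =>
    intro v hv
    have h1 : HasDerivAt (fun v => T (iteratedDeriv n Φ v)) (T (iteratedDeriv (n + 1) Φ v)) v :=
      T.hasFDerivAt.comp_hasDerivAt v (hasDerivAt_iteratedDeriv hΩ hΦ n hv)
    have h2 : HasDerivAt (fun v => c ^ n • iteratedDeriv n Φ (c * v))
        (c ^ n • ((c * 1) • iteratedDeriv (n + 1) Φ (c * v))) v :=
      ((hasDerivAt_iteratedDeriv hΩ hΦ n (hc v hv)).scomp v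
        ((hasDerivAt_id v).const_mul c)).const_smul _
    have h3 := h1.unique (h2.congr_of_eventuallyEq
      (Filter.eventually_of_mem (hΩ.mem_nhds hv) ih))
    rw [h3, mul_one, smul_smul, pow_succ]

theorem functional_iteratedDeriv [CompleteSpace X] {Φ : ℂ → X} {Ω : Set ℂ} (hΩ : IsOpen Ω)
    (hΦ : DifferentiableOn ℂ Φ Ω) {ℓ : X →L[ℂ] ℂ} {a κ : ℂ}
    (h : ∀ v ∈ Ω, ℓ (Φ v) = a * Complex.exp (-(κ * v))) (n : ℕ) :
    ∀ v ∈ Ω, ℓ (iteratedDeriv n Φ v) = (-κ) ^ n * a * Complex.exp (-(κ * v)) := by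
  induction n with
  | zero => simpa using h
  | succ n ih =>
    intro v hv
    have h1 : HasDerivAt (fun v => ℓ (iteratedDeriv n Φ v)) (ℓ (iteratedDeriv (n + 1) Φ v)) v :=
      ℓ.hasFDerivAt.comp_hasDerivAt v (hasDerivAt_iteratedDeriv hΩ hΦ n hv)
    have h2 : HasDerivAt (fun v => (-κ) ^ n * a * Complex.exp (-(κ * v)))
        ((-κ) ^ n * a * (Complex.exp (-(κ * v)) * (-(κ * 1)))) v :=
      (((hasDerivAt_id v).const_mul κ).fun_neg.cexp).const_mul _
    have h3 := h1.unique (h2.congr_of_eventuallyEq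
      (Filter.eventually_of_mem (hΩ.mem_nhds hv) ih))
    rw [h3]
    ring

theorem norm_iteratedDeriv_le_of_sector [CompleteSpace X] {δ : ℝ} {Φ : ℂ → X}
    (hΦ : DifferentiableOn ℂ Φ (sector δ)) {C : ℝ} (hC : ∀ v ∈ sector δ, ‖Φ v‖ ≤ C) (n : ℕ)
    {v : ℝ} (hv : -δ < v) :
    ‖iteratedDeriv n Φ v‖ ≤ n.factorial * C / ((δ + v) / 3) ^ n := by
  have hsub : Metric.closedBall (v : ℂ) ((δ + v) / 3) ⊆ sector δ := by
    intro w hw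
    rw [mem_closedBall_iff_norm] at hw
    have h1 := (Complex.abs_im_le_norm _).trans hw
    have h2 := (abs_le.1 ((Complex.abs_re_le_norm _).trans hw)).1
    simp only [Complex.sub_im, Complex.ofReal_im, sub_zero, Complex.sub_re,
      Complex.ofReal_re] at h1 h2
    simp only [sector, Set.mem_ofPred_eq]
    linarith
  refine Complex.norm_iteratedDeriv_le_of_forall_mem_sphere_norm_le n (by linarith) ?_
    fun w hw => hC w (hsub (Metric.sphere_subset_closedBall hw))
  refine DifferentiableOn.diffContOnCl (hΦ.mono ?_)
  exact Metric.closure_ball_subset_closedBall.trans hsub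

/-- Cauchy's estimate decays like `v^{-n}` at infinity, and it stays bounded at `0` because the
vertex of the sector is at `-δ < 0`. -/
theorem mellinConvergent_iteratedDeriv [CompleteSpace X] {δ : ℝ} (hδ : 0 < δ) {Φ : ℂ → X}
    (hΦ : DifferentiableOn ℂ Φ (sector δ)) {C : ℝ} (hC : ∀ v ∈ sector δ, ‖Φ v‖ ≤ C) (n : ℕ)
    {w : ℂ} (hw : 0 < w.re) (hwn : w.re < n) :
    MellinConvergent (fun v : ℝ => iteratedDeriv n Φ v) w := by
  have hC0 : 0 ≤ C := (norm_nonneg _).trans (hC 0 (by simpa [sector] using hδ))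
  refine mellinConvergent_of_isBigO_rpow (a := n) (b := 0) ?_ ?_ hwn ?_ hw
  · refine ContinuousOn.locallyIntegrableOn (fun v hv => ?_) measurableSet_Ioi
    have h1 := (hasDerivAt_iteratedDeriv (isOpen_sector δ) hΦ n
      (ofReal_mem_sector (by linarith [Set.mem_Ioi.1 hv] : -δ < v))).continuousAt
    exact (ContinuousAt.comp (f := fun v : ℝ => (v : ℂ)) h1
      Complex.continuous_ofReal.continuousAt).continuousWithinAt
  · refine Asymptotics.IsBigO.of_bound (n.factorial * C * 3 ^ n) ?_
    filter_upwards [eventually_gt_atTop 0] with v hv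
    refine (norm_iteratedDeriv_le_of_sector hΦ hC n (by linarith)).trans ?_
    rw [Real.rpow_neg hv.le, Real.rpow_natCast, norm_inv, norm_pow, Real.norm_of_nonneg hv.le,
      div_pow, div_div_eq_mul_div, ← div_eq_mul_inv]
    gcongr
    linarith
  · refine Asymptotics.IsBigO.of_bound (n.factorial * C / (δ / 3) ^ n) ?_
    filter_upwards [self_mem_nhdsWithin] with v hv
    have hv : 0 < v := hv
    refine (norm_iteratedDeriv_le_of_sector hΦ hC n (by linarith)).trans ?_
    rw [neg_zero, Real.rpow_zero, norm_one, mul_one]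
    gcongr
    linarith

/-- A bounded holomorphic family in a sector on which a semigroup acts by dilations yields
eigenvectors by means of the Mellin transform. -/
theorem exists_eigenvector_of_sector [CompleteSpace X] {T : ℝ≥0 → X →L[ℂ] X} {δ : ℝ} (hδ : 0 < δ)
    {Φ : ℂ → X} (hΦ : DifferentiableOn ℂ Φ (sector δ)) {C : ℝ} (hC : ∀ v ∈ sector δ, ‖Φ v‖ ≤ C)
    {α : ℝ} (hα : α < 0)
    (hT : ∀ t, ∀ v ∈ sector δ, T t (Φ v) = Φ ((Real.exp (2 * α * (t : ℝ)) : ℝ) * v))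
    {ℓ : X →L[ℂ] ℂ} {a : ℂ} (ha : a ≠ 0) {κ : ℝ} (hκ : 0 < κ)
    (hℓ : ∀ v ∈ sector δ, ℓ (Φ v) = a * Complex.exp (-(κ * v))) {z : ℂ} (hz : z.re < 0) :
    ∃ f : X, f ≠ 0 ∧ ∀ t, T t f = Complex.exp ((t : ℝ) * z) • f := by
  set s : ℂ := z / (-2 * α : ℝ) with hs
  have hsre : s.re < 0 := by
    rw [hs, Complex.div_ofReal_re]
    exact div_neg_of_neg_of_pos hz (by linarith)
  have hsz : s * (-2 * α : ℝ) = z :=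
    div_mul_cancel₀ _ (Complex.ofReal_ne_zero.2 (by linarith : (-2 * α) ≠ 0))
  -- Since `Re s < 0`, the Mellin integral of `Φ` itself need not converge at `0`; `n` derivatives
  -- move the exponent to `0 < Re (s + n) < n`.
  obtain ⟨n, hn⟩ := exists_nat_gt (-s.re)
  set w : ℂ := s + n with hw
  have hwre : w.re = s.re + n := by simp [hw]
  have hw0 : 0 < w.re := by linarith
  have hconv := mellinConvergent_iteratedDeriv hδ hΦ hC n hw0 (by linarith)
  set G : ℝ → X := fun v => iteratedDeriv n Φ v with hG
  refine ⟨mellin G w, fun h0 => ?_, fun t => ?_⟩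
  -- Under `ℓ` the integral becomes `(-κ)ⁿ a κ^{-w} Γ(w)`, which is nonzero.
  · have h1 : ℓ (mellin G w) = ∫ v in Set.Ioi (0 : ℝ), ((-κ : ℂ) ^ n * a) *
        ((v : ℂ) ^ (w - 1) * Complex.exp (-(κ * v))) := by
      rw [mellin, ← ContinuousLinearMap.integral_comp_comm ℓ hconv]
      refine setIntegral_congr_fun measurableSet_Ioi fun v hv => ?_
      have hv : 0 < v := hv
      simp only [map_smul, hG, smul_eq_mul]
      rw [functional_iteratedDeriv (isOpen_sector δ) hΦ hℓ n _
        (ofReal_mem_sector (by linarith : -δ < v))]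
      ring
    rw [h0, map_zero, integral_const_mul, Complex.integral_cpow_mul_exp_neg_mul_Ioi hw0 hκ] at h1
    have hκ' : (κ : ℂ) ≠ 0 := Complex.ofReal_ne_zero.2 hκ.ne'
    refine mul_ne_zero (mul_ne_zero (pow_ne_zero _ (neg_ne_zero.2 hκ')) ha)
      (mul_ne_zero ?_ (Complex.Gamma_ne_zero_of_re_pos hw0)) h1.symm
    rw [Complex.cpow_ne_zero_iff]
    exact Or.inl (one_div_ne_zero hκ')
  · set c : ℝ := Real.exp (2 * α * (t : ℝ)) with hc
    have hc0 : 0 < c := Real.exp_pos _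
    have hc1 : c ≤ 1 := Real.exp_le_one_iff.2 (mul_nonpos_of_nonpos_of_nonneg (by linarith)
      t.coe_nonneg)
    have h1 : T t (mellin G w) = (c : ℂ) ^ n • mellin (fun v => G (c * v)) w := by
      rw [mellin, ← ContinuousLinearMap.integral_comp_comm _ hconv, mellin, ← integral_smul]
      refine setIntegral_congr_fun measurableSet_Ioi fun v hv => ?_
      have hv : 0 < v := hv
      simp only [map_smul, hG]
      rw [map_iteratedDeriv (isOpen_sector δ) hΦ (fun v hv => smul_mem_sector hδ.le hc0 hc1 hv)
        (hT t) n _ (ofReal_mem_sector (by linarith : -δ < v)), smul_comm, Complex.ofReal_mul]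
    -- The derivatives contribute `cⁿ` and the Mellin transform `c^{-w}`; the product `c^{-s}`
    -- equals `e^{tz}` by the choice of `s`.
    rw [h1, mellin_comp_mul_left _ _ hc0, smul_smul]
    congr 1
    have hc' : (c : ℂ) ≠ 0 := Complex.ofReal_ne_zero.2 hc0.ne'
    rw [← Complex.cpow_natCast, ← Complex.cpow_add _ _ hc', hw, Complex.cpow_def_of_ne_zero hc',
      ← Complex.ofReal_log hc0.le, hc, Real.log_exp, ← hsz]
    congr 1
    push_cast
    ring

theorem isEigenvalue_generator_of_forall {T : ℝ≥0 → X →L[ℂ] X} {z : ℂ} {f : X} (hf : f ≠ 0)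
    (h : ∀ t, T t f = Complex.exp ((t : ℝ) * z) • f) : IsEigenvalue (generator T) z := by
  have h1 : HasDerivAt (fun r : ℝ => Complex.exp ((r : ℂ) * z)) z 0 := by
    have := ((hasDerivAt_id (0 : ℝ)).ofReal_comp.mul_const z).cexp
    simpa using this
  have h2 : IsGeneratorValue T f (z • f) := by
    rw [hasDerivAt_iff_tendsto_slope_zero] at h1
    have h3 : Tendsto (fun t : ℝ≥0 => (t : ℝ)) (𝓝[>] 0) (𝓝[≠] 0) := by
      refine tendsto_nhdsWithin_iff.2 ⟨?_, ?_⟩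
      · exact (NNReal.continuous_coe.tendsto' 0 0 rfl).mono_left nhdsWithin_le_nhds
      · filter_upwards [self_mem_nhdsWithin] with t ht
        exact (NNReal.coe_pos.2 ht).ne'
    refine ((h1.comp h3).smul_const f).congr fun t => ?_
    simp only [Function.comp_apply, zero_add, Complex.ofReal_zero, zero_mul, Complex.exp_zero, h,
      sub_smul, one_smul, smul_assoc, smul_sub]
    have h4 : ∀ y : X, (((t : ℝ) : ℂ)⁻¹) • y = (t : ℝ)⁻¹ • y := fun y => by
      rw [← Complex.ofReal_inv, Complex.coe_smul]
    exact congrArg₂ (· - ·) (h4 _).symm (h4 _).symm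
  obtain ⟨hd, hgz⟩ := h2.exists_generator_eq
  exact ⟨⟨f, hd⟩, hf, hgz⟩

end Holomorphic

/-! ### Gaussian integrals -/

section GaussianIntegral

theorem gaussianPDFReal_smul_cexp (θ c : ℂ) (a : ℝ) :
    gaussianPDFReal 0 1 a • Complex.exp (θ * (a : ℂ) ^ 2 / 2 + c * a) =
      ((√(2 * Real.pi))⁻¹ : ℝ) *
        Complex.exp (-((1 - θ) / 2) * (a : ℂ) ^ 2 + c * a + 0) := by
  rw [gaussianPDFReal, Complex.real_smul, NNReal.coe_one, mul_one, sub_zero, Complex.ofReal_mul,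
    mul_assoc, Complex.ofReal_exp, ← Complex.exp_add]
  congr 2
  push_cast
  ring

theorem integrable_cexp_gaussian {θ : ℂ} (hθ : θ.re < 1) (c : ℂ) :
    Integrable (fun a : ℝ => Complex.exp (θ * (a : ℂ) ^ 2 / 2 + c * a)) (gaussianReal 0 1) := by
  rw [gaussianReal_of_var_ne_zero 0 one_ne_zero,
    integrable_withDensity_iff_integrable_smul' (measurable_gaussianPDF _ _)
      (ae_of_all _ fun _ => gaussianPDF_lt_top)]
  simp only [toReal_gaussianPDF, gaussianPDFReal_smul_cexp]
  refine Integrable.const_mul (integrable_cexp_quadratic ?_ c 0) _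
  rw [Complex.div_ofNat_re, Complex.sub_re, Complex.one_re]
  linarith

theorem integral_cexp_gaussian {θ : ℂ} (hθ : θ.re < 1) (c : ℂ) :
    ∫ a : ℝ, Complex.exp (θ * (a : ℂ) ^ 2 / 2 + c * a) ∂gaussianReal 0 1 =
      ((1 - θ) ^ (1 / 2 : ℂ))⁻¹ * Complex.exp (c ^ 2 / (2 * (1 - θ))) := by
  have hre : 0 < (1 - θ).re := by simpa using hθ
  have h0 : 1 - θ ≠ 0 := fun h => by rw [h] at hre; simp at hre
  have hb : (-((1 - θ) / 2)).re < 0 := by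
    rw [Complex.neg_re, Complex.div_ofNat_re]
    linarith
  rw [integral_gaussianReal_eq_integral_smul one_ne_zero]
  simp only [gaussianPDFReal_smul_cexp]
  rw [integral_const_mul, integral_cexp_quadratic hb, ← mul_assoc]
  have h2π : 0 < 2 * Real.pi := by positivity
  congr 1
  · have h1 : (Real.pi : ℂ) / - -((1 - θ) / 2) = ((2 * Real.pi : ℝ) : ℂ) * (1 - θ)⁻¹ := by
      rw [neg_neg]
      push_cast
      field_simp
    have h2 : (((2 * Real.pi : ℝ) : ℂ) * (1 - θ)⁻¹) ^ (1 / 2 : ℂ) =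
        ((2 * Real.pi : ℝ) : ℂ) ^ (1 / 2 : ℂ) * ((1 - θ)⁻¹) ^ (1 / 2 : ℂ) := by
      rw [Complex.cpow_def_of_ne_zero, Complex.cpow_def_of_ne_zero, Complex.cpow_def_of_ne_zero,
        Complex.log_ofReal_mul h2π (inv_ne_zero h0), add_mul, Complex.exp_add,
        Complex.ofReal_log h2π.le]
      · exact inv_ne_zero h0
      · exact Complex.ofReal_ne_zero.2 h2π.ne'
      · exact mul_ne_zero (Complex.ofReal_ne_zero.2 h2π.ne') (inv_ne_zero h0)
    have h3 : ((2 * Real.pi : ℝ) : ℂ) ^ (1 / 2 : ℂ) = (√(2 * Real.pi) : ℝ) := by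
      rw [Real.sqrt_eq_rpow, Complex.ofReal_cpow h2π.le]
      norm_num
    have h4 : ((√(2 * Real.pi) : ℝ) : ℂ) ≠ 0 :=
      Complex.ofReal_ne_zero.2 (Real.sqrt_pos.2 h2π).ne'
    rw [h1, h2, h3, Complex.inv_cpow _ _ (Complex.mem_slitPlane_iff_arg.1 (Or.inl hre)).1,
      Complex.ofReal_inv, inv_mul_cancel_left₀ h4]
  · congr 1
    field_simp
    ring

theorem integrable_exp_gaussian {θ : ℝ} (hθ : θ < 1) :
    Integrable (fun a : ℝ => Real.exp (θ * a ^ 2 / 2)) (gaussianReal 0 1) := by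
  have h := (integrable_cexp_gaussian (θ := θ) (by simpa using hθ) 0).norm
  refine h.congr (Eventually.of_forall fun a => ?_)
  simp only [Complex.norm_exp]
  norm_cast
  simp

theorem integral_exp_gaussian {θ : ℝ} (hθ : θ < 1) :
    ∫ a : ℝ, Real.exp (θ * a ^ 2 / 2) ∂gaussianReal 0 1 = (√(1 - θ))⁻¹ := by
  have h := integral_cexp_gaussian (θ := θ) (by simpa using hθ) 0
  have h1 : ∀ a : ℝ, Complex.exp ((θ : ℂ) * (a : ℂ) ^ 2 / 2 + 0 * a) =
      ((Real.exp (θ * a ^ 2 / 2) : ℝ) : ℂ) := fun a => by push_cast; simp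
  simp only [h1, integral_complex_ofReal] at h
  rw [Real.sqrt_eq_rpow, ← Complex.ofReal_inj, h, Complex.ofReal_inv,
    Complex.ofReal_cpow (by linarith)]
  simp

end GaussianIntegral

/-! ### Joint law of two uncorrelated functionals. -/

section JointLaw

variable {E : Type*} [NormedAddCommGroup E] [NormedSpace ℝ E] [MeasurableSpace E] [BorelSpace E]
  {Q : StrongDual ℝ E →L[ℝ] E} {m : Measure E} [IsProbabilityMeasure m]

omit [IsProbabilityMeasure m] in
theorem charFunDual_smul_add_smul (hm : IsCentredGaussianRadon m fun x' y' => y' (Q x'))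
    {U V : StrongDual ℝ E} (hUV : V (Q U) = 0) (a b : ℝ) :
    charFunDual m (a • U + b • V) =
      Complex.exp (-((a ^ 2 * U (Q U) + b ^ 2 * V (Q V) : ℝ) : ℂ) / 2) := by
  have hVU : U (Q V) = 0 := by
    rw [← hm.covariance V U, ← hUV, ← hm.covariance U V]
    simp only [mul_comm]
  rw [hm.charFunDual_eq]
  congr 4
  simp only [map_add, map_smul, _root_.add_apply, _root_.smul_apply, smul_eq_mul, hUV,
    hVU]
  ring

theorem charFun_gaussian (c : ℝ) :
    ∫ a : ℝ, Complex.exp ((c * a : ℝ) * Complex.I) ∂gaussianReal 0 1 =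
      Complex.exp (-((c ^ 2 : ℝ) : ℂ) / 2) := by
  have h := integral_cexp_gaussian (θ := 0) (by simp) (c * Complex.I)
  simp only [sub_zero, Complex.one_cpow, inv_one, one_mul, mul_one, mul_pow, Complex.I_sq] at h
  convert! h using 2
  · ext a
    congr 1
    push_cast
    ring
  · push_cast
    ring

/-- Uncorrelated jointly Gaussian variables are independent. Scaling standard Gaussians also covers
the case of zero variance, which `V` may have. -/
theorem map_pair_eq (hm : IsCentredGaussianRadon m fun x' y' => y' (Q x'))
    {U V : StrongDual ℝ E} (hUV : V (Q U) = 0) :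
    m.map (fun x => (U x, V x)) = ((gaussianReal 0 1).prod (gaussianReal 0 1)).map
      (fun w : ℝ × ℝ => (√(U (Q U)) * w.1, √(V (Q V)) * w.2)) := by
  have : IsProbabilityMeasure (m.map (fun x => (U x, V x))) :=
    Measure.isProbabilityMeasure_map (by fun_prop)
  have : IsProbabilityMeasure (((gaussianReal 0 1).prod (gaussianReal 0 1)).map
      (fun w : ℝ × ℝ => (√(U (Q U)) * w.1, √(V (Q V)) * w.2))) :=
    Measure.isProbabilityMeasure_map (by fun_prop)
  refine Measure.ext_of_charFunDual (funext fun L => ?_)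
  have hL : ∀ w : ℝ × ℝ, L w = L (1, 0) * w.1 + L (0, 1) * w.2 := fun w => by
    have : w = w.1 • ((1 : ℝ), (0 : ℝ)) + w.2 • ((0 : ℝ), (1 : ℝ)) := by ext <;> simp
    conv_lhs => rw [this, map_add, map_smul, map_smul, smul_eq_mul, smul_eq_mul]
    ring
  have hcont : Continuous fun w : ℝ × ℝ => Complex.exp (L w * Complex.I) := by fun_prop
  rw [charFunDual_apply, charFunDual_apply, integral_map (by fun_prop)
    hcont.aestronglyMeasurable, integral_map (by fun_prop) hcont.aestronglyMeasurable]
  have h1 := charFunDual_smul_add_smul hm hUV (L (1, 0)) (L (0, 1))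
  rw [charFunDual_apply] at h1
  have h2 : ∀ x, L (U x, V x) = (L (1, 0) • U + L (0, 1) • V) x := fun x => by rw [hL]; rfl
  simp only [h2, h1]
  have h3 : ∀ w : ℝ × ℝ, Complex.exp (L (√(U (Q U)) * w.1, √(V (Q V)) * w.2) * Complex.I) =
      Complex.exp ((L (1, 0) * √(U (Q U)) * w.1 : ℝ) * Complex.I) *
        Complex.exp ((L (0, 1) * √(V (Q V)) * w.2 : ℝ) * Complex.I) := fun w => by
    rw [hL, ← Complex.exp_add]
    congr 1
    push_cast
    ring
  simp only [h3]
  rw [integral_prod_mul (fun a : ℝ => Complex.exp ((L (1, 0) * √(U (Q U)) * a : ℝ) * Complex.I))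
    (fun b : ℝ => Complex.exp ((L (0, 1) * √(V (Q V)) * b : ℝ) * Complex.I)), charFun_gaussian,
    charFun_gaussian, ← Complex.exp_add, mul_pow, mul_pow, Real.sq_sqrt (hm.covariance_nonneg U),
    Real.sq_sqrt (hm.covariance_nonneg V)]
  congr 1
  push_cast
  ring

variable {𝕜 : Type*} [RCLike 𝕜] {f g : ℝ → 𝕜}

theorem integral_mul_pair (hm : IsCentredGaussianRadon m fun x' y' => y' (Q x'))
    {U V : StrongDual ℝ E} (hUV : V (Q U) = 0) (hf : Continuous f) (hg : Continuous g) :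
    ∫ x, f (U x) * g (V x) ∂m = (∫ a, f (√(U (Q U)) * a) ∂gaussianReal 0 1) *
      ∫ b, g (√(V (Q V)) * b) ∂gaussianReal 0 1 := by
  have hcont : Continuous fun w : ℝ × ℝ => f w.1 * g w.2 := by fun_prop
  have h1 := integral_map (μ := m) (φ := fun x => (U x, V x)) (by fun_prop)
    (hcont.aestronglyMeasurable)
  rw [map_pair_eq hm hUV, integral_map (by fun_prop) hcont.aestronglyMeasurable] at h1
  rw [← h1]
  exact integral_prod_mul (fun a => f (√(U (Q U)) * a)) (fun b => g (√(V (Q V)) * b))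

theorem integrable_mul_pair (hm : IsCentredGaussianRadon m fun x' y' => y' (Q x'))
    {U V : StrongDual ℝ E} (hUV : V (Q U) = 0) (hf : Continuous f) (hg : Continuous g)
    (hfi : Integrable (fun a => f (√(U (Q U)) * a)) (gaussianReal 0 1))
    (hgi : Integrable (fun b => g (√(V (Q V)) * b)) (gaussianReal 0 1)) :
    Integrable (fun x => f (U x) * g (V x)) m := by
  have hcont : Continuous fun w : ℝ × ℝ => f w.1 * g w.2 := by fun_prop
  have h1 := integrable_map_measure (μ := m) (f := fun x => (U x, V x))
    (hcont.aestronglyMeasurable) (by fun_prop)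
  refine h1.1 ?_
  rw [map_pair_eq hm hUV, integrable_map_measure hcont.aestronglyMeasurable (by fun_prop)]
  exact hfi.mul_prod hgi

end JointLaw

/-! ### A holomorphic family of Gaussian functions -/

section Family

/-- The functions `(1 + p v)^{-1/2} exp(v u² / (2 (1 + p v)))`. -/
def gaussFamily (p : ℝ) (v : ℂ) (u : ℝ) : ℂ :=
  ((1 + v * p) ^ (1 / 2 : ℂ))⁻¹ * Complex.exp (v / (1 + v * p) * (u : ℂ) ^ 2 / 2)

theorem continuous_gaussFamily (p : ℝ) (v : ℂ) : Continuous (gaussFamily p v) := by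
  unfold gaussFamily
  fun_prop

variable {p δ : ℝ} {v : ℂ}

/-- The condition `p δ ≤ 1` puts `1 + v p` in the sector of half-angle `π/4` about the positive
axis; the square root is then holomorphic and the real part is comparable to the modulus. -/
theorem abs_im_lt_re_of_mem_sector (hp : 0 ≤ p) (hpδ : p * δ ≤ 1) (hv : v ∈ sector δ) :
    |(1 + v * p).im| ≤ (1 + v * p).re ∧ 0 < (1 + v * p).re := by
  simp only [sector, Set.mem_ofPred_eq] at hv
  simp only [Complex.add_im, Complex.one_im, Complex.mul_im, Complex.ofReal_re, Complex.ofReal_im,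
    mul_zero, zero_add, Complex.add_re, Complex.one_re, Complex.mul_re, sub_zero]
  rw [abs_mul, abs_of_nonneg hp]
  have h0 := abs_nonneg v.im
  rcases hp.eq_or_lt with rfl | hp'
  · simp
  · constructor
    · nlinarith
    · nlinarith

theorem mem_slitPlane_of_mem_sector (hp : 0 ≤ p) (hpδ : p * δ ≤ 1) (hv : v ∈ sector δ) :
    1 + v * p ∈ Complex.slitPlane := Or.inl (abs_im_lt_re_of_mem_sector hp hpδ hv).2

theorem differentiableOn_gaussFamily (hp : 0 ≤ p) (hpδ : p * δ ≤ 1) (u : ℝ) :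
    DifferentiableOn ℂ (fun v => gaussFamily p v u) (sector δ) := by
  intro v hv
  have h1 := mem_slitPlane_of_mem_sector hp hpδ hv
  have h0 : 1 + v * p ≠ 0 := Complex.slitPlane_ne_zero h1
  have hd : DifferentiableAt ℂ (fun v : ℂ => 1 + v * p) v := by fun_prop
  refine DifferentiableAt.differentiableWithinAt ?_
  unfold gaussFamily
  refine ((hd.cpow (differentiableAt_const _) h1).inv ?_).mul ?_
  · rw [Complex.cpow_ne_zero_iff]
    exact Or.inl h0
  · exact (((differentiableAt_id.div hd h0).mul_const _).div_const _).cexp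

theorem one_sub_div_eq (h0 : 1 + v * p ≠ 0) : 1 - v * p / (1 + v * p) = (1 + v * p)⁻¹ := by
  field_simp
  ring

theorem re_div_lt (hp : 0 ≤ p) (hpδ : p * δ ≤ 1) (hv : v ∈ sector δ) :
    (v * p / (1 + v * p)).re < 1 := by
  have h1 := mem_slitPlane_of_mem_sector hp hpδ hv
  have h0 : 1 + v * p ≠ 0 := Complex.slitPlane_ne_zero h1
  have h2 := congrArg Complex.re (one_sub_div_eq h0)
  rw [Complex.sub_re, Complex.one_re, Complex.inv_re] at h2
  have h3 : 0 < (1 + v * p).re / Complex.normSq (1 + v * p) :=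
    div_pos (abs_im_lt_re_of_mem_sector hp hpδ hv).2 (Complex.normSq_pos.2 h0)
  linarith

theorem gaussFamily_sqrt_mul (hp : 0 ≤ p) (v : ℂ) (a : ℝ) :
    gaussFamily p v (√p * a) = ((1 + v * p) ^ (1 / 2 : ℂ))⁻¹ *
      Complex.exp (v * p / (1 + v * p) * (a : ℂ) ^ 2 / 2) := by
  have h1 : (((√p * a : ℝ) : ℂ)) ^ 2 = p * (a : ℂ) ^ 2 := by
    rw [← Complex.ofReal_pow, mul_pow, Real.sq_sqrt hp]
    push_cast
    rfl
  rw [gaussFamily, h1]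
  congr 2
  ring

theorem integrable_gaussFamily (hp : 0 ≤ p) (hpδ : p * δ ≤ 1) (hv : v ∈ sector δ) :
    Integrable (fun a => gaussFamily p v (√p * a)) (gaussianReal 0 1) := by
  simp only [gaussFamily_sqrt_mul hp]
  refine Integrable.const_mul ?_ _
  simpa using integrable_cexp_gaussian (re_div_lt hp hpδ hv) 0

theorem integral_gaussFamily_mul_cexp (hp : 0 ≤ p) (hpδ : p * δ ≤ 1) (hv : v ∈ sector δ)
    (c : ℝ) : ∫ a, gaussFamily p v (√p * a) * Complex.exp ((c * (√p * a) : ℝ) * Complex.I)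
      ∂gaussianReal 0 1 = Complex.exp (-((c ^ 2 * p : ℝ) * (1 + v * p) / 2)) := by
  have h1 := mem_slitPlane_of_mem_sector hp hpδ hv
  have h0 : 1 + v * p ≠ 0 := Complex.slitPlane_ne_zero h1
  have h2 : ∀ a : ℝ, gaussFamily p v (√p * a) *
      Complex.exp ((c * (√p * a) : ℝ) * Complex.I) = ((1 + v * p) ^ (1 / 2 : ℂ))⁻¹ *
      Complex.exp (v * p / (1 + v * p) * (a : ℂ) ^ 2 / 2 + (c * √p : ℝ) * Complex.I * a) := by
    intro a
    rw [gaussFamily_sqrt_mul hp, mul_assoc, ← Complex.exp_add]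
    congr 3
    push_cast
    ring
  have h3 : (((c * √p : ℝ) : ℂ) * Complex.I) ^ 2 = -((c ^ 2 * p : ℝ) : ℂ) := by
    rw [mul_pow, Complex.I_sq, ← Complex.ofReal_pow, mul_pow, Real.sq_sqrt hp, mul_neg_one]
  have h4 : (1 + v * p) ^ (1 / 2 : ℂ) ≠ 0 := by
    rw [Complex.cpow_ne_zero_iff]
    exact Or.inl h0
  simp only [h2]
  rw [integral_const_mul, integral_cexp_gaussian (re_div_lt hp hpδ hv), one_sub_div_eq h0, h3,
    Complex.inv_cpow _ _ (Complex.mem_slitPlane_iff_arg.1 h1).1, inv_inv, inv_mul_cancel_left₀ h4]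
  congr 1
  field_simp

/-- With `w = 1 + v p` the integral equals `(‖w‖ / Re w)^{1/2}`, which is bounded in the sector. -/
theorem integral_norm_gaussFamily_le (hp : 0 ≤ p) (hpδ : p * δ ≤ 1) (hv : v ∈ sector δ) :
    ∫ a, ‖gaussFamily p v (√p * a)‖ ∂gaussianReal 0 1 ≤ 2 := by
  have h1 := mem_slitPlane_of_mem_sector hp hpδ hv
  have h0 : 1 + v * p ≠ 0 := Complex.slitPlane_ne_zero h1
  obtain ⟨h2, h3⟩ := abs_im_lt_re_of_mem_sector hp hpδ hv
  have h4 := re_div_lt hp hpδ hv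
  have h5 := congrArg Complex.re (one_sub_div_eq h0)
  rw [Complex.sub_re, Complex.one_re, Complex.inv_re, Complex.normSq_eq_norm_sq] at h5
  set θ := (v * p / (1 + v * p)).re with hθ
  set w := 1 + v * p with hw
  have hw0 : 0 < ‖w‖ := norm_pos_iff.2 h0
  have hnorm : ∀ a : ℝ, ‖gaussFamily p v (√p * a)‖ = (√‖w‖)⁻¹ * Real.exp (θ * a ^ 2 / 2) := by
    intro a
    rw [gaussFamily_sqrt_mul hp, norm_mul, norm_inv, Complex.norm_exp]
    congr 2
    · rw [Real.sqrt_eq_rpow, ← Complex.norm_cpow_real]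
      norm_num [hw]
    · rw [Complex.div_ofNat_re, ← Complex.ofReal_pow, Complex.re_mul_ofReal]
  simp only [hnorm]
  rw [integral_const_mul, integral_exp_gaussian h4, h5, ← mul_inv, ← Real.sqrt_mul hw0.le]
  have h6 : ‖w‖ ≤ 2 * w.re := by
    have := Complex.norm_le_abs_re_add_abs_im w
    rw [abs_of_pos h3] at this
    linarith
  have h7 : (1 / 2 : ℝ) ^ 2 ≤ ‖w‖ * (w.re / ‖w‖ ^ 2) := by
    rw [← mul_div_assoc, le_div_iff₀ (by positivity)]
    nlinarith
  calc (√(‖w‖ * (w.re / ‖w‖ ^ 2)))⁻¹ ≤ (1 / 2 : ℝ)⁻¹ := by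
        gcongr
        exact Real.le_sqrt_of_sq_le h7
    _ = 2 := by norm_num

/-- The strict inequality `Re (v / (1 + v p)) p < 1` leaves room for a slightly larger exponent `θ`
that serves a whole neighbourhood of `v` and is still Gaussian integrable. -/
theorem exists_dominated_gaussFamily (hp : 0 ≤ p) (hpδ : p * δ ≤ 1) (hv : v ∈ sector δ) :
    ∃ θ C : ℝ, θ * p < 1 ∧
      ∀ᶠ w in 𝓝 v, ∀ u, ‖gaussFamily p w u‖ ≤ C * Real.exp (θ * u ^ 2 / 2) := by
  have h1 := mem_slitPlane_of_mem_sector hp hpδ hv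
  have h0 : 1 + v * p ≠ 0 := Complex.slitPlane_ne_zero h1
  have hc : ContinuousAt (fun w : ℂ => 1 + w * p) v := by fun_prop
  have hc1 : ContinuousAt (fun w : ℂ => ‖((1 + w * p) ^ (1 / 2 : ℂ))⁻¹‖) v := by
    refine ((hc.cpow continuousAt_const h1).inv₀ ?_).norm
    rw [Complex.cpow_ne_zero_iff]
    exact Or.inl h0
  have hc2 : ContinuousAt (fun w : ℂ => (w / (1 + w * p)).re) v :=
    Complex.continuous_re.continuousAt.comp (continuousAt_id.div hc h0)
  have h2 : (v / (1 + v * p)).re * p < 1 := by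
    have := re_div_lt hp hpδ hv
    rwa [mul_div_right_comm, Complex.re_mul_ofReal] at this
  obtain ⟨θ, hθ, hθp⟩ : ∃ θ, (v / (1 + v * p)).re < θ ∧ θ * p < 1 := by
    have h3 : ContinuousAt (fun θ : ℝ => θ * p) (v / (1 + v * p)).re := by fun_prop
    have h4 : ∀ᶠ θ in 𝓝 (v / (1 + v * p)).re, θ * p < 1 := h3.eventually_lt_const h2
    obtain ⟨ε, hε, h5⟩ := Metric.eventually_nhds_iff.1 h4
    exact ⟨_, lt_add_of_pos_right _ (half_pos hε), h5 (by
      rw [Real.dist_eq, add_sub_cancel_left, abs_of_pos (half_pos hε)]; linarith)⟩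
  refine ⟨θ, ‖((1 + v * p) ^ (1 / 2 : ℂ))⁻¹‖ + 1, hθp, ?_⟩
  filter_upwards [hc1.eventually_lt_const (lt_add_one _), hc2.eventually_lt_const hθ] with w hw1 hw2
  intro u
  rw [gaussFamily, norm_mul, Complex.norm_exp, Complex.div_ofNat_re, ← Complex.ofReal_pow,
    Complex.re_mul_ofReal]
  gcongr

/-- The exponential of a negative square is linearized: at negative parameters the function is a
superposition of the characters `e^{iτau}`. -/
theorem gaussFamily_neg {τ : ℝ} (hτ : τ ^ 2 * p < 1) (u : ℝ) :
    gaussFamily p (-(τ ^ 2 : ℝ)) u = ∫ a : ℝ, Complex.exp ((τ ^ 2 * p : ℝ) * (a : ℂ) ^ 2 / 2 +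
      (τ * u : ℝ) * Complex.I * a) ∂gaussianReal 0 1 := by
  rw [integral_cexp_gaussian (by rwa [Complex.ofReal_re])]
  have h1 : (1 : ℂ) + -(τ ^ 2 : ℝ) * p = 1 - (τ ^ 2 * p : ℝ) := by
    push_cast
    ring
  have h2 : (1 : ℂ) - (τ ^ 2 * p : ℝ) ≠ 0 := by
    rw [← Complex.ofReal_one, ← Complex.ofReal_sub]
    exact Complex.ofReal_ne_zero.2 (by linarith)
  rw [gaussFamily, h1]
  congr 2
  rw [mul_pow, Complex.I_sq]
  push_cast at h2 ⊢
  field_simp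

end Family

/-! ### Holomorphic families in `L¹` -/

section HolomorphicL1

/-- The Schwarz lemma applied to `f`, and then to its difference quotient `dslope f c`. The bounds
are linear in `M`, so they can be integrated when `M` depends on a point. -/
theorem norm_deriv_le_of_forall_ball {f : ℂ → ℂ} {c : ℂ} {R M : ℝ} (hR : 0 < R)
    (hf : DifferentiableOn ℂ f (Metric.ball c R)) (hM : ∀ v ∈ Metric.ball c R, ‖f v‖ ≤ M) :
    ‖deriv f c‖ ≤ 2 * M / R ∧ ∀ w ∈ Metric.ball c R,
      ‖f w - f c - (w - c) * deriv f c‖ ≤ 4 * M / R ^ 2 * ‖w - c‖ ^ 2 := by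
  have hc : c ∈ Metric.ball c R := Metric.mem_ball_self hR
  have hmaps : Set.MapsTo f (Metric.ball c R) (Metric.closedBall (f c) (2 * M)) := fun v hv => by
    rw [mem_closedBall_iff_norm]
    linarith [norm_sub_le (f v) (f c), hM v hv, hM c hc]
  have h1 : ∀ v ∈ Metric.ball c R, ‖dslope f c v‖ ≤ 2 * M / R := fun v hv =>
    Complex.norm_dslope_le_div_of_mapsTo_ball hf hmaps hv
  have hd : DifferentiableOn ℂ (dslope f c) (Metric.ball c R) :=
    (Complex.differentiableOn_dslope (Metric.ball_mem_nhds c hR)).2 hf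
  have hmaps' : Set.MapsTo (dslope f c) (Metric.ball c R)
      (Metric.closedBall (dslope f c c) (2 * (2 * M / R))) := fun v hv => by
    rw [mem_closedBall_iff_norm]
    linarith [norm_sub_le (dslope f c v) (dslope f c c), h1 v hv, h1 c hc]
  refine ⟨by simpa [dslope_same] using h1 c hc, fun w hw => ?_⟩
  have h2 := Complex.norm_dslope_le_div_of_mapsTo_ball hd hmaps' hw
  have h3 : f w - f c - (w - c) * deriv f c =
      (w - c) * ((w - c) * dslope (dslope f c) c w) := by
    have e1 := sub_smul_dslope f c w
    have e2 := sub_smul_dslope (dslope f c) c w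
    rw [smul_eq_mul] at e1 e2
    rw [e2, dslope_same, ← e1]
    ring
  rw [h3, norm_mul, norm_mul]
  calc ‖w - c‖ * (‖w - c‖ * ‖dslope (dslope f c) c w‖)
      ≤ ‖w - c‖ * (‖w - c‖ * (2 * (2 * M / R) / R)) := by gcongr
    _ = 4 * M / R ^ 2 * ‖w - c‖ ^ 2 := by field_simp; ring

variable {α : Type*} [MeasurableSpace α] {m : Measure α}

/-- A dominated, pointwise holomorphic family of functions is holomorphic in `L¹`. -/
theorem differentiableAt_of_dominated {Φ : ℂ → Lp ℂ 1 m} {F : ℂ → α → ℂ} {c : ℂ} {R : ℝ}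
    (hR : 0 < R) (hΦ : ∀ v ∈ Metric.ball c R, Φ v =ᵐ[m] F v)
    (hF : ∀ x, DifferentiableOn ℂ (fun v => F v x) (Metric.ball c R)) {h : α → ℝ}
    (hh : Integrable h m) (hdom : ∀ v ∈ Metric.ball c R, ∀ x, ‖F v x‖ ≤ h x) :
    DifferentiableAt ℂ Φ c := by
  set D : α → ℂ := fun x => deriv (fun v => F v x) c with hD
  have hc : c ∈ Metric.ball c R := Metric.mem_ball_self hR
  have hbd := fun x => norm_deriv_le_of_forall_ball hR (hF x) (fun v hv => hdom v hv x)
  have hFm : ∀ v ∈ Metric.ball c R, AEStronglyMeasurable (F v) m := fun v hv =>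
    (Lp.aestronglyMeasurable (Φ v)).congr (hΦ v hv)
  have hDm : AEStronglyMeasurable D m := by
    -- The derivative is measurable as a limit of difference quotients; the denominators `n + 2`
    -- keep the increments smaller than `R`.
    have hpos : ∀ n : ℕ, 0 < R / ((n : ℝ) + 2) := fun n => by positivity
    have hball : ∀ n : ℕ, c + ((R / ((n : ℝ) + 2) : ℝ) : ℂ) ∈ Metric.ball c R := fun n => by
      rw [mem_ball_iff_norm, add_sub_cancel_left, Complex.norm_real,
        Real.norm_of_nonneg (hpos n).le]
      exact div_lt_self hR (by linarith [(Nat.cast_nonneg n : (0 : ℝ) ≤ n)])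
    have hlim : Tendsto (fun n : ℕ => ((R / ((n : ℝ) + 2) : ℝ) : ℂ)) atTop (𝓝[≠] 0) := by
      refine tendsto_nhdsWithin_iff.2 ⟨?_, Eventually.of_forall fun n =>
        Complex.ofReal_ne_zero.2 (hpos n).ne'⟩
      have : Tendsto (fun n : ℕ => R / ((n : ℝ) + 2)) atTop (𝓝 0) :=
        tendsto_const_nhds.div_atTop
          (tendsto_atTop_add_const_right _ _ tendsto_natCast_atTop_atTop)
      exact (Complex.continuous_ofReal.tendsto' 0 0 Complex.ofReal_zero).comp this
    refine aestronglyMeasurable_of_tendsto_ae atTop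
      (f := fun (n : ℕ) x => ((R / ((n : ℝ) + 2) : ℝ) : ℂ)⁻¹ •
        (F (c + ((R / ((n : ℝ) + 2) : ℝ) : ℂ)) x - F c x))
      (fun n => ((hFm _ (hball n)).sub (hFm _ hc)).const_smul
        (((R / ((n : ℝ) + 2) : ℝ) : ℂ)⁻¹))
      (Eventually.of_forall fun x => ?_)
    have h1 := ((hF x).differentiableAt (Metric.ball_mem_nhds c hR)).hasDerivAt
    exact (hasDerivAt_iff_tendsto_slope_zero.1 h1).comp hlim
  have hDi : Integrable D m := ((hh.const_mul 2).div_const R).mono' hDm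
    (Eventually.of_forall fun x => (hbd x).1)
  refine HasDerivAt.differentiableAt (f' := hDi.toL1 D) ?_
  rw [hasDerivAt_iff_isLittleO]
  -- The integrated pointwise remainder is of second order.
  refine Asymptotics.IsBigO.trans_isLittleO (g := fun w => ‖w - c‖ ^ 2) ?_ ?_
  · refine Asymptotics.IsBigO.of_bound (4 * (∫ x, h x ∂m) / R ^ 2) ?_
    filter_upwards [Metric.ball_mem_nhds c hR] with w hw
    have h1 : ((Φ w - Φ c - (w - c) • hDi.toL1 D : Lp ℂ 1 m) : α → ℂ) =ᵐ[m]
        fun x => F w x - F c x - (w - c) * D x := by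
      filter_upwards [Lp.coeFn_sub (Φ w - Φ c) ((w - c) • hDi.toL1 D), Lp.coeFn_sub (Φ w) (Φ c),
        Lp.coeFn_smul (w - c) (hDi.toL1 D), hDi.coeFn_toL1, hΦ w hw, hΦ c hc]
        with x e1 e2 e3 e4 e5 e6
      rw [e1, Pi.sub_apply, e2, Pi.sub_apply, e3, Pi.smul_apply, e4, e5, e6, smul_eq_mul]
    rw [L1.norm_eq_integral_norm, norm_pow, norm_norm]
    calc ∫ x, ‖(Φ w - Φ c - (w - c) • hDi.toL1 D : Lp ℂ 1 m) x‖ ∂m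
        ≤ ∫ x, 4 * h x / R ^ 2 * ‖w - c‖ ^ 2 ∂m := by
          refine integral_mono_ae (L1.integrable_coeFn _).norm
            (((hh.const_mul 4).div_const _).mul_const _) ?_
          filter_upwards [h1] with x hx
          rw [hx]
          exact (hbd x).2 w hw
      _ = 4 * (∫ x, h x ∂m) / R ^ 2 * ‖w - c‖ ^ 2 := by
          rw [integral_mul_const, integral_div, integral_const_mul]
  · have h2 := Asymptotics.isLittleO_pow_sub_sub c one_lt_two
    exact h2.norm_left.congr_left fun w => by rw [norm_pow, norm_norm]

end HolomorphicL1

/-! ### The Gaussian family in `L¹` and the Ornstein-Uhlenbeck semigroup -/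

section GaussVector

variable {E : Type*} [NormedAddCommGroup E] [NormedSpace ℝ E] [MeasurableSpace E] [BorelSpace E]

/-- The product of two Gaussian functions. -/
def gaussProduct (p r : ℝ) (U V : StrongDual ℝ E) (v : ℂ) (x : E) : ℂ :=
  gaussFamily p v (U x) * gaussFamily r v (V x)

open Classical in
/-- The class of `gaussProduct` in `L¹`. -/
def gaussVector (m : Measure E) (p r : ℝ) (U V : StrongDual ℝ E) (v : ℂ) : Lp ℂ 1 m :=
  if h : Integrable (gaussProduct p r U V v) m then h.toL1 _ else 0

omit [BorelSpace E] in
theorem coeFn_gaussVector {m : Measure E} {p r : ℝ} {U V : StrongDual ℝ E} {v : ℂ}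
    (h : Integrable (gaussProduct p r U V v) m) :
    gaussVector m p r U V v =ᵐ[m] gaussProduct p r U V v := by
  rw [gaussVector, dif_pos h]
  exact h.coeFn_toL1

variable {Q : StrongDual ℝ E →L[ℝ] E} {m : Measure E} [IsProbabilityMeasure m]
  (hm : IsCentredGaussianRadon m fun x' y' => y' (Q x')) {U V : StrongDual ℝ E}
  (hUV : V (Q U) = 0) {δ : ℝ} (hpδ : U (Q U) * δ ≤ 1) (hrδ : V (Q V) * δ ≤ 1) {v : ℂ}

include hm hUV hpδ hrδ

theorem integrable_gaussProduct (hv : v ∈ sector δ) :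
    Integrable (gaussProduct (U (Q U)) (V (Q V)) U V v) m :=
  integrable_mul_pair hm hUV (continuous_gaussFamily _ _) (continuous_gaussFamily _ _)
    (integrable_gaussFamily (hm.covariance_nonneg U) hpδ hv)
    (integrable_gaussFamily (hm.covariance_nonneg V) hrδ hv)

theorem norm_gaussVector_le (hv : v ∈ sector δ) :
    ‖gaussVector m (U (Q U)) (V (Q V)) U V v‖ ≤ 4 := by
  have h1 := integrable_gaussProduct hm hUV hpδ hrδ hv
  rw [L1.norm_eq_integral_norm]
  have h2 : ∫ x, ‖gaussVector m (U (Q U)) (V (Q V)) U V v x‖ ∂m =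
      ∫ x, ‖gaussFamily (U (Q U)) v (U x)‖ * ‖gaussFamily (V (Q V)) v (V x)‖ ∂m := by
    refine integral_congr_ae ?_
    filter_upwards [coeFn_gaussVector h1] with x hx
    rw [hx, gaussProduct, norm_mul]
  rw [h2, integral_mul_pair hm hUV (continuous_gaussFamily _ _).norm
    (continuous_gaussFamily _ _).norm]
  calc _ ≤ (2 : ℝ) * 2 := mul_le_mul
        (integral_norm_gaussFamily_le (hm.covariance_nonneg U) hpδ hv)
        (integral_norm_gaussFamily_le (hm.covariance_nonneg V) hrδ hv)
        (integral_nonneg fun _ => norm_nonneg _) zero_le_two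
    _ = 4 := by norm_num

theorem differentiableOn_gaussVector :
    DifferentiableOn ℂ (gaussVector m (U (Q U)) (V (Q V)) U V) (sector δ) := by
  intro v hv
  refine DifferentiableAt.differentiableWithinAt ?_
  have hp := hm.covariance_nonneg U
  have hr := hm.covariance_nonneg V
  obtain ⟨θ, C, hθ, h1⟩ := exists_dominated_gaussFamily hp hpδ hv
  obtain ⟨θ', C', hθ', h2⟩ := exists_dominated_gaussFamily hr hrδ hv
  obtain ⟨R, hR, h3⟩ := Metric.eventually_nhds_iff_ball.1
    ((h1.and h2).and ((isOpen_sector δ).mem_nhds hv))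
  have hint : ∀ {q ϑ : ℝ}, 0 ≤ q → ϑ * q < 1 →
      Integrable (fun a : ℝ => Real.exp (ϑ * (√q * a) ^ 2 / 2)) (gaussianReal 0 1) := by
    intro q ϑ hq hϑ
    simpa only [mul_pow, Real.sq_sqrt hq, ← mul_assoc] using integrable_exp_gaussian hϑ
  refine differentiableAt_of_dominated (F := gaussProduct (U (Q U)) (V (Q V)) U V)
    (h := fun x => (C * Real.exp (θ * (U x) ^ 2 / 2)) * (C' * Real.exp (θ' * (V x) ^ 2 / 2))) hR
    (fun w hw => coeFn_gaussVector (integrable_gaussProduct hm hUV hpδ hrδ (h3 w hw).2))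
    (fun x => ?_) ?_ (fun w hw x => ?_)
  · have hsub : Metric.ball v R ⊆ sector δ := fun w hw => (h3 w hw).2
    exact (((differentiableOn_gaussFamily hp hpδ (U x)).mono hsub).mul
      ((differentiableOn_gaussFamily hr hrδ (V x)).mono hsub))
  · exact integrable_mul_pair (f := fun u : ℝ => C * Real.exp (θ * u ^ 2 / 2))
      (g := fun u : ℝ => C' * Real.exp (θ' * u ^ 2 / 2)) hm hUV (by fun_prop) (by fun_prop)
      ((hint hp hθ).const_mul C) ((hint hr hθ').const_mul C')
  · rw [gaussProduct, norm_mul]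
    exact mul_le_mul ((h3 w hw).1.1 _) ((h3 w hw).1.2 _) (norm_nonneg _)
      ((norm_nonneg _).trans ((h3 w hw).1.1 _))

/-- Independence factors the integral; the factor in `V` carries the trivial character and equals
`1`. The exponential dependence on `v` is what detects that the Mellin integral is nonzero. -/
theorem integral_gaussProduct_mul_cexp (hv : v ∈ sector δ) :
    ∫ x, gaussProduct (U (Q U)) (V (Q V)) U V v x * Complex.exp (U x * Complex.I) ∂m =
      Complex.exp (-((U (Q U) : ℝ) * (1 + v * (U (Q U) : ℝ)) / 2)) := by
  have h1 := integral_mul_pair (f := fun u : ℝ => gaussFamily (U (Q U)) v u *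
      Complex.exp (((1 : ℝ) * u : ℝ) * Complex.I)) (g := fun u : ℝ => gaussFamily (V (Q V)) v u *
      Complex.exp (((0 : ℝ) * u : ℝ) * Complex.I)) hm hUV
      ((continuous_gaussFamily _ _).mul (by fun_prop))
      ((continuous_gaussFamily _ _).mul (by fun_prop))
  rw [integral_gaussFamily_mul_cexp (hm.covariance_nonneg U) hpδ hv,
    integral_gaussFamily_mul_cexp (hm.covariance_nonneg V) hrδ hv] at h1
  have h2 : ∀ x, gaussProduct (U (Q U)) (V (Q V)) U V v x * Complex.exp (U x * Complex.I) =
      gaussFamily (U (Q U)) v (U x) * Complex.exp (((1 : ℝ) * U x : ℝ) * Complex.I) *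
      (gaussFamily (V (Q V)) v (V x) * Complex.exp (((0 : ℝ) * V x : ℝ) * Complex.I)) := by
    intro x
    simp [gaussProduct]
    ring
  simp only [h2, h1]
  simp

end GaussVector

/-! ### Pairing with a character. -/

section PairingFunctional

variable {E : Type*} [NormedAddCommGroup E] [NormedSpace ℝ E] [MeasurableSpace E] [BorelSpace E]

theorem integrable_mul_probCharDual {m : Measure E} (U : StrongDual ℝ E) {f : E → ℂ}
    (hf : Integrable f m) : Integrable (fun x => f x * Complex.exp (U x * Complex.I)) m := by
  refine hf.norm.mono' (hf.aestronglyMeasurable.mul ?_) (Eventually.of_forall fun x => ?_)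
  · exact Measurable.aestronglyMeasurable (by fun_prop)
  · rw [norm_mul, Complex.norm_exp_ofReal_mul_I, mul_one]

/-- The functional `f ↦ ∫ f exp(i U)` on `L¹`. -/
def charFunctional (m : Measure E) (U : StrongDual ℝ E) : Lp ℂ 1 m →L[ℂ] ℂ :=
  LinearMap.mkContinuous
    { toFun := fun f => ∫ x, f x * Complex.exp (U x * Complex.I) ∂m
      map_add' := fun f g => by
        rw [← integral_add (integrable_mul_probCharDual U (L1.integrable_coeFn f))
          (integrable_mul_probCharDual U (L1.integrable_coeFn g))]
        refine integral_congr_ae ?_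
        filter_upwards [Lp.coeFn_add f g] with x hx
        rw [hx, Pi.add_apply, add_mul]
      map_smul' := fun c f => by
        rw [RingHom.id_apply, smul_eq_mul, ← integral_const_mul]
        refine integral_congr_ae ?_
        filter_upwards [Lp.coeFn_smul c f] with x hx
        rw [hx, Pi.smul_apply, smul_eq_mul, mul_assoc] } 1 fun f => by
    rw [one_mul, L1.norm_eq_integral_norm]
    refine (norm_integral_le_integral_norm _).trans_eq ?_
    refine integral_congr_ae (Eventually.of_forall fun x => ?_)
    simp only [norm_mul, Complex.norm_exp_ofReal_mul_I, mul_one]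

theorem charFunctional_apply {m : Measure E} (U : StrongDual ℝ E) {f : Lp ℂ 1 m} {g : E → ℂ}
    (h : f =ᵐ[m] g) : charFunctional m U f = ∫ x, g x * Complex.exp (U x * Complex.I) ∂m := by
  refine integral_congr_ae ?_
  filter_upwards [h] with x hx
  rw [hx]

end PairingFunctional

/-! ### Transition operators act on the Gaussian family by dilations -/

section Dilation

/-- The standard Gaussian measure in the plane. -/
abbrev planeGaussian : Measure (ℝ × ℝ) := (gaussianReal 0 1).prod (gaussianReal 0 1)

/-- The weight by which `gaussProduct` is a superposition of characters. -/
def characterWeight (p r τ : ℝ) (w : ℝ × ℝ) : ℝ :=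
  Real.exp (τ ^ 2 * (w.1 ^ 2 * p + w.2 ^ 2 * r) / 2)

theorem continuous_characterWeight (p r τ : ℝ) : Continuous (characterWeight p r τ) := by
  unfold characterWeight
  fun_prop

theorem characterWeight_eq_mul (p r τ : ℝ) (w : ℝ × ℝ) : characterWeight p r τ w =
    Real.exp (τ ^ 2 * p * w.1 ^ 2 / 2) * Real.exp (τ ^ 2 * r * w.2 ^ 2 / 2) := by
  rw [characterWeight, ← Real.exp_add]
  congr 1
  ring

variable {p r τ : ℝ}

theorem integrable_characterWeight (hp : τ ^ 2 * p < 1) (hr : τ ^ 2 * r < 1) :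
    Integrable (characterWeight p r τ) planeGaussian := by
  have h := (integrable_exp_gaussian hp).mul_prod (integrable_exp_gaussian hr)
  exact h.congr (Eventually.of_forall fun w => (characterWeight_eq_mul p r τ w).symm)

theorem integral_rotation (φ : ℝ) {f : ℝ × ℝ → ℂ} (hf : Continuous f) :
    ∫ w : ℝ × ℝ, f (Real.cos φ * w.1 + Real.sin φ * w.2, -Real.sin φ * w.1 + Real.cos φ * w.2)
      ∂planeGaussian = ∫ w, f w ∂planeGaussian := by
  have h1 := IsGaussian.map_rotation_eq_self (μ := gaussianReal 0 1) (by simp) φ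
  have h2 := integral_map (μ := planeGaussian) (φ := ContinuousLinearMap.rotation φ)
    (by fun_prop) (f := f) (hf.aestronglyMeasurable)
  rw [h1] at h2
  exact h2.symm

variable {E : Type*} [NormedAddCommGroup E] [NormedSpace ℝ E] {U V : StrongDual ℝ E}

theorem gaussProduct_neg (hp : τ ^ 2 * p < 1) (hr : τ ^ 2 * r < 1) (x : E) :
    gaussProduct p r U V (-(τ ^ 2 : ℝ)) x = ∫ w, (characterWeight p r τ w : ℂ) *
      Complex.exp ((τ * (w.1 * U x + w.2 * V x) : ℝ) * Complex.I) ∂planeGaussian := by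
  rw [gaussProduct, gaussFamily_neg hp, gaussFamily_neg hr, ← integral_prod_mul]
  refine integral_congr_ae (Eventually.of_forall fun w => ?_)
  simp only
  rw [characterWeight, Complex.ofReal_exp, ← Complex.exp_add, ← Complex.exp_add]
  congr 1
  push_cast
  ring

theorem norm_gaussProduct_neg_le (hp : τ ^ 2 * p < 1) (hr : τ ^ 2 * r < 1) (x : E) :
    ‖gaussProduct p r U V (-(τ ^ 2 : ℝ)) x‖ ≤ ∫ w, characterWeight p r τ w ∂planeGaussian := by
  rw [gaussProduct_neg hp hr]
  refine (norm_integral_le_integral_norm _).trans_eq ?_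
  refine integral_congr_ae (Eventually.of_forall fun w => ?_)
  simp only [norm_mul, Complex.norm_exp_ofReal_mul_I, mul_one, Complex.norm_real,
    Real.norm_of_nonneg (Real.exp_pos _).le, characterWeight]

/-- `gaussProduct` at a negative parameter, as a bounded continuous function. -/
def boundedGaussProduct (U V : StrongDual ℝ E) (hp : τ ^ 2 * p < 1) (hr : τ ^ 2 * r < 1) :
    E →ᵇ ℂ :=
  BoundedContinuousFunction.ofNormedAddCommGroup (gaussProduct p r U V (-(τ ^ 2 : ℝ)))
    (((continuous_gaussFamily _ _).comp U.continuous).mul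
      ((continuous_gaussFamily _ _).comp V.continuous)) _ (norm_gaussProduct_neg_le hp hr)

variable [MeasurableSpace E] [BorelSpace E]

theorem integral_gaussProduct_neg_add (hp : τ ^ 2 * p < 1) (hr : τ ^ 2 * r < 1) (ν : Measure E)
    [IsProbabilityMeasure ν] (x : E) :
    ∫ y, gaussProduct p r U V (-(τ ^ 2 : ℝ)) (x + y) ∂ν =
      ∫ w, (characterWeight p r τ w : ℂ) *
        (charFunDual ν ((τ * w.1) • U + (τ * w.2) • V) *
        Complex.exp ((τ * (w.1 * U x + w.2 * V x) : ℝ) * Complex.I)) ∂planeGaussian := by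
  simp only [gaussProduct_neg hp hr]
  rw [integral_integral_swap]
  · refine integral_congr_ae (Eventually.of_forall fun w => ?_)
    simp only
    rw [integral_const_mul, charFunDual_apply, ← integral_mul_const]
    congr 1
    refine integral_congr_ae (Eventually.of_forall fun y => ?_)
    simp only [map_add, _root_.add_apply, _root_.smul_apply, smul_eq_mul]
    rw [← Complex.exp_add]
    congr 1
    push_cast
    ring
  · refine ((integrable_characterWeight hp hr).comp_snd ν).mono' ?_
      (Eventually.of_forall fun z => ?_)
    · refine Measurable.aestronglyMeasurable ?_
      have h1 : Measurable (characterWeight p r τ) := (continuous_characterWeight p r τ).measurable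
      simp only [Function.uncurry_def, map_add]
      fun_prop
    · simp only [Function.uncurry_def, norm_mul, Complex.norm_exp_ofReal_mul_I, mul_one,
        Complex.norm_real, Real.norm_of_nonneg (Real.exp_pos _).le, characterWeight, le_refl]

variable {Q : StrongDual ℝ E →L[ℝ] E} {m : Measure E} [IsProbabilityMeasure m]
  (hm : IsCentredGaussianRadon m fun x' y' => y' (Q x')) (hUV : V (Q U) = 0)
  {T : E →L[ℝ] E} {ν : Measure E} [IsProbabilityMeasure ν]
  (hν : ∀ L, charFunDual ν L * charFunDual m (L.comp T) = charFunDual m L) {c φ : ℝ}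
  (hU : ∀ᵐ x ∂m, U (T x) = c * (Real.cos φ * U x - Real.sin φ * V x))
  (hV : ∀ᵐ x ∂m, V (T x) = c * (Real.sin φ * U x + Real.cos φ * V x))

include hm hUV hν hU hV

-- For `L = τ(w₁U + w₂V)` the weight is the reciprocal of `charFunDual m L`, so its product with
-- `charFunDual ν L` is the reciprocal of `charFunDual m (L.comp T)`. Almost everywhere `L ∘ T` is
-- the combination with rotated `w` and with `τ` replaced by `τ c`.
omit [IsProbabilityMeasure m] [IsProbabilityMeasure ν] in
theorem characterWeight_mul_charFunDual (w : ℝ × ℝ) :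
    (characterWeight (U (Q U)) (V (Q V)) τ w : ℂ) *
      charFunDual ν ((τ * w.1) • U + (τ * w.2) • V) =
    characterWeight (U (Q U)) (V (Q V)) (τ * c)
      (Real.cos φ * w.1 + Real.sin φ * w.2, -Real.sin φ * w.1 + Real.cos φ * w.2) := by
  have h1 := hν ((τ * w.1) • U + (τ * w.2) • V)
  have h2 : charFunDual m (((τ * w.1) • U + (τ * w.2) • V).comp T) = charFunDual m
      ((τ * c * (Real.cos φ * w.1 + Real.sin φ * w.2)) • U +
        (τ * c * (-Real.sin φ * w.1 + Real.cos φ * w.2)) • V) := by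
    rw [charFunDual_apply, charFunDual_apply]
    refine integral_congr_ae ?_
    filter_upwards [hU, hV] with x h3 h4
    simp only [ContinuousLinearMap.comp_apply, _root_.add_apply, _root_.smul_apply, smul_eq_mul,
      h3, h4]
    congr 3
    ring
  rw [h2, charFunDual_smul_add_smul hm hUV, charFunDual_smul_add_smul hm hUV,
    ← eq_div_iff (Complex.exp_ne_zero _), ← Complex.exp_sub] at h1
  rw [h1, characterWeight, characterWeight, Complex.ofReal_exp, Complex.ofReal_exp,
    ← Complex.exp_add]
  congr 1
  push_cast
  ring

-- `T` rotates the characters by the same angle as it does the weights; the standard planar Gaussian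
-- is rotation invariant, so only the dilation of `τ` remains.
omit [IsProbabilityMeasure m] in
theorem transition_gaussProduct_neg (hp : τ ^ 2 * U (Q U) < 1) (hr : τ ^ 2 * V (Q V) < 1)
    (hpc : (τ * c) ^ 2 * U (Q U) < 1) (hrc : (τ * c) ^ 2 * V (Q V) < 1) :
    ∀ᵐ x ∂m, transition T ν (boundedGaussProduct U V hp hr) x =
      gaussProduct (U (Q U)) (V (Q V)) U V (-((τ * c) ^ 2 : ℝ)) x := by
  filter_upwards [hU, hV] with x h3 h4
  have h1 : transition T ν (boundedGaussProduct U V hp hr) x =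
      ∫ y, gaussProduct (U (Q U)) (V (Q V)) U V (-(τ ^ 2 : ℝ)) (T x + y) ∂ν := rfl
  have hf : Continuous fun w : ℝ × ℝ => (characterWeight (U (Q U)) (V (Q V)) (τ * c) w : ℂ) *
      Complex.exp ((τ * c * (w.1 * U x + w.2 * V x) : ℝ) * Complex.I) := by
    have := continuous_characterWeight (U (Q U)) (V (Q V)) (τ * c)
    fun_prop
  rw [h1, integral_gaussProduct_neg_add hp hr, gaussProduct_neg hpc hrc, ← integral_rotation φ hf]
  refine integral_congr_ae (Eventually.of_forall fun w => ?_)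
  simp only
  rw [← mul_assoc, characterWeight_mul_charFunDual hm hUV hν hU hV, h3, h4]
  congr 4
  ring

/-- At negative parameters the family consists of bounded continuous functions, on which the
operator is given by its integral formula. -/
theorem transitionL1_gaussVector_neg (hinv : IsInvariantLaw T ν m) {δ : ℝ} (hδ : 0 < δ)
    (hpδ : U (Q U) * δ ≤ 1) (hrδ : V (Q V) * δ ≤ 1) (hc0 : 0 < c) (hc1 : c ≤ 1) {v : ℝ}
    (hv : -δ < v) (hv0 : v < 0) :
    transitionL1 T ν m (gaussVector m (U (Q U)) (V (Q V)) U V v) =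
      gaussVector m (U (Q U)) (V (Q V)) U V ((c ^ 2 : ℝ) * v) := by
  have hp := hm.covariance_nonneg U
  have hr := hm.covariance_nonneg V
  have hsmul : ∀ {q s : ℝ}, 0 ≤ q → q * δ ≤ 1 → 0 ≤ s → s < δ → s * q < 1 := by
    intro q s hq hqδ hs hsδ
    rcases hq.eq_or_lt with rfl | hq'
    · simp
    · nlinarith
  obtain ⟨τ, hτ⟩ : ∃ τ : ℝ, τ ^ 2 = -v := ⟨√(-v), Real.sq_sqrt (by linarith)⟩
  have hc2 : c ^ 2 ≤ 1 := pow_le_one₀ hc0.le hc1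
  have hτc : (τ * c) ^ 2 = -v * c ^ 2 := by rw [mul_pow, hτ]
  have hτcδ : (τ * c) ^ 2 < δ := by
    rw [hτc]
    nlinarith
  have hτδ : τ ^ 2 < δ := by linarith
  have e1 : (v : ℂ) = -(τ ^ 2 : ℝ) := by rw [hτ]; simp
  have e2 : ((c ^ 2 : ℝ) : ℂ) * v = -((τ * c) ^ 2 : ℝ) := by
    rw [hτc]
    push_cast
    ring
  have hp1 := hsmul hp hpδ (sq_nonneg τ) hτδ
  have hr1 := hsmul hr hrδ (sq_nonneg τ) hτδ
  have hv1 : (v : ℂ) ∈ sector δ := ofReal_mem_sector hv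
  have hv2 := smul_mem_sector hδ.le (pow_pos hc0 2) hc2 hv1
  have h1 : gaussVector m (U (Q U)) (V (Q V)) U V v =
      BoundedContinuousFunction.toLp 1 m ℂ (boundedGaussProduct U V hp1 hr1) := by
    refine Lp.ext ?_
    filter_upwards [coeFn_gaussVector (integrable_gaussProduct hm hUV hpδ hrδ hv1),
      BoundedContinuousFunction.coeFn_toLp 1 m ℂ (boundedGaussProduct U V hp1 hr1)] with x h1 h2
    rw [h1, h2, e1]
    rfl
  rw [h1, hinv.transitionL1_toLp]
  refine Lp.ext ?_
  filter_upwards [coeFn_gaussVector (integrable_gaussProduct hm hUV hpδ hrδ hv2),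
    BoundedContinuousFunction.coeFn_toLp 1 m ℂ (transition T ν (boundedGaussProduct U V hp1 hr1)),
    transition_gaussProduct_neg hm hUV hν hU hV hp1 hr1 (hsmul hp hpδ (sq_nonneg _) hτcδ)
      (hsmul hr hrδ (sq_nonneg _) hτcδ)] with x h1 h2 h3
  rw [h1, h2, h3, e2]

theorem transitionL1_gaussVector (hinv : IsInvariantLaw T ν m) {δ : ℝ} (hδ : 0 < δ)
    (hpδ : U (Q U) * δ ≤ 1) (hrδ : V (Q V) * δ ≤ 1) (hc0 : 0 < c) (hc1 : c ≤ 1) {v : ℂ}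
    (hv : v ∈ sector δ) :
    transitionL1 T ν m (gaussVector m (U (Q U)) (V (Q V)) U V v) =
      gaussVector m (U (Q U)) (V (Q V)) U V ((c ^ 2 : ℝ) * v) := by
  have hd := differentiableOn_gaussVector hm hUV hpδ hrδ
  have hc2 : c ^ 2 ≤ 1 := pow_le_one₀ hc0.le hc1
  have hmaps : ∀ v ∈ sector δ, ((c ^ 2 : ℝ) : ℂ) * v ∈ sector δ := fun v hv =>
    smul_mem_sector hδ.le (pow_pos hc0 2) hc2 hv
  have hd1 : DifferentiableOn ℂ
      (fun v => transitionL1 T ν m (gaussVector m (U (Q U)) (V (Q V)) U V v)) (sector δ) :=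
    (transitionL1 T ν m).differentiable.comp_differentiableOn hd
  have hd2 : DifferentiableOn ℂ
      (fun v => gaussVector m (U (Q U)) (V (Q V)) U V ((c ^ 2 : ℝ) * v)) (sector δ) :=
    hd.comp (by fun_prop : DifferentiableOn ℂ (fun v : ℂ => ((c ^ 2 : ℝ) : ℂ) * v) (sector δ)) hmaps
  -- The identity theorem in the connected sector: both sides agree on the real interval `(-δ, 0)`,
  -- which accumulates at `-δ/2`.
  refine (hd1.analyticOnNhd (isOpen_sector δ)).eqOn_of_preconnected_of_frequently_eq
    (hd2.analyticOnNhd (isOpen_sector δ)) (convex_sector δ).isPreconnected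
    (ofReal_mem_sector (by linarith : -δ < -(δ / 2))) ?_ hv
  have htend : Tendsto (fun t : ℝ => (t : ℂ)) (𝓝[≠] (-(δ / 2))) (𝓝[≠] ((-(δ / 2) : ℝ) : ℂ)) := by
    refine tendsto_nhdsWithin_iff.2
      ⟨(Complex.continuous_ofReal.tendsto _).mono_left nhdsWithin_le_nhds, ?_⟩
    filter_upwards [self_mem_nhdsWithin] with t ht
    exact fun h => ht (Complex.ofReal_injective h)
  refine htend.frequently (Eventually.frequently ?_)
  have hev : ∀ᶠ t in 𝓝 (-(δ / 2)), t ∈ Set.Ioo (-δ) 0 :=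
    Ioo_mem_nhds (by linarith) (by linarith)
  filter_upwards [hev.filter_mono nhdsWithin_le_nhds] with t ht
  exact transitionL1_gaussVector_neg hm hUV hν hU hV hinv hδ hpδ hrδ hc0 hc1 ht.1 ht.2

end Dilation

/-! ### Eigenvalues of the Ornstein-Uhlenbeck operator -/

section Eigenvalues

/-- A bounded inverse `R` of `z - L` satisfies `1 ≤ |z - w| ‖R‖` for every eigenvalue `w`. -/
theorem mem_spec_of_forall_exists_isEigenvalue {X : Type*} [NormedAddCommGroup X]
    [NormedSpace ℂ X] {L : X →ₗ.[ℂ] X} {z : ℂ}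
    (h : ∀ ε > 0, ∃ w, ‖z - w‖ < ε ∧ IsEigenvalue L w) : z ∈ spec L := by
  rintro ⟨R, -, hR⟩
  obtain ⟨w, hw, f, hf, hfw⟩ := h (‖R‖ + 1)⁻¹ (by positivity)
  have h1 : shift L z f = (z - w) • (f : X) := by
    change z • (f : X) - L f = _
    rw [hfw, sub_smul]
  have h2 : (z - w) • R (f : X) = f := by
    rw [← map_smul, ← h1]
    exact hR f
  have h3 : ‖(f : X)‖ ≤ ‖z - w‖ * (‖R‖ * ‖(f : X)‖) := by
    conv_lhs => rw [← h2, norm_smul]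
    gcongr
    exact R.le_opNorm _
  have h4 : 0 < ‖(f : X)‖ := norm_pos_iff.2 hf
  have h5 : ‖z - w‖ * (‖R‖ + 1) < 1 := by
    have := mul_lt_mul_of_pos_right hw (by positivity : 0 < ‖R‖ + 1)
    rwa [inv_mul_cancel₀ (by positivity)] at this
  nlinarith [norm_nonneg (z - w)]

theorem exists_diagonalizing_angle {p r : ℝ} (κ : ℝ) (h : 0 < p + r) : ∃ ψ : ℝ,
    Real.cos ψ * Real.sin ψ * (p - r) + (Real.cos ψ ^ 2 - Real.sin ψ ^ 2) * κ = 0 ∧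
      0 < Real.cos ψ ^ 2 * p - 2 * Real.cos ψ * Real.sin ψ * κ + Real.sin ψ ^ 2 * r := by
  -- The double angle is chosen so that the rotated covariance matrix is diagonal; the first rotated
  -- variance is then the larger one, `(p + r + ‖w‖)/2`.
  set w : ℂ := ⟨p - r, -(2 * κ)⟩ with hw
  refine ⟨w.arg / 2, ?_⟩
  have h1 : ‖w‖ * Real.cos w.arg = p - r := Complex.norm_mul_cos_arg w
  have h2 : ‖w‖ * Real.sin w.arg = -(2 * κ) := Complex.norm_mul_sin_arg w
  have h3 : Real.cos w.arg = Real.cos (w.arg / 2) ^ 2 - Real.sin (w.arg / 2) ^ 2 := by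
    rw [← Real.cos_two_mul', mul_div_cancel₀ _ two_ne_zero]
  have h4 : Real.sin w.arg = 2 * Real.sin (w.arg / 2) * Real.cos (w.arg / 2) := by
    rw [← Real.sin_two_mul, mul_div_cancel₀ _ two_ne_zero]
  have h5 := Real.sin_sq_add_cos_sq (w.arg / 2)
  have h6 := Real.sin_sq_add_cos_sq w.arg
  generalize Real.cos (w.arg / 2) = c at *
  generalize Real.sin (w.arg / 2) = s at *
  generalize Real.cos w.arg = C at *
  generalize Real.sin w.arg = D at *
  have hκ : κ = -(‖w‖ * D) / 2 := by linarith
  constructor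
  · rw [← h3, ← h1, hκ]
    have : c * s = D / 2 := by rw [h4]; ring
    rw [this]
    ring
  · have h7 : c ^ 2 * p - 2 * c * s * κ + s ^ 2 * r = (p + r) / 2 + ‖w‖ / 2 := by
      have e1 : c ^ 2 = (1 + C) / 2 := by linarith
      have e2 : s ^ 2 = (1 - C) / 2 := by linarith
      have e3 : 2 * c * s = D := by rw [h4]; ring
      rw [e1, e2, e3, hκ]
      linear_combination (C / 2) * (-h1) + (‖w‖ / 2) * h6
    rw [h7]
    have := norm_nonneg w
    linarith

variable {E : Type*} [NormedAddCommGroup E] [NormedSpace ℝ E] [CompleteSpace E]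
    [MeasurableSpace E] [BorelSpace E]
    {H : Type*} [NormedAddCommGroup H] [InnerProductSpace ℝ H] [CompleteSpace H]
    {S : C0Semigroup ℝ E} {B : H →L[ℝ] E}
    {Q : StrongDual ℝ E →L[ℝ] E}
    {m : Measure E}

omit [CompleteSpace E] in
theorem IsCentredGaussianRadon.covariance_comm
    (hm : IsCentredGaussianRadon m (fun x' y' => y' (Q x'))) (U V : StrongDual ℝ E) :
    V (Q U) = U (Q V) := by
  rw [← hm.covariance U V, ← hm.covariance V U]
  simp only [mul_comm]

-- Functionals are known only on `E_∞`; this makes the choice of their extensions to `E` irrelevant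
-- almost everywhere.
omit [CompleteSpace E] in
theorem IsCentredGaussianRadon.ae_eq_of_eqOn
    (hm : IsCentredGaussianRadon m (fun x' y' => y' (Q x'))) {U V : StrongDual ℝ E}
    (h : ∀ x ∈ Q.range.topologicalClosure, U x = V x) : ∀ᵐ x ∂m, U x = V x := by
  have h1 : (U - V) (Q (U - V)) = 0 := covariance_eq_zero_of_forall fun x hx =>
    sub_eq_zero.2 (h x hx)
  filter_upwards [hm.ae_eq_zero h1] with x hx
  exact sub_eq_zero.1 hx

omit [CompleteSpace E] in
theorem IsCentredGaussianRadon.covariance_congr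
    (hm : IsCentredGaussianRadon m (fun x' y' => y' (Q x'))) {U V : StrongDual ℝ E}
    (h : ∀ x ∈ Q.range.topologicalClosure, U x = V x) : U (Q U) = V (Q V) := by
  rw [← hm.covariance U U, ← hm.covariance V V]
  refine integral_congr_ae ?_
  filter_upwards [hm.ae_eq_of_eqOn h] with x hx
  rw [hx]

/-- Real and imaginary part of an eigenfunctional may be chosen uncorrelated. -/
theorem exists_uncorrelated_eigenfunctionals
    (hQ : ∀ x' y' : StrongDual ℝ E, Tendsto (fun t => covForm S B t x' y') atTop (𝓝 (y' (Q x'))))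
    (hm : IsCentredGaussianRadon m (fun x' y' => y' (Q x')))
    (hS : EventuallyCompact S)
    (hA : (complexSpec (partIn (generator S.op) Q.range.topologicalClosure)).Nonempty) :
    ∃ (U V : StrongDual ℝ E) (z : ℂ), V (Q U) = 0 ∧ 0 < U (Q U) ∧
      ∀ t : ℝ≥0, ∀ x ∈ Q.range.topologicalClosure,
        U (S.op t x) = Real.exp (z.re * t) *
          (Real.cos (z.im * t) * U x - Real.sin (z.im * t) * V x) ∧
        V (S.op t x) = Real.exp (z.re * t) *
          (Real.sin (z.im * t) * U x + Real.cos (z.im * t) * V x) := by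
  obtain ⟨z, hz⟩ := hA
  set F := Q.range.topologicalClosure with hF
  have hinv := op_mem_closure_range hQ hm
  obtain ⟨Z, hZ0, hZ⟩ := exists_eigenfunctional S hS F (Submodule.isClosed_topologicalClosure _)
    hinv hz
  obtain ⟨U₁, hU₁, -⟩ := exists_extension_norm_eq F (Complex.reCLM.comp Z)
  obtain ⟨V₁, hV₁, -⟩ := exists_extension_norm_eq F (Complex.imCLM.comp Z)
  replace hU₁ : ∀ x : F, U₁ x = (Z x).re := hU₁
  replace hV₁ : ∀ x : F, V₁ x = (Z x).im := hV₁
  -- If both variances vanished, `Z` would vanish on all of `E_∞`.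
  have hpos : 0 < U₁ (Q U₁) + V₁ (Q V₁) := by
    have h1 := hm.covariance_nonneg U₁
    have h2 := hm.covariance_nonneg V₁
    by_contra! h3
    refine hZ0 (ContinuousLinearMap.ext fun x => Complex.ext ?_ ?_)
    · rw [← hU₁ x]
      exact hm.apply_eq_zero (by linarith) x x.2
    · rw [← hV₁ x]
      exact hm.apply_eq_zero (by linarith) x x.2
  obtain ⟨ψ, h1, h2⟩ := exists_diagonalizing_angle (V₁ (Q U₁)) hpos
  have hcomm := hm.covariance_comm U₁ V₁
  set c := Real.cos ψ with hc
  set s := Real.sin ψ with hs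
  -- These are the real and imaginary parts of `e^{iψ} Z`, which is again an eigenfunctional.
  refine ⟨c • U₁ - s • V₁, s • U₁ + c • V₁, z, ?_, ?_, fun t x hx => ?_⟩
  · simp only [map_sub, map_smul, _root_.add_apply, _root_.smul_apply, smul_eq_mul, ← hcomm]
    linear_combination h1
  · simp only [map_sub, map_smul, _root_.sub_apply, _root_.smul_apply, smul_eq_mul, ← hcomm]
    linarith
  · have h3 := hZ t ⟨x, hx⟩
    have h4 : U₁ (S.op t x) = (Z ((S.restrict F hinv).op t ⟨x, hx⟩)).re := (hU₁ _).symm ▸ rfl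
    have h5 : V₁ (S.op t x) = (Z ((S.restrict F hinv).op t ⟨x, hx⟩)).im := (hV₁ _).symm ▸ rfl
    have h6 : ((t : ℝ) * z).re = z.re * t := by simp [mul_comm]
    have h7 : ((t : ℝ) * z).im = z.im * t := by simp [mul_comm]
    rw [h3, Complex.mul_re, Complex.exp_re, Complex.exp_im, h6, h7] at h4
    rw [h3, Complex.mul_im, Complex.exp_re, Complex.exp_im, h6, h7] at h5
    have h8 := hU₁ ⟨x, hx⟩
    have h9 := hV₁ ⟨x, hx⟩
    simp only at h8 h9
    simp only [_root_.sub_apply, _root_.add_apply, _root_.smul_apply, smul_eq_mul, h4, h5, h8, h9]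
    constructor <;> ring

omit [CompleteSpace E] in
theorem covariance_smul_add_smul (hm : IsCentredGaussianRadon m (fun x' y' => y' (Q x')))
    {U V : StrongDual ℝ E} (hUV : V (Q U) = 0) (a b : ℝ) :
    (a • U + b • V) (Q (a • U + b • V)) = a ^ 2 * U (Q U) + b ^ 2 * V (Q V) := by
  have hVU := (hm.covariance_comm U V).symm.trans hUV
  simp only [map_add, map_smul, _root_.add_apply, _root_.smul_apply, smul_eq_mul, hUV, hVU]
  ring

/-- The variances of `U ∘ S(t)` and `V ∘ S(t)` tend to `0`, while rotation invariance of `sin² +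
cos²` makes their sum `e^{2t Re z}` times the positive sum of the variances of `U` and `V`. -/
theorem re_neg_of_eigenfunctionals
    (hQ : ∀ x' y' : StrongDual ℝ E, Tendsto (fun t => covForm S B t x' y') atTop (𝓝 (y' (Q x'))))
    (hm : IsCentredGaussianRadon m (fun x' y' => y' (Q x'))) {U V : StrongDual ℝ E} {z : ℂ}
    (hUV : V (Q U) = 0) (hU : 0 < U (Q U))
    (h : ∀ t : ℝ≥0, ∀ x ∈ Q.range.topologicalClosure,
        U (S.op t x) = Real.exp (z.re * t) *
          (Real.cos (z.im * t) * U x - Real.sin (z.im * t) * V x) ∧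
        V (S.op t x) = Real.exp (z.re * t) *
          (Real.sin (z.im * t) * U x + Real.cos (z.im * t) * V x)) : z.re < 0 := by
  by_contra! hz
  have hlim : ∀ L : StrongDual ℝ E,
      Tendsto (fun t => (L.comp (S.op t)) (Q (L.comp (S.op t)))) atTop (𝓝 0) := fun L => by
    have h1 := (hQ L L).const_sub (L (Q L))
    rw [sub_self] at h1
    refine h1.congr fun t => ?_
    rw [limit_covForm_self S B hQ t L]
    ring
  have h1 := (hlim U).add (hlim V)
  rw [add_zero] at h1
  have h2 : ∀ t : ℝ≥0, U (Q U) ≤ (U.comp (S.op t)) (Q (U.comp (S.op t))) +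
      (V.comp (S.op t)) (Q (V.comp (S.op t))) := fun t => by
    set e := Real.exp (z.re * t) with he
    set c := Real.cos (z.im * t) with hc
    set s := Real.sin (z.im * t) with hs
    have e1 := hm.covariance_congr (U := U.comp (S.op t)) (V := (e * c) • U + (-(e * s)) • V)
      fun x hx => by
        simp only [ContinuousLinearMap.comp_apply, (h t x hx).1, _root_.add_apply,
          _root_.smul_apply, smul_eq_mul]
        ring
    have e2 := hm.covariance_congr (U := V.comp (S.op t)) (V := (e * s) • U + (e * c) • V)
      fun x hx => by
        simp only [ContinuousLinearMap.comp_apply, (h t x hx).2, _root_.add_apply,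
          _root_.smul_apply, smul_eq_mul]
        ring
    rw [e1, e2, covariance_smul_add_smul hm hUV, covariance_smul_add_smul hm hUV]
    have e3 : s ^ 2 + c ^ 2 = 1 := Real.sin_sq_add_cos_sq _
    have e4 : 1 ≤ e ^ 2 := one_le_pow₀ (Real.one_le_exp (mul_nonneg hz t.coe_nonneg))
    have e5 := hm.covariance_nonneg V
    calc U (Q U) ≤ e ^ 2 * (U (Q U) + V (Q V)) := by nlinarith
      _ = e ^ 2 * (s ^ 2 + c ^ 2) * (U (Q U) + V (Q V)) := by rw [e3, mul_one]
      _ = _ := by ring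
  have h3 := ge_of_tendsto h1 (Eventually.of_forall h2)
  linarith

variable {μ : ℝ≥0 → Measure E} [∀ t, IsProbabilityMeasure (μ t)] [IsProbabilityMeasure m]

theorem isEigenvalue_ouGenerator (hμ : ∀ t, IsCentredGaussianRadon (μ t) (covForm S B t))
    (hQ : ∀ x' y' : StrongDual ℝ E, Tendsto (fun t => covForm S B t x' y') atTop (𝓝 (y' (Q x'))))
    (hm : IsCentredGaussianRadon m (fun x' y' => y' (Q x')))
    (hS : EventuallyCompact S)
    (hA : (complexSpec (partIn (generator S.op) Q.range.topologicalClosure)).Nonempty)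
    {z : ℂ} (hz : z.re < 0) : IsEigenvalue (ouGenerator S μ m) z := by
  obtain ⟨U, V, w, hUV, hU, hUVS⟩ := exists_uncorrelated_eigenfunctionals hQ hm hS hA
  have hw := re_neg_of_eigenfunctionals hQ hm hUV hU hUVS
  have hV := hm.covariance_nonneg V
  set p := U (Q U) with hp
  set r := V (Q V) with hr
  have hpr : 0 < p + r := by linarith
  -- The choice `δ = 1/(p + r)` satisfies both sector conditions, also when `r = 0`.
  have hpδ : p * (1 / (p + r)) ≤ 1 := by
    rw [mul_one_div, div_le_one hpr]
    linarith
  have hrδ : r * (1 / (p + r)) ≤ 1 := by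
    rw [mul_one_div, div_le_one hpr]
    linarith
  have hδ : 0 < 1 / (p + r) := by positivity
  have key : ∃ f : Lp ℂ 1 m, f ≠ 0 ∧
      ∀ t : ℝ≥0, transitionL1 (S.op t) (μ t) m f = Complex.exp ((t : ℝ) * z) • f := by
    refine exists_eigenvector_of_sector
      (T := fun t => transitionL1 (S.op t) (μ t) m) hδ
      (differentiableOn_gaussVector hm hUV hpδ hrδ)
      (fun v hv => norm_gaussVector_le hm hUV hpδ hrδ hv) hw (fun t v hv => ?_)
      (ℓ := charFunctional m U) (a := Complex.exp (-(p / 2))) (Complex.exp_ne_zero _)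
      (κ := p ^ 2 / 2) (by positivity) (fun v hv => ?_) hz
    · have hae := (hm.ae_eq_of_eqOn (U := U.comp (S.op t))
        (V := Real.exp (w.re * t) • (Real.cos (w.im * t) • U - Real.sin (w.im * t) • V))
        fun x hx => (hUVS t x hx).1)
      have hae' := (hm.ae_eq_of_eqOn (U := V.comp (S.op t))
        (V := Real.exp (w.re * t) • (Real.sin (w.im * t) • U + Real.cos (w.im * t) • V))
        fun x hx => (hUVS t x hx).2)
      have h1 := transitionL1_gaussVector hm hUV (charFunDual_mul_op hμ hQ hm t) hae hae'
        (isInvariantLaw_op hμ hQ hm t) hδ hpδ hrδ (Real.exp_pos _)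
        (Real.exp_le_one_iff.2 (mul_nonpos_of_nonpos_of_nonneg hw.le t.coe_nonneg)) hv
      rw [h1, ← Real.exp_nat_mul]
      congr 4
      push_cast
      ring
    · rw [charFunctional_apply U (coeFn_gaussVector (integrable_gaussProduct hm hUV hpδ hrδ hv)),
        integral_gaussProduct_mul_cexp hm hUV hpδ hrδ hv, ← Complex.exp_add]
      congr 1
      push_cast
      ring
  obtain ⟨f, hf, hfT⟩ := key
  exact isEigenvalue_generator_of_forall hf hfT

end Eigenvalues

end

end OrnsteinUhlenbeck

/-! ### Determination of the spectrum. -/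

theorem mainTheorem4
    {E : Type*} [NormedAddCommGroup E] [NormedSpace ℝ E] [CompleteSpace E]
    [MeasurableSpace E] [BorelSpace E]
    {H : Type*} [NormedAddCommGroup H] [InnerProductSpace ℝ H] [CompleteSpace H]
    (S : OrnsteinUhlenbeck.C0Semigroup ℝ E) (B : H →L[ℝ] E)
    (μ : ℝ≥0 → Measure E) [∀ t, IsProbabilityMeasure (μ t)]
    (hμ : ∀ t, OrnsteinUhlenbeck.IsCentredGaussianRadon (μ t) (OrnsteinUhlenbeck.covForm S B t))
    (Qinf : StrongDual ℝ E →L[ℝ] E)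
    (hQinf : ∀ x' y' : StrongDual ℝ E,
      Tendsto (fun t => OrnsteinUhlenbeck.covForm S B t x' y') atTop (𝓝 (y' (Qinf x'))))
    (μinf : Measure E) [IsProbabilityMeasure μinf]
    (hμinf : OrnsteinUhlenbeck.IsCentredGaussianRadon μinf (fun x' y' => y' (Qinf x')))
    (hS : OrnsteinUhlenbeck.EventuallyCompact S)
    (hA : (OrnsteinUhlenbeck.complexSpec
      (OrnsteinUhlenbeck.partIn (OrnsteinUhlenbeck.generator S.op)
        Qinf.range.topologicalClosure)).Nonempty) :
    OrnsteinUhlenbeck.spec (OrnsteinUhlenbeck.ouGenerator S μ μinf) = {z : ℂ | z.re ≤ 0} ∧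
      ∀ z : ℂ, z.re < 0 →
        OrnsteinUhlenbeck.IsEigenvalue (OrnsteinUhlenbeck.ouGenerator S μ μinf) z := by
  have heig : ∀ z : ℂ, z.re < 0 →
      OrnsteinUhlenbeck.IsEigenvalue (OrnsteinUhlenbeck.ouGenerator S μ μinf) z := fun z hz =>
    OrnsteinUhlenbeck.isEigenvalue_ouGenerator hμ hQinf hμinf hS hA hz
  refine ⟨Set.Subset.antisymm
    (fun z hz => OrnsteinUhlenbeck.re_nonpos_of_mem_spec hμ hQinf hμinf hz) fun z hz => ?_, heig⟩
  -- Shifting left by `ε/2` reaches an eigenvalue, even from the imaginary axis.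
  refine OrnsteinUhlenbeck.mem_spec_of_forall_exists_isEigenvalue fun ε hε =>
    ⟨z - (ε / 2 : ℝ), ?_, heig _ ?_⟩
  · rw [sub_sub_cancel, Complex.norm_real, Real.norm_of_nonneg (by positivity)]
    linarith
  · rw [Complex.sub_re, Complex.ofReal_re]
    have : z.re ≤ 0 := hz
    linarith
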